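/- Let $0\le\lambda<2$ and $\beta=(3-2\lambda)^{-1}$ (for $\lambda\neq\tfrac32$). For a sequence $c=(c_k)_{k\ge0}$ put $M_\kappa[c]=\sum_{l\ge1}l^\kappa c_l$, and for $\mu\ge 0$ let $X_\mu^+$ be the set of nonnegative sequences $(c_k)_{k\ge0}$ with $M_\mu[c]<\infty$. Consider the exchange-driven growth system with product kernel $(kl)^\lambda$ (for $\lambda=0$: the kernel that is $1$ if $k,l\ge1$ and $0$ otherwise), $$\dot c_0=M_\lambda[c]\,c_1,\qquad \dot c_1=M_\lambda[c]\,(-2c_1+2^\lambda c_2),$$ $$\dot c_k=M_\lambda[c]\,\bigl((k-1)^\lambda c_{k-1}-2k^\lambda c_k+(k+1)^\lambda c_{k+1}\bigr),\quad k\ge2 .$$ For $T\in(0,\infty]$, a solution on $[0,T)$ with initial data $c^{(0)}\in X^+_{\max(1,\lambda)}$ is a map $c\colon[0,T)\to X^+_{\max(1,\lambda)}$ such that $M_{\max(1,\lambda)}[c(t)]$ is bounded on compact subsets of $[0,T)$, every $t\mapsto c_k(t)$ is continuous, and $c_k(t)=c_k^{(0)}+\int_0^t(\text{right-hand side})_k(s)\,ds$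 for all $k\ge0$ and $t\in[0,T)$. The average cluster size of a solution is $\ell(t)=M_1[c(t)]/M_0[c(t)]$; since mass is conserved, $\ell(t)=\rho/M_0[c(t)]$ with $\rho=M_1[c^{(0)}]$. Consider initial data $c^{(0)}\in X^+_{\max(1,\lambda)}$ with $\rho>0$. Then, with constants $C_1,C_2,K_1,K_2,t_0>0$ that depend only on $\lambda$, $\rho$, $M_0[c^{(0)}]$ and $M_\lambda[c^{(0)}]$: 1. If $0\le\lambda<\tfrac32$, then a global solution (that is, $T=\infty$) with initial data $c^{(0)}$ exists, every solution with initial data $c^{(0)}$ on an interval $[0,T)$ extends to a global solution, and every global solution satisfies $$C_1t^\beta\le\ell(t)\le C_2t^\beta\qquad\text{for all }t\ge t_0 .$$ 2. If $\lambda=\tfrac32$, then a global solution with initial data $c^{(0)}$ exists, every solution with initial data $c^{(0)}$ on an interval $[0,T)$ extends to a global solution, and every global solution satisfies $$K_1e^{C_1t}\le\ell(t)\le K_2e^{C_2t}\qquad\text{for all }t\ge t_0 .$$ 3. If $\tfrac32<\lambda<2$, then there is a finite time $t^*>t_0$, depending on $c^{(0)}$, such that a solution with initial data $c^{(0)}$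 exists on $[0,t^*)$, every solution with initial data $c^{(0)}$ on an interval $[0,T)$ has $T\le t^*$ and extends to a solution on $[0,t^*)$, and every solution on $[0,t^*)$ satisfies $$C_1(t^*-t)^\beta\le\ell(t)\le C_2(t^*-t)^\beta\qquad\text{for all }t_0\le t<t^* .$$ -/

import Mathlib

noncomputable section

/-- The moment `M_κ[c] = ∑_{l ≥ 1} l ^ κ * c_l` of a sequence `(c_k)_{k ≥ 0}`
(the empty clusters `k = 0` are left out). -/
def edgMoment (κ : ℝ) (c : ℕ → ℝ) : ℝ :=
  ∑' l : ℕ, ((l + 1 : ℕ) : ℝ) ^ κ * c (l + 1)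

/-- Membership in the cone `X_μ^+(ℕ₀)` of nonnegative sequences with finite moment of order `μ`. -/
def MemEDGCone (μ : ℝ) (c : ℕ → ℝ) : Prop :=
  (∀ k, 0 ≤ c k) ∧ Summable (fun l : ℕ => ((l + 1 : ℕ) : ℝ) ^ μ * c (l + 1))

/-- Right-hand side of the exchange-driven growth system with kernel `(k l) ^ lam`
(for `lam = 0` the kernel is the indicator of `k, l ≥ 1`). -/
def edgRhs (lam : ℝ) (c : ℕ → ℝ) : ℕ → ℝ
  | 0 => edgMoment lam c * c 1
  | 1 => edgMoment lam c * (-2 * c 1 + (2 : ℝ) ^ lam * c 2)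
  | (k + 2) => edgMoment lam c *
      (((k + 1 : ℕ) : ℝ) ^ lam * c (k + 1) - 2 * ((k + 2 : ℕ) : ℝ) ^ lam * c (k + 2)
        + ((k + 3 : ℕ) : ℝ) ^ lam * c (k + 3))

/-- `c` is a solution on `[0, T)`, `0 < T ≤ ∞`, with initial data `c₀`. The values of `c` outside
`[0, T)` are irrelevant. The norm in `X_{max(1, lam)}` is lower semicontinuous in time (it is a
supremum of continuous partial sums), so being essentially bounded on `[0, b]` is the same as being
bounded there. -/
structure IsEDGSolution (lam : ℝ) (c₀ : ℕ → ℝ) (T : EReal) (c : ℝ → ℕ → ℝ) : Prop where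
  pos : 0 < T
  mem : ∀ t : ℝ, 0 ≤ t → (t : EReal) < T → MemEDGCone (max 1 lam) (c t)
  locBdd : ∀ b : ℝ, (b : EReal) < T →
    ∃ B : ℝ, ∀ t : ℝ, 0 ≤ t → t ≤ b → edgMoment (max 1 lam) (c t) ≤ B
  cont : ∀ k : ℕ, ContinuousOn (fun t => c t k) {t : ℝ | 0 ≤ t ∧ (t : EReal) < T}
  eqn : ∀ (k : ℕ) (t : ℝ), 0 ≤ t → (t : EReal) < T →
    c t k = c₀ k + ∫ s in (0 : ℝ)..t, edgRhs lam (c s) k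

/-- Average size of the living clusters, `(∑_{k ≥ 1} k * c_k) / (∑_{k ≥ 1} c_k)`. -/
def avgClusterSize (c : ℕ → ℝ) : ℝ :=
  edgMoment 1 c / edgMoment 0 c

end

open Set Filter Topology MeasureTheory

/-! The nonlinearity is only a change of clock. The factor M_λ[c] multiplies every equation, so in
the time σ = ∫ M_λ[c] dt the sizes k ≥ 1 follow the linear flow dU_k/dσ = Δ(k^λ U)_k with zero
boundary value at k = 0; c_0 is recovered by integration. Conversely, the physical time spent up to
σ is Γ(σ) = ∫_0^σ M_λ[U]⁻¹ (`elapsedTime`). So everything reduces to the growth of the moments of U.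

The linear flow is self-similar with k ~ σ^(1/(2-λ)): the number of clusters behaves like
(1+σ)^(-1/(2-λ)), and M_λ[U] like (1+σ)^((λ-1)/(2-λ)). Hence Γ' is comparable to (1+σ)^(δ-1) with δ
= (3-2λ)/(2-λ). For δ > 0, Γ grows like σ^δ; for δ = 0, like a logarithm; for δ < 0 it is bounded,
and its supremum is the blow-up time. Since δβ = 1/(2-λ), inverting Γ turns ℓ ~ (1+σ)^(1/(2-λ)) into
the stated rates.

The moment bounds come from duality with the backward equation ∂_s H = k^λ ΔH, H_0 = 0. The explicit
profiles k (k^(2-λ) + Ks)^r are supersolutions or subsolutions, according to the sign of r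
(`exists_edgMoment_lam_le`, `exists_le_edgMoment_of_lt_one`). A smoothly capped concave profile
bounds the number of clusters from above (`exists_edgMoment_zero_le`). Interpolation with the
conserved mass supplies the remaining bounds (`exists_edgMoment_lam_bounds`).

The flow U is the increasing limit of finite truncations (`exists_isLimitFlow`). Uniqueness
(`IsLimitFlow.solution_eq`) holds because any solution, in its own clock, dominates every truncation
and hence U. Both have the same mass, so they coincide. Inverting Γ gives existence
(`IsLimitFlow.exists_solution`). -/

/-! ### Discrete calculus: second differences and mean values -/

/-- The jump rate `k ^ lam` of clusters of size `k`; empty clusters do not jump. -/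
noncomputable def clusterRate (lam : ℝ) (k : ℕ) : ℝ := if k = 0 then 0 else (k : ℝ) ^ lam

/-- The second difference of a sequence, centered at `i + 1`. -/
def secondDiff (f : ℕ → ℝ) (i : ℕ) : ℝ := f (i + 2) - 2 * f (i + 1) + f i

@[simp] lemma clusterRate_zero (lam : ℝ) : clusterRate lam 0 = 0 := by simp [clusterRate]

lemma clusterRate_succ (lam : ℝ) (i : ℕ) :
    clusterRate lam (i + 1) = ((i + 1 : ℕ) : ℝ) ^ lam := by simp [clusterRate]

lemma clusterRate_nonneg (lam : ℝ) (k : ℕ) : 0 ≤ clusterRate lam k := by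
  unfold clusterRate; split_ifs <;> positivity

lemma clusterRate_succ_pos (lam : ℝ) (i : ℕ) : 0 < clusterRate lam (i + 1) := by
  rw [clusterRate_succ]; positivity

lemma edgRhs_succ (lam : ℝ) (c : ℕ → ℝ) (i : ℕ) :
    edgRhs lam c (i + 1) =
      edgMoment lam c * secondDiff (fun k => clusterRate lam k * c k) i := by
  cases i with
  | zero => simp [edgRhs, secondDiff, clusterRate]; ring_nf; simp
  | succ i => simp [edgRhs, secondDiff, clusterRate]; ring_nf; simp

/-- Summation by parts, applied twice. Vanishing at 0 removes the lower boundary terms. The upper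
ones stay explicit: the arguments below control either their sign or their limit. -/
lemma sum_mul_secondDiff (φ v : ℕ → ℝ) (K : ℕ) (hφ : φ 0 = 0) (hv : v 0 = 0) :
    ∑ i ∈ Finset.range K, φ (i + 1) * secondDiff v i =
      ∑ i ∈ Finset.range K, v (i + 1) * secondDiff φ i + φ K * v (K + 1) - φ (K + 1) * v K := by
  induction K with
  | zero => simp [hφ, hv]
  | succ K ih => rw [Finset.sum_range_succ, Finset.sum_range_succ, ih]; simp only [secondDiff]; ring

lemma hasDerivAt_posPart_sq (y : ℝ) :
    HasDerivAt (fun y : ℝ => (max y 0) ^ 2) (2 * max y 0) y := by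
  rcases lt_trichotomy y 0 with h | h | h
  · have : (fun y : ℝ => (max y 0) ^ 2) =ᶠ[𝓝 y] fun _ => 0 := by
      filter_upwards [Iio_mem_nhds h] with z hz
      rw [max_eq_right (le_of_lt hz)]; simp
    rw [max_eq_right h.le, mul_zero]
    exact (hasDerivAt_const y (0 : ℝ)).congr_of_eventuallyEq this
  · subst h
    rw [max_self, mul_zero, hasDerivAt_iff_isLittleO_nhds_zero]
    have : (fun h : ℝ => h ^ 2) =o[𝓝 0] fun h => h := by
      simpa using (Asymptotics.isLittleO_pow_pow (𝕜 := ℝ) (m := 1) (n := 2) (by norm_num))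
    refine Asymptotics.IsBigO.trans_isLittleO ?_ this
    refine Asymptotics.IsBigO.of_bound 1 (Eventually.of_forall fun x => ?_)
    simp only [zero_add, max_self, smul_zero, sub_zero, one_mul, Real.norm_eq_abs, abs_pow]
    norm_num
    rcases le_total x 0 with h | h
    · rw [max_eq_right h]; simpa using sq_nonneg x
    · rw [max_eq_left h]
  · have : (fun y : ℝ => (max y 0) ^ 2) =ᶠ[𝓝 y] fun y => y ^ 2 := by
      filter_upwards [Ioi_mem_nhds h] with z hz
      rw [max_eq_left (le_of_lt hz)]
    rw [max_eq_left h.le]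
    simpa using (hasDerivAt_pow 2 y).congr_of_eventuallyEq this

/-- Mean value form of the second difference of a function on the line. -/
lemma exists_second_difference_eq {f f' f'' : ℝ → ℝ} {a : ℝ}
    (hf : ContinuousOn f (Icc (a - 1) (a + 1)))
    (hf' : ∀ x ∈ Ioo (a - 1) (a + 1), HasDerivAt f (f' x) x)
    (hf'' : ∀ x ∈ Ioo (a - 1) (a + 1), HasDerivAt f' (f'' x) x) :
    ∃ η ∈ Ioo (a - 1) (a + 1), f (a + 1) - 2 * f a + f (a - 1) = f'' η := by
  have hc : ContinuousOn (fun h => f (a + h) + f (a - h)) (Icc 0 1) := by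
    refine ContinuousOn.add ?_ ?_
    · refine hf.comp (by fun_prop) fun x hx => ?_
      constructor <;> linarith [hx.1, hx.2]
    · refine hf.comp (by fun_prop) fun x hx => ?_
      constructor <;> linarith [hx.1, hx.2]
  have hd : ∀ x ∈ Ioo (0 : ℝ) 1,
      HasDerivAt (fun h => f (a + h) + f (a - h)) (f' (a + x) - f' (a - x)) x := by
    intro x hx
    have h1 : HasDerivAt (fun h => f (a + h)) (f' (a + x)) x := by
      simpa using (hf' (a + x) ⟨by linarith [hx.1], by linarith [hx.2]⟩).comp_const_add a x
    have h2 : HasDerivAt (fun h => f (a - h)) (-f' (a - x)) x := by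
      simpa using (hf' (a - x) ⟨by linarith [hx.2], by linarith [hx.1]⟩).comp_const_sub a x
    exact (h1.fun_add h2).congr_deriv (by ring)
  -- Cauchy's mean value theorem against `h ^ 2` reduces the second difference to a slope of `f'`
  -- over `[a - h, a + h]`.
  obtain ⟨h, hh, he⟩ := exists_ratio_hasDerivAt_eq_ratio_slope
    (fun h => f (a + h) + f (a - h)) (fun x => f' (a + x) - f' (a - x)) (zero_lt_one' ℝ) hc hd
    (fun x => x ^ 2) (fun x => 2 * x) (by fun_prop)
    (fun x _ => by simpa using hasDerivAt_pow 2 x)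
  have hsub : Icc (a - h) (a + h) ⊆ Ioo (a - 1) (a + 1) := fun x hx =>
    ⟨by linarith [hx.1, hh.2], by linarith [hx.2, hh.2]⟩
  obtain ⟨η, hη, hs⟩ := exists_hasDerivAt_eq_slope f' f'' (a := a - h) (b := a + h)
    (by linarith [hh.1]) (fun x hx => (hf'' x (hsub hx)).continuousAt.continuousWithinAt)
    (fun x hx => hf'' x (hsub (Ioo_subset_Icc_self hx)))
  refine ⟨η, hsub (Ioo_subset_Icc_self hη), ?_⟩
  have h0 : 0 < h := hh.1
  rw [hs]
  simp at he
  rw [he, show a + h - (a - h) = 2 * h by ring, mul_div_assoc, div_self (by positivity)]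
  ring

/-- A Harnack-type comparison that is blind to the sign of the exponent; it moves bounds from an
intermediate mean value point to the lattice point. -/
lemma rpow_le_of_comparable {c x y : ℝ} (e : ℝ) (hc : 1 ≤ c) (hy : 0 < y) (h1 : y ≤ c * x)
    (h2 : x ≤ c * y) : x ^ e ≤ c ^ |e| * y ^ e := by
  have hc0 : 0 < c := by linarith
  have hx : 0 < x := by
    by_contra h
    nlinarith
  rcases le_total 0 e with he | he
  · rw [abs_of_nonneg he, ← Real.mul_rpow hc0.le hy.le]
    exact Real.rpow_le_rpow hx.le h2 he
  · rw [abs_of_nonpos he]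
    have : (c * x) ^ e ≤ y ^ e := Real.rpow_le_rpow_of_nonpos hy h1 he
    rw [Real.mul_rpow hc0.le hx.le] at this
    have h3 : c ^ (-e) * c ^ e = 1 := by rw [← Real.rpow_add hc0]; simp
    calc x ^ e = c ^ (-e) * (c ^ e * x ^ e) := by rw [← mul_assoc, h3, one_mul]
      _ ≤ _ := by gcongr

lemma hasDerivAt_rpow_add_rpow {p r S x : ℝ} (hx : 0 < x) (hS : 0 ≤ S) :
    HasDerivAt (fun x : ℝ => (x ^ p + S) ^ r)
      (r * p * (x ^ (p - 1) * (x ^ p + S) ^ (r - 1))) x := by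
  have h1 := ((Real.hasDerivAt_rpow_const (p := p) (Or.inl hx.ne')).add_const S).rpow_const
    (p := r) (Or.inl (by positivity))
  exact h1.congr_deriv (by ring)

lemma hasDerivAt_mul_rpow_add_rpow {p r S x : ℝ} (hx : 0 < x) (hS : 0 ≤ S) :
    HasDerivAt (fun x : ℝ => x * (x ^ p + S) ^ r)
      ((x ^ p + S) ^ r + r * p * (x ^ p * (x ^ p + S) ^ (r - 1))) x := by
  refine ((hasDerivAt_id x).fun_mul
    (hasDerivAt_rpow_add_rpow (p := p) (r := r) hx hS)).congr_deriv ?_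
  rw [Real.rpow_sub_one hx.ne']
  simp only [id]; field_simp

lemma hasDerivAt_mul_rpow_add_rpow_deriv {p r S x : ℝ} (hx : 0 < x) (hS : 0 ≤ S) :
    HasDerivAt (fun x : ℝ => (x ^ p + S) ^ r + r * p * (x ^ p * (x ^ p + S) ^ (r - 1)))
      (r * p * (x ^ (p - 1) * (x ^ p + S) ^ (r - 1)) *
        (1 + p + (r - 1) * p * (x ^ p / (x ^ p + S)))) x := by
  refine ((hasDerivAt_rpow_add_rpow (p := p) (r := r) hx hS).fun_add
    (((Real.hasDerivAt_rpow_const (p := p) (Or.inl hx.ne')).fun_mul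
      (hasDerivAt_rpow_add_rpow (p := p) (r := r - 1) hx hS)).const_mul (r * p))).congr_deriv ?_
  have hW : 0 < x ^ p + S := by positivity
  have : (x ^ p + S) ^ (r - 1) = (x ^ p + S) * (x ^ p + S) ^ (r - 1 - 1) := by
    rw [Real.rpow_sub_one hW.ne' (r - 1)]; field_simp
  rw [this]; field_simp; ring

/-! ### Second differences of power-type profiles -/

/-- The sequence `k (k ^ p + S) ^ r`, which interpolates between `k S ^ r` for small `k`
and `k ^ (1 + p r)` for large `k`. -/
noncomputable def crossover (p r S : ℝ) (k : ℕ) : ℝ := k * ((k : ℝ) ^ p + S) ^ r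

/-- The second derivative of x (x^p + S)^r is r p x^(p-1) (x^p + S)^(r-1) times a bracket in which S
enters only through x^p / (x^p + S), a number in [0, 1]. Hence the constant is uniform in S. -/
lemma exists_abs_secondDiff_crossover_le (p r : ℝ) (hp : 0 < p) :
    ∃ C : ℝ, 0 < C ∧ ∀ (S : ℝ), 0 ≤ S → ∀ i : ℕ, |secondDiff (crossover p r S) i| ≤
      C * (((i + 1 : ℕ) : ℝ) ^ (p - 1) * (((i + 1 : ℕ) : ℝ) ^ p + S) ^ (r - 1)) := by
  set E : ℝ := 2 ^ |p - 1| * (2 ^ p) ^ |r - 1| with hE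
  have hE0 : 0 < E := by positivity
  have hcomp : ∀ S : ℝ, 0 ≤ S → ∀ x y : ℝ, 0 < y → y ≤ 2 * x → x ≤ 2 * y →
      x ^ (p - 1) * (x ^ p + S) ^ (r - 1) ≤ E * (y ^ (p - 1) * (y ^ p + S) ^ (r - 1)) := by
    intro S hS x y hy h1 h2
    have hx : 0 < x := by linarith
    have e1 := rpow_le_of_comparable (p - 1) one_le_two hy h1 h2
    have h2p : (1 : ℝ) ≤ 2 ^ p := Real.one_le_rpow one_le_two hp.le
    have e2 := rpow_le_of_comparable (c := 2 ^ p) (x := x ^ p + S) (y := y ^ p + S) (r - 1) h2p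
      (by positivity)
      (by
        have := Real.rpow_le_rpow hy.le h1 hp.le
        rw [Real.mul_rpow zero_le_two hx.le] at this
        nlinarith)
      (by
        have := Real.rpow_le_rpow hx.le h2 hp.le
        rw [Real.mul_rpow zero_le_two hy.le] at this
        nlinarith)
    calc x ^ (p - 1) * (x ^ p + S) ^ (r - 1)
        ≤ (2 ^ |p - 1| * y ^ (p - 1)) * ((2 ^ p) ^ |r - 1| * (y ^ p + S) ^ (r - 1)) := by gcongr
      _ = _ := by rw [hE]; ring
  -- The added 1 only keeps the constant positive when `r = 0`.
  refine ⟨(|r| * p * (2 + p + |r - 1| * p)) * E + 1, by positivity, fun S hS i => ?_⟩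
  set V : ℝ := ((i + 1 : ℕ) : ℝ) ^ (p - 1) * (((i + 1 : ℕ) : ℝ) ^ p + S) ^ (r - 1) with hV
  have hV0 : 0 ≤ V := by positivity
  have key : |secondDiff (crossover p r S) i| ≤ (|r| * p * (2 + p + |r - 1| * p)) * (E * V) := by
    -- For `i = 0` the window reaches the origin, where the derivatives may be singular. The factor
    -- `k` collapses the second difference to 2((2^p + S)^r - (1 + S)^r), so a first-order mean
    -- value on `[1, 2]` suffices.
    rcases Nat.eq_zero_or_pos i with rfl | hi
    · obtain ⟨η, hη, hs⟩ := exists_hasDerivAt_eq_slope (fun x : ℝ => (x ^ p + S) ^ r)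
        (fun x => r * p * (x ^ (p - 1) * (x ^ p + S) ^ (r - 1))) (a := 1) (b := 2) (by norm_num)
        (fun x hx => (hasDerivAt_rpow_add_rpow (by linarith [hx.1]) hS).continuousAt.continuousWithinAt)
        (fun x hx => hasDerivAt_rpow_add_rpow (by linarith [hx.1]) hS)
      have h0 : secondDiff (crossover p r S) 0 =
          2 * (r * p * (η ^ (p - 1) * (η ^ p + S) ^ (r - 1))) := by
        rw [hs]; simp [secondDiff, crossover]; ring
      have hη0 : 0 < η := by linarith [hη.1]
      have hc := hcomp S hS η ((0 + 1 : ℕ) : ℝ) (by norm_num) (by push_cast; linarith [hη.1])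
        (by push_cast; linarith [hη.2])
      rw [h0, abs_mul, abs_mul, abs_mul, abs_of_pos hp, abs_two,
        abs_of_nonneg (a := η ^ (p - 1) * _) (by positivity)]
      have : |r| * p * 2 ≤ |r| * p * (2 + p + |r - 1| * p) := by
        gcongr; nlinarith [abs_nonneg (r - 1), hp, mul_nonneg (abs_nonneg (r - 1)) hp.le]
      calc 2 * (|r| * p * (η ^ (p - 1) * (η ^ p + S) ^ (r - 1)))
          ≤ 2 * (|r| * p * (E * V)) := by gcongr
        _ = |r| * p * 2 * (E * V) := by ring
        _ ≤ _ := by gcongr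
    · have hi1 : (1 : ℝ) ≤ i := by exact_mod_cast hi
      set a : ℝ := ((i + 1 : ℕ) : ℝ) with ha
      have ha' : a = i + 1 := by rw [ha]; push_cast; ring
      have hpos : ∀ x ∈ Icc (a - 1) (a + 1), 0 < x := fun x hx => by linarith [hx.1]
      obtain ⟨η, hη, hs⟩ := exists_second_difference_eq
        (f := fun x : ℝ => x * (x ^ p + S) ^ r) (a := a)
        (fun x hx => (hasDerivAt_mul_rpow_add_rpow (hpos x hx) hS).continuousAt.continuousWithinAt)
        (fun x hx => hasDerivAt_mul_rpow_add_rpow (hpos x (Ioo_subset_Icc_self hx)) hS)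
        (fun x hx => hasDerivAt_mul_rpow_add_rpow_deriv (hpos x (Ioo_subset_Icc_self hx)) hS)
      have hη0 : 0 < η := hpos η (Ioo_subset_Icc_self hη)
      have h0 : secondDiff (crossover p r S) i = r * p * (η ^ (p - 1) * (η ^ p + S) ^ (r - 1)) *
          (1 + p + (r - 1) * p * (η ^ p / (η ^ p + S))) := by
        rw [← hs]
        simp only [secondDiff, crossover]
        rw [← ha, show ((i + 2 : ℕ) : ℝ) = a + 1 by rw [ha]; push_cast; ring,
          show (i : ℝ) = a - 1 by rw [ha']; ring]
      have hc := hcomp S hS η a (by linarith) (by linarith [hη.1]) (by linarith [hη.2])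
      have hq : |1 + p + (r - 1) * p * (η ^ p / (η ^ p + S))| ≤ 2 + p + |r - 1| * p := by
        have hq1 : η ^ p / (η ^ p + S) ≤ 1 := by
          rw [div_le_one (by positivity)]; linarith
        have hq0 : 0 ≤ η ^ p / (η ^ p + S) := by positivity
        calc |1 + p + (r - 1) * p * (η ^ p / (η ^ p + S))|
            ≤ |1 + p| + |(r - 1) * p * (η ^ p / (η ^ p + S))| := abs_add_le _ _
          _ = 1 + p + |r - 1| * p * (η ^ p / (η ^ p + S)) := by
              rw [abs_mul, abs_mul, abs_of_pos hp, abs_of_nonneg hq0,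
                abs_of_pos (show 0 < 1 + p by linarith)]
          _ ≤ 1 + p + |r - 1| * p * 1 := by gcongr
          _ ≤ _ := by linarith
      rw [h0, abs_mul, abs_mul, abs_mul, abs_of_pos hp,
        abs_of_nonneg (a := η ^ (p - 1) * _) (by positivity)]
      calc |r| * p * (η ^ (p - 1) * (η ^ p + S) ^ (r - 1)) *
            |1 + p + (r - 1) * p * (η ^ p / (η ^ p + S))|
          ≤ |r| * p * (E * V) * (2 + p + |r - 1| * p) := by gcongr
        _ = _ := by ring
  calc _ ≤ _ := key
    _ ≤ _ := by nlinarith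

/-- Quantitative strict convexity of x^(1+p). At `i = 0` the second difference is the number 2^(1+p)
- 2, which is why a minimum of two constants appears. -/
lemma exists_le_secondDiff_rpow (p : ℝ) (hp : 0 < p) :
    ∃ c : ℝ, 0 < c ∧ ∀ i : ℕ,
      c * ((i + 1 : ℕ) : ℝ) ^ (p - 1) ≤ secondDiff (fun k => (k : ℝ) ^ (1 + p)) i := by
  set E : ℝ := 2 ^ |p - 1| with hE
  have hE0 : 0 < E := by positivity
  have h2 : (2 : ℝ) < 2 ^ (1 + p) := by
    simpa using Real.rpow_lt_rpow_of_exponent_lt one_lt_two (show 1 < 1 + p by linarith)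
  refine ⟨min (2 ^ (1 + p) - 2) ((1 + p) * p / E), ?_, fun i => ?_⟩
  · exact lt_min (by linarith) (by positivity)
  rcases Nat.eq_zero_or_pos i with rfl | hi
  · have : (0 : ℝ) ^ (1 + p) = 0 := Real.zero_rpow (by linarith)
    simp [secondDiff, this]
  · have hi1 : (1 : ℝ) ≤ i := by exact_mod_cast hi
    set a : ℝ := ((i + 1 : ℕ) : ℝ) with ha
    have ha' : a = i + 1 := by rw [ha]; push_cast; ring
    have hpos : ∀ x ∈ Ioo (a - 1) (a + 1), 0 < x := fun x hx => by linarith [hx.1]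
    obtain ⟨η, hη, hs⟩ := exists_second_difference_eq
      (f := fun x : ℝ => x ^ (1 + p)) (f' := fun x => (1 + p) * x ^ p)
      (f'' := fun x => (1 + p) * (p * x ^ (p - 1))) (a := a)
      (fun x hx => (Real.continuousAt_rpow_const x (1 + p)
        (Or.inr (by linarith))).continuousWithinAt)
      (fun x hx => (Real.hasDerivAt_rpow_const (Or.inl (hpos x hx).ne')).congr_deriv (by simp))
      (fun x hx => (Real.hasDerivAt_rpow_const (Or.inl (hpos x hx).ne')).const_mul _)
    have h0 : secondDiff (fun k => (k : ℝ) ^ (1 + p)) i = (1 + p) * (p * η ^ (p - 1)) := by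
      rw [← hs]
      simp only [secondDiff]
      rw [← ha, show ((i + 2 : ℕ) : ℝ) = a + 1 by rw [ha]; push_cast; ring,
        show (i : ℝ) = a - 1 by rw [ha']; ring]
    have hc := rpow_le_of_comparable (x := a) (y := η) (p - 1) one_le_two (hpos η hη)
      (by linarith [hη.2]) (by linarith [hη.1])
    rw [h0]
    calc min (2 ^ (1 + p) - 2) ((1 + p) * p / E) * a ^ (p - 1)
        ≤ (1 + p) * p / E * (E * η ^ (p - 1)) := by
          gcongr
          exact min_le_right _ _
      _ = _ := by field_simp

/-! ### Weak formulation and conservation of mass -/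

/-- `c` solves the linear system `dc_k/dt = m(t) ((k-1)^lam c_{k-1} - 2 k^lam c_k + (k+1)^lam c_{k+1})`,
`k ≥ 1`, on `[0, b]`, with nonnegative values and a bounded moment of order `max 1 lam`. -/
structure IsRateFlow (lam : ℝ) (m : ℝ → ℝ) (b : ℝ) (c : ℝ → ℕ → ℝ) : Prop where
  nonneg : ∀ t ∈ Icc 0 b, ∀ i, 0 ≤ c t (i + 1)
  summable : ∀ t ∈ Icc 0 b, Summable (fun l : ℕ => ((l + 1 : ℕ) : ℝ) ^ max 1 lam * c t (l + 1))
  bdd : ∃ B, ∀ t ∈ Icc 0 b, edgMoment (max 1 lam) (c t) ≤ B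
  cont : ∀ i, ContinuousOn (fun t => c t (i + 1)) (Icc 0 b)
  rate_int : IntervalIntegrable m volume 0 b
  rate_bdd : ∃ B, ∀ t ∈ Icc 0 b, |m t| ≤ B
  eqn : ∀ i, ∀ t ∈ Icc 0 b, c t (i + 1) = c 0 (i + 1) +
    ∫ s in (0 : ℝ)..t, m s * secondDiff (fun k => clusterRate lam k * c s k) i

lemma one_le_cast_succ (l : ℕ) : (1 : ℝ) ≤ ((l + 1 : ℕ) : ℝ) := by
  push_cast; linarith [(Nat.cast_nonneg l : (0 : ℝ) ≤ l)]

lemma summable_moment_mono {κ μ : ℝ} {c : ℕ → ℝ} (hκ : κ ≤ μ) (h0 : ∀ i, 0 ≤ c (i + 1))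
    (hs : Summable (fun l : ℕ => ((l + 1 : ℕ) : ℝ) ^ μ * c (l + 1))) :
    Summable (fun l : ℕ => ((l + 1 : ℕ) : ℝ) ^ κ * c (l + 1)) :=
  hs.of_nonneg_of_le (fun l => mul_nonneg (by positivity) (h0 l)) fun l =>
    mul_le_mul_of_nonneg_right (Real.rpow_le_rpow_of_exponent_le (one_le_cast_succ l) hκ) (h0 l)

lemma edgMoment_mono {κ μ : ℝ} {c : ℕ → ℝ} (hκ : κ ≤ μ) (h0 : ∀ i, 0 ≤ c (i + 1))
    (hs : Summable (fun l : ℕ => ((l + 1 : ℕ) : ℝ) ^ μ * c (l + 1))) :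
    edgMoment κ c ≤ edgMoment μ c :=
  (summable_moment_mono hκ h0 hs).tsum_le_tsum (fun l =>
    mul_le_mul_of_nonneg_right (Real.rpow_le_rpow_of_exponent_le (one_le_cast_succ l) hκ) (h0 l)) hs

lemma edgMoment_nonneg {κ : ℝ} {c : ℕ → ℝ} (h0 : ∀ i, 0 ≤ c (i + 1)) : 0 ≤ edgMoment κ c :=
  tsum_nonneg fun l => mul_nonneg (by positivity) (h0 l)

lemma summable_weighted {μ A : ℝ} {c φ : ℕ → ℝ} (h0 : ∀ i, 0 ≤ c (i + 1))
    (hs : Summable (fun l : ℕ => ((l + 1 : ℕ) : ℝ) ^ μ * c (l + 1)))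
    (hφ : ∀ l : ℕ, |φ (l + 1)| ≤ A * ((l + 1 : ℕ) : ℝ) ^ μ) :
    Summable (fun l : ℕ => φ (l + 1) * c (l + 1)) := by
  refine Summable.of_norm_bounded (hs.mul_left A) fun l => ?_
  rw [Real.norm_eq_abs, abs_mul, abs_of_nonneg (h0 l), ← mul_assoc]
  exact mul_le_mul_of_nonneg_right (hφ l) (h0 l)

namespace IsRateFlow

variable {lam b : ℝ} {m : ℝ → ℝ} {c : ℝ → ℕ → ℝ}

lemma intervalIntegrable_mul (h : IsRateFlow lam m b c) {g : ℝ → ℝ}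
    (hg : ContinuousOn g (Icc 0 b)) {s t : ℝ} (hs : s ∈ Icc 0 b) (ht : t ∈ Icc 0 b) :
    IntervalIntegrable (fun x => m x * g x) volume s t := by
  have hb : 0 ≤ b := hs.1.trans hs.2
  refine (h.rate_int.mul_continuousOn (by rwa [uIcc_of_le hb])).mono_set ?_
  rw [uIcc_of_le hb]
  exact uIcc_subset_Icc hs ht

lemma continuousOn_rate_mul (h : IsRateFlow lam m b c) (k : ℕ) :
    ContinuousOn (fun s => clusterRate lam k * c s k) (Icc 0 b) := by
  cases k with
  | zero => simpa using continuousOn_const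
  | succ i => exact continuousOn_const.mul (h.cont i)

lemma tendsto_rate_mul (h : IsRateFlow lam m b c) {t : ℝ} (ht : t ∈ Icc 0 b) :
    Tendsto (fun k => clusterRate lam k * c t k) atTop (𝓝 0) := by
  rw [← tendsto_add_atTop_iff_nat 1]
  simp only [clusterRate_succ]
  exact (summable_moment_mono (le_max_right _ _) (h.nonneg t ht)
    (h.summable t ht)).tendsto_atTop_zero

lemma rate_mul_nonneg (h : IsRateFlow lam m b c) {t : ℝ} (ht : t ∈ Icc 0 b) (k : ℕ) :
    0 ≤ clusterRate lam k * c t k := by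
  cases k with
  | zero => simp
  | succ i => exact mul_nonneg (clusterRate_nonneg _ _) (h.nonneg t ht i)

lemma rate_mul_le (h : IsRateFlow lam m b c) {t : ℝ} (ht : t ∈ Icc 0 b) (k : ℕ) :
    clusterRate lam k * c t k ≤ edgMoment (max 1 lam) (c t) := by
  cases k with
  | zero => simpa using edgMoment_nonneg (h.nonneg t ht)
  | succ i =>
    have hs := summable_moment_mono (le_max_right 1 lam) (h.nonneg t ht) (h.summable t ht)
    refine le_trans ?_ (edgMoment_mono (le_max_right 1 lam) (h.nonneg t ht) (h.summable t ht))
    rw [clusterRate_succ]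
    exact hs.le_tsum i fun j _ => mul_nonneg (by positivity) (h.nonneg t ht j)

/-- No flux escapes to infinity: each k^λ c_k is a term of a convergent series, and the bounded
moment of order max(1, λ) dominates it uniformly in k and time. -/
lemma tendsto_integral_rate (h : IsRateFlow lam m b c) {t : ℝ} (ht : t ∈ Icc 0 b) :
    Tendsto (fun k => ∫ s in (0 : ℝ)..t, m s * (clusterRate lam k * c s k)) atTop (𝓝 0) := by
  obtain ⟨B, hB⟩ := h.bdd
  have h0 : (0 : ℝ) ∈ Icc 0 b := ⟨le_rfl, ht.1.trans ht.2⟩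
  have hsub : ∀ x, x ∈ uIoc 0 t → x ∈ Icc 0 b := fun x hx => by
    rw [uIoc_of_le ht.1] at hx; exact ⟨hx.1.le, hx.2.trans ht.2⟩
  have := intervalIntegral.tendsto_integral_filter_of_dominated_convergence
    (μ := volume) (a := 0) (b := t) (l := atTop)
    (F := fun k s => m s * (clusterRate lam k * c s k)) (f := fun _ => (0 : ℝ))
    (fun s => |m s| * B)
    (Eventually.of_forall fun k =>
      ((h.intervalIntegrable_mul (h.continuousOn_rate_mul k) h0 ht).def').aestronglyMeasurable)
    (Eventually.of_forall fun k => Eventually.of_forall fun s hs => by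
      rw [Real.norm_eq_abs, abs_mul, abs_of_nonneg (h.rate_mul_nonneg (hsub s hs) k)]
      exact mul_le_mul_of_nonneg_left ((h.rate_mul_le (hsub s hs) k).trans (hB s (hsub s hs)))
        (abs_nonneg _))
    (by
      have := (h.intervalIntegrable_mul (g := fun _ => 1) continuousOn_const h0 ht).abs
      simpa using this.mul_const B)
    (Eventually.of_forall fun s hs => by
      simpa using (h.tendsto_rate_mul (hsub s hs)).const_mul (m s))
  simpa using this

lemma finite_weighted_sum (h : IsRateFlow lam m b c) (φ : ℕ → ℝ) (hφ : φ 0 = 0) (K : ℕ) {t : ℝ}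
    (ht : t ∈ Icc 0 b) :
    ∑ i ∈ Finset.range K, φ (i + 1) * c t (i + 1) =
      ∑ i ∈ Finset.range K, φ (i + 1) * c 0 (i + 1) +
      ((∫ s in (0 : ℝ)..t, m s * ∑ i ∈ Finset.range K,
          (clusterRate lam (i + 1) * c s (i + 1)) * secondDiff φ i) +
        φ K * (∫ s in (0 : ℝ)..t, m s * (clusterRate lam (K + 1) * c s (K + 1))) -
        φ (K + 1) * ∫ s in (0 : ℝ)..t, m s * (clusterRate lam K * c s K)) := by
  have h0 : (0 : ℝ) ∈ Icc 0 b := ⟨le_rfl, ht.1.trans ht.2⟩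
  have hv : ∀ k, ContinuousOn (fun s => clusterRate lam k * c s k) (Icc 0 b) :=
    h.continuousOn_rate_mul
  have hd : ∀ i, ContinuousOn (fun s => secondDiff (fun k => clusterRate lam k * c s k) i)
      (Icc 0 b) := fun i => ((hv (i + 2)).sub (continuousOn_const.mul (hv (i + 1)))).add (hv i)
  have hI : ∀ k, IntervalIntegrable (fun s => m s * (clusterRate lam k * c s k)) volume 0 t :=
    fun k => h.intervalIntegrable_mul (hv k) h0 ht
  have hS : IntervalIntegrable (fun s => m s * ∑ i ∈ Finset.range K,
      (clusterRate lam (i + 1) * c s (i + 1)) * secondDiff φ i) volume 0 t :=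
    h.intervalIntegrable_mul (continuousOn_finsetSum _ fun i _ =>
      (hv (i + 1)).mul continuousOn_const) h0 ht
  have e1 : ∑ i ∈ Finset.range K, φ (i + 1) * c t (i + 1) =
      ∑ i ∈ Finset.range K, φ (i + 1) * c 0 (i + 1) +
      ∫ s in (0 : ℝ)..t, ∑ i ∈ Finset.range K,
        φ (i + 1) * (m s * secondDiff (fun k => clusterRate lam k * c s k) i) := by
    rw [intervalIntegral.integral_finsetSum fun i _ =>
      (h.intervalIntegrable_mul (hd i) h0 ht).const_mul _, ← Finset.sum_add_distrib]
    refine Finset.sum_congr rfl fun i _ => ?_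
    rw [h.eqn i t ht, mul_add, intervalIntegral.integral_const_mul]
  rw [e1, ← intervalIntegral.integral_const_mul, ← intervalIntegral.integral_const_mul,
    ← intervalIntegral.integral_add hS ((hI _).const_mul _),
    ← intervalIntegral.integral_sub (hS.add ((hI _).const_mul _)) ((hI _).const_mul _)]
  congr 1
  refine intervalIntegral.integral_congr fun s _ => ?_
  have := sum_mul_secondDiff φ (fun k => clusterRate lam k * c s k) K hφ (by simp)
  calc ∑ i ∈ Finset.range K,
        φ (i + 1) * (m s * secondDiff (fun k => clusterRate lam k * c s k) i)
      = m s * ∑ i ∈ Finset.range K,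
        φ (i + 1) * secondDiff (fun k => clusterRate lam k * c s k) i := by
        rw [Finset.mul_sum]; exact Finset.sum_congr rfl fun i _ => by ring
    _ = _ := by rw [this]; ring

/-- For an eventually constant weight, the boundary terms are bounded multiples of vanishing fluxes,
and the second difference is zero beyond `N`. This is the weak form from which mass conservation and
the continuity of M_λ are derived. -/
lemma tsum_eventually_const (h : IsRateFlow lam m b c) (φ : ℕ → ℝ) (hφ : φ 0 = 0) (N : ℕ)
    (hN : ∀ k, N ≤ k → φ k = φ N) {t : ℝ} (ht : t ∈ Icc 0 b) :
    ∑' l, φ (l + 1) * c t (l + 1) = ∑' l, φ (l + 1) * c 0 (l + 1) +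
      ∫ s in (0 : ℝ)..t, m s * ∑ i ∈ Finset.range N,
        (clusterRate lam (i + 1) * c s (i + 1)) * secondDiff φ i := by
  have h0 : (0 : ℝ) ∈ Icc 0 b := ⟨le_rfl, ht.1.trans ht.2⟩
  obtain ⟨A, hA⟩ : ∃ A, ∀ k, |φ k| ≤ A := by
    refine ⟨∑ k ∈ Finset.range (N + 1), |φ k|, fun k => ?_⟩
    have : φ k = φ (min k N) := by
      rcases le_total k N with hk | hk
      · rw [min_eq_left hk]
      · rw [min_eq_right hk, hN k hk]
    rw [this]
    exact Finset.single_le_sum (f := fun k => |φ k|) (fun _ _ => abs_nonneg _)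
      (Finset.mem_range.2 (by omega))
  have hsum : ∀ s ∈ Icc 0 b, Tendsto (fun K => ∑ i ∈ Finset.range K, φ (i + 1) * c s (i + 1)) atTop
      (𝓝 (∑' l, φ (l + 1) * c s (l + 1))) := fun s hs =>
    (summable_weighted (μ := max 1 lam) (A := A) (h.nonneg s hs) (h.summable s hs) fun l =>
      (hA _).trans (le_mul_of_one_le_right ((abs_nonneg _).trans (hA 0))
        (Real.one_le_rpow (one_le_cast_succ l)
          (zero_le_one.trans (le_max_left _ _))))).hasSum.tendsto_sum_nat
  have hlim := (hsum 0 h0).add ((tendsto_const_nhds (x := ∫ s in (0 : ℝ)..t, m s *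
    ∑ i ∈ Finset.range N, (clusterRate lam (i + 1) * c s (i + 1)) * secondDiff φ i)).add
    ((((h.tendsto_integral_rate ht).comp (tendsto_add_atTop_nat 1)).const_mul (φ N)).sub
      ((h.tendsto_integral_rate ht).const_mul (φ N))))
  simp only [mul_zero, sub_zero, add_zero] at hlim
  refine tendsto_nhds_unique (hsum t ht) (hlim.congr' ?_)
  filter_upwards [eventually_ge_atTop N] with K hK
  rw [h.finite_weighted_sum φ hφ K ht, hN K hK, hN (K + 1) (by omega)]
  have : ∀ s, ∑ i ∈ Finset.range K, (clusterRate lam (i + 1) * c s (i + 1)) * secondDiff φ i =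
      ∑ i ∈ Finset.range N, (clusterRate lam (i + 1) * c s (i + 1)) * secondDiff φ i := by
    intro s
    refine (Finset.sum_subset (Finset.range_mono hK) fun i _ hi => ?_).symm
    rw [Finset.mem_range, not_lt] at hi
    simp only [secondDiff]
    rw [hN i hi, hN (i + 1) (by omega), hN (i + 2) (by omega)]; ring
  simp only [this, Function.comp]
  ring

lemma secondDiff_min (j i : ℕ) :
    secondDiff (fun k => ((min k (j + 1) : ℕ) : ℝ)) i = if i = j then -1 else 0 := by
  simp only [secondDiff]
  rcases lt_trichotomy i j with h | h | h
  · rw [min_eq_left (by omega), min_eq_left (by omega), min_eq_left (by omega), if_neg h.ne]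
    push_cast; ring
  · subst h; rw [min_eq_right (by omega), min_eq_left (by omega), min_eq_left (by omega), if_pos rfl]
    push_cast; ring
  · rw [min_eq_right (by omega), min_eq_right (by omega), min_eq_right (by omega), if_neg h.ne']
    push_cast; ring

/-- Conservation of mass. -/
lemma edgMoment_one (h : IsRateFlow lam m b c) {t : ℝ} (ht : t ∈ Icc 0 b) :
    edgMoment 1 (c t) = edgMoment 1 (c 0) := by
  have h0 : (0 : ℝ) ∈ Icc 0 b := ⟨le_rfl, ht.1.trans ht.2⟩
  have hlim : ∀ s ∈ Icc 0 b, Tendsto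
      (fun j : ℕ => ∑' l : ℕ, ((min (l + 1) (j + 1) : ℕ) : ℝ) * c s (l + 1)) atTop
      (𝓝 (edgMoment 1 (c s))) := by
    intro s hs
    refine tendsto_tsum_of_dominated_convergence
      (summable_moment_mono (le_max_left 1 lam) (h.nonneg s hs) (h.summable s hs)) (fun l => ?_)
      (Eventually.of_forall fun j l => ?_)
    · refine tendsto_const_nhds.congr' ?_
      filter_upwards [eventually_ge_atTop l] with j hj
      rw [min_eq_left (by omega), Real.rpow_one]
    · rw [Real.norm_eq_abs, abs_mul, abs_of_nonneg (h.nonneg s hs l), Nat.abs_cast, Real.rpow_one]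
      gcongr
      · exact h.nonneg s hs l
      · exact min_le_left _ _
  -- Capping the weight `k` at `j + 1` leaves a second difference of -1 at a single site, so the
  -- capped mass loses exactly the integrated flux there, which tends to 0 as `j` grows.
  have hstep : ∀ j : ℕ, ∑' l : ℕ, ((min (l + 1) (j + 1) : ℕ) : ℝ) * c t (l + 1) =
      ∑' l : ℕ, ((min (l + 1) (j + 1) : ℕ) : ℝ) * c 0 (l + 1) -
      ∫ s in (0 : ℝ)..t, m s * (clusterRate lam (j + 1) * c s (j + 1)) := by
    intro j
    have := h.tsum_eventually_const (fun k => ((min k (j + 1) : ℕ) : ℝ)) (by simp) (j + 1)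
      (fun k hk => by simp [hk]) ht
    rw [this, sub_eq_add_neg, ← intervalIntegral.integral_neg]
    congr 1
    refine intervalIntegral.integral_congr fun s _ => ?_
    simp only [secondDiff_min]; simp
  refine tendsto_nhds_unique (hlim t ht) ?_
  simp only [hstep]
  simpa using (hlim 0 h0).sub ((h.tendsto_integral_rate ht).comp (tendsto_add_atTop_nat 1))

end IsRateFlow

/-! ### Lipschitz continuity in time of the moment of order `lam` -/

/-- Second differences of k^λ have size at most a constant times k^(λ-2), bounded since λ < 2. The
rate is the crossover sequence with p = 1, r = λ - 1 and S = 0. -/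
lemma abs_secondDiff_clusterRate_le (lam : ℝ) (hlam2 : lam < 2) :
    ∃ C : ℝ, 0 < C ∧ ∀ i, |secondDiff (clusterRate lam) i| ≤ C := by
  obtain ⟨C, hC, h⟩ := exists_abs_secondDiff_crossover_le 1 (lam - 1) one_pos
  refine ⟨C, hC, fun i => ?_⟩
  have h1 : crossover 1 (lam - 1) 0 = clusterRate lam := by
    funext k
    cases k with
    | zero => simp [crossover]
    | succ k =>
      rw [clusterRate_succ, crossover, Real.rpow_one, add_zero, Real.rpow_sub_one (by positivity)]
      field_simp
  rw [← h1]
  refine (h 0 le_rfl i).trans (mul_le_of_le_one_right hC.le ?_)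
  rw [sub_self, Real.rpow_zero, one_mul, Real.rpow_one, add_zero]
  exact Real.rpow_le_one_of_one_le_of_nonpos (one_le_cast_succ i) (by linarith)

lemma clusterRate_succ_sub_nonneg {lam : ℝ} (hlam0 : 0 ≤ lam) (n : ℕ) :
    0 ≤ clusterRate lam (n + 1) - clusterRate lam n := by
  rw [sub_nonneg]
  cases n with
  | zero => simpa using clusterRate_nonneg lam 1
  | succ n =>
    rw [clusterRate_succ, clusterRate_succ]
    exact Real.rpow_le_rpow (by positivity) (by push_cast; linarith) hlam0

/-- Writing k^λ = k² k^(λ-2), with the second factor decreasing, treats λ below and above 1 at once.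
-/
lemma clusterRate_succ_sub_le {lam : ℝ} (hlam2 : lam < 2) (n : ℕ) :
    clusterRate lam (n + 1) - clusterRate lam n ≤ 2 * ((n + 1 : ℕ) : ℝ) ^ (lam - 1) := by
  cases n with
  | zero => simp [clusterRate]
  | succ n =>
    rw [clusterRate_succ, clusterRate_succ]
    set x : ℝ := ((n + 1 : ℕ) : ℝ) with hx
    have hx1 : 1 ≤ x := one_le_cast_succ n
    have hy : ((n + 1 + 1 : ℕ) : ℝ) = x + 1 := by rw [hx]; push_cast; ring
    rw [hy]
    have h1 : (x + 1) ^ (lam - 2) ≤ x ^ (lam - 2) :=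
      Real.rpow_le_rpow_of_nonpos (by linarith) (by linarith) (by linarith)
    have h2 : x ^ lam = x ^ 2 * x ^ (lam - 2) := by
      rw [← Real.rpow_two, ← Real.rpow_add (by linarith)]; ring_nf
    have h3 : (x + 1) ^ lam = (x + 1) ^ 2 * (x + 1) ^ (lam - 2) := by
      rw [← Real.rpow_two, ← Real.rpow_add (by linarith)]; ring_nf
    have h4 : (x + 1) ^ (lam - 1) = (x + 1) * (x + 1) ^ (lam - 2) := by
      rw [show lam - 1 = 1 + (lam - 2) by ring, Real.rpow_add (by linarith), Real.rpow_one]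
    rw [h2, h3, h4]
    have h5 : 0 < (x + 1) ^ (lam - 2) := Real.rpow_pos_of_pos (by linarith) _
    nlinarith [mul_le_mul_of_nonneg_left h1 (sq_nonneg x)]

/-- The sequence that agrees with `k ^ lam` up to `N = n + 1` and continues linearly. -/
noncomputable def linearExtRate (lam : ℝ) (n k : ℕ) : ℝ :=
  clusterRate lam (min k (n + 1)) +
    (clusterRate lam (n + 1) - clusterRate lam n) * ((k : ℝ) - (min k (n + 1) : ℕ))

lemma linearExtRate_of_le {lam : ℝ} {n k : ℕ} (h : k ≤ n + 1) :
    linearExtRate lam n k = clusterRate lam k := by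
  simp [linearExtRate, min_eq_left h]

/-- The bound does not depend on `n`; it is the majorant for letting the linear extensions converge
to k^λ inside the sum. -/
lemma abs_linearExtRate_le {lam : ℝ} (hlam0 : 0 ≤ lam) (hlam2 : lam < 2) (n l : ℕ) :
    |linearExtRate lam n (l + 1)| ≤ 3 * ((l + 1 : ℕ) : ℝ) ^ max 1 lam := by
  set x : ℝ := ((l + 1 : ℕ) : ℝ) with hx
  have hx1 : 1 ≤ x := one_le_cast_succ l
  have hxl : x ^ lam ≤ x ^ max 1 lam := Real.rpow_le_rpow_of_exponent_le hx1 (le_max_right _ _)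
  rcases le_total (l + 1) (n + 1) with h | h
  · rw [linearExtRate_of_le h, clusterRate_succ, abs_of_nonneg (by positivity)]
    have : 0 ≤ x ^ max 1 lam := by positivity
    linarith
  · have hd0 := clusterRate_succ_sub_nonneg hlam0 n
    have hd1 := clusterRate_succ_sub_le hlam2 n
    have hnx : ((n + 1 : ℕ) : ℝ) ≤ x := by rw [hx]; exact_mod_cast h
    have hd2 : ((n + 1 : ℕ) : ℝ) ^ (lam - 1) ≤ x ^ (max 1 lam - 1) :=
      (Real.rpow_le_rpow_of_exponent_le (one_le_cast_succ n)
        (sub_le_sub_right (le_max_right 1 lam) 1)).trans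
        (Real.rpow_le_rpow (by positivity) hnx (by linarith [le_max_left 1 lam]))
    have ha : clusterRate lam (n + 1) ≤ x ^ lam := by
      rw [clusterRate_succ]; exact Real.rpow_le_rpow (by positivity) hnx hlam0
    have hxm : x ^ max 1 lam = x ^ (max 1 lam - 1) * x := by
      rw [Real.rpow_sub_one (by positivity)]; field_simp
    have hp := clusterRate_nonneg lam (n + 1)
    have hn : (0 : ℝ) ≤ ((n + 1 : ℕ) : ℝ) := by positivity
    rw [linearExtRate, min_eq_right h, abs_of_nonneg
      (add_nonneg hp (mul_nonneg hd0 (by linarith)))]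
    calc clusterRate lam (n + 1) + (clusterRate lam (n + 1) - clusterRate lam n) *
          (x - ((n + 1 : ℕ) : ℝ))
        ≤ x ^ max 1 lam + (2 * x ^ (max 1 lam - 1)) * x := by
          gcongr
          · linarith
          · linarith
          · linarith
      _ = _ := by rw [hxm]; ring

namespace IsRateFlow

variable {lam b : ℝ} {m : ℝ → ℝ} {c : ℝ → ℕ → ℝ}

/-- The weight k^λ is not eventually constant, so it is replaced beyond a large size by its linear
extension. The linear part pairs with the conserved mass; the remainder is eventually constant with
uniformly bounded second differences, so the time derivative is bounded by a multiple of M_λ. -/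
lemma exists_lipschitz (h : IsRateFlow lam m b c) (hlam0 : 0 ≤ lam) (hlam2 : lam < 2) :
    ∃ L, ∀ s ∈ Icc 0 b, ∀ t ∈ Icc 0 b,
      |edgMoment lam (c t) - edgMoment lam (c s)| ≤ L * |t - s| := by
  obtain ⟨C, hC, hD⟩ := abs_secondDiff_clusterRate_le lam hlam2
  obtain ⟨B, hB⟩ := h.bdd
  obtain ⟨A, hA⟩ := h.rate_bdd
  refine ⟨A * (C * B), fun s hs t ht => ?_⟩
  have h0 : (0 : ℝ) ∈ Icc 0 b := ⟨le_rfl, ht.1.trans ht.2⟩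
  have hconv : ∀ t ∈ Icc 0 b, Tendsto
      (fun n : ℕ => ∑' l : ℕ, linearExtRate lam n (l + 1) * c t (l + 1)) atTop
      (𝓝 (edgMoment lam (c t))) := by
    intro t ht
    refine tendsto_tsum_of_dominated_convergence ((h.summable t ht).mul_left 3) (fun l => ?_)
      (Eventually.of_forall fun n l => ?_)
    · refine tendsto_const_nhds.congr' ?_
      filter_upwards [eventually_ge_atTop l] with n hn
      rw [linearExtRate_of_le (by omega), clusterRate_succ]
    · rw [Real.norm_eq_abs, abs_mul, abs_of_nonneg (h.nonneg t ht l), ← mul_assoc]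
      exact mul_le_mul_of_nonneg_right (abs_linearExtRate_le hlam0 hlam2 n l) (h.nonneg t ht l)
  refine le_of_tendsto ((hconv t ht).sub (hconv s hs)).abs (Eventually.of_forall fun n => ?_)
  set d : ℝ := clusterRate lam (n + 1) - clusterRate lam n with hd
  set ψ : ℕ → ℝ := fun k => clusterRate lam (min k (n + 1)) - d * ((min k (n + 1) : ℕ) : ℝ) with hψ
  have hdec : ∀ t ∈ Icc 0 b, ∑' l : ℕ, linearExtRate lam n (l + 1) * c t (l + 1) =
      ∑' l : ℕ, ψ (l + 1) * c t (l + 1) + d * edgMoment 1 (c 0) := by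
    intro t ht
    rw [← h.edgMoment_one ht, edgMoment, ← tsum_mul_left, ← Summable.tsum_add]
    · refine tsum_congr fun l => ?_
      rw [linearExtRate, hψ, Real.rpow_one]; ring
    · have h1 := (summable_weighted (h.nonneg t ht) (h.summable t ht)
        (abs_linearExtRate_le hlam0 hlam2 n)).sub ((summable_moment_mono (le_max_left 1 lam)
          (h.nonneg t ht) (h.summable t ht)).mul_left d)
      refine h1.congr fun l => ?_
      rw [linearExtRate, hψ, Real.rpow_one]; ring
    · exact (summable_moment_mono (le_max_left 1 lam)
        (h.nonneg t ht) (h.summable t ht)).mul_left d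
  have hψc := fun t ht => h.tsum_eventually_const ψ (by simp only [hψ]; rw [Nat.zero_min]; simp) (n + 1)
    (fun k hk => by simp only [hψ]; rw [min_eq_right hk, min_self]) (t := t) ht
  have hψD : ∀ i ∈ Finset.range (n + 1), |secondDiff ψ i| ≤ C := by
    intro i hi
    rw [Finset.mem_range] at hi
    rcases Nat.lt_or_ge i n with hin | hin
    · refine le_trans (le_of_eq ?_) (hD i)
      simp only [secondDiff, hψ]
      rw [min_eq_left (by omega), min_eq_left (by omega), min_eq_left (by omega)]
      congr 1; push_cast; ring
    -- The slope `d` is the last increment before the junction, so the remainder has no kink there: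
    -- ψ(n) = ψ(n+1) = ψ(n+2).
    · obtain rfl : i = n := by omega
      have : secondDiff ψ i = 0 := by
        simp only [secondDiff, hψ]
        rw [min_eq_right (by omega), min_eq_left (by omega), min_eq_left (by omega), hd]
        push_cast; ring
      rw [this, abs_zero]; exact hC.le
  set q : ℝ → ℝ := fun s => ∑ i ∈ Finset.range (n + 1),
    (clusterRate lam (i + 1) * c s (i + 1)) * secondDiff ψ i with hq
  have hqb : ∀ s ∈ Icc 0 b, |q s| ≤ C * B := by
    intro s hs
    have hsum := summable_moment_mono (le_max_right 1 lam) (h.nonneg s hs) (h.summable s hs)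
    calc |q s| ≤ ∑ i ∈ Finset.range (n + 1),
          |(clusterRate lam (i + 1) * c s (i + 1)) * secondDiff ψ i| :=
          Finset.abs_sum_le_sum_abs _ _
      _ ≤ ∑ i ∈ Finset.range (n + 1), C * (((i + 1 : ℕ) : ℝ) ^ lam * c s (i + 1)) := by
          refine Finset.sum_le_sum fun i hi => ?_
          rw [abs_mul, abs_of_nonneg (h.rate_mul_nonneg hs _), mul_comm, ← clusterRate_succ]
          exact mul_le_mul_of_nonneg_right (hψD i hi) (h.rate_mul_nonneg hs _)
      _ ≤ C * edgMoment lam (c s) := by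
          rw [← Finset.mul_sum]
          exact mul_le_mul_of_nonneg_left (hsum.sum_le_tsum _ fun i _ =>
            mul_nonneg (by positivity) (h.nonneg s hs i)) hC.le
      _ ≤ C * B := mul_le_mul_of_nonneg_left ((edgMoment_mono (le_max_right 1 lam)
          (h.nonneg s hs) (h.summable s hs)).trans (hB s hs)) hC.le
  have hqc : ContinuousOn q (Icc 0 b) := continuousOn_finsetSum _ fun i _ =>
    (h.continuousOn_rate_mul (i + 1)).mul continuousOn_const
  have hdiff : ∑' l : ℕ, linearExtRate lam n (l + 1) * c t (l + 1) -
      ∑' l : ℕ, linearExtRate lam n (l + 1) * c s (l + 1) = ∫ x in s..t, m x * q x := by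
    rw [hdec t ht, hdec s hs, hψc t ht, hψc s hs, ← intervalIntegral.integral_interval_sub_left
      (h.intervalIntegrable_mul hqc h0 ht) (h.intervalIntegrable_mul hqc h0 hs)]
    ring
  rw [hdiff, ← Real.norm_eq_abs]
  refine intervalIntegral.norm_integral_le_of_norm_le_const fun x hx => ?_
  have hx' : x ∈ Icc 0 b := uIcc_subset_Icc hs ht (uIoc_subset_uIcc hx)
  rw [Real.norm_eq_abs, abs_mul]
  exact mul_le_mul (hA x hx') (hqb x hx') (abs_nonneg _) ((abs_nonneg _).trans (hA x hx'))

lemma continuousOn_edgMoment (h : IsRateFlow lam m b c) (hlam0 : 0 ≤ lam) (hlam2 : lam < 2) :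
    ContinuousOn (fun t => edgMoment lam (c t)) (Icc 0 b) := by
  obtain ⟨L, hL⟩ := h.exists_lipschitz hlam0 hlam2
  refine LipschitzOnWith.continuousOn (K := L.toNNReal)
    (LipschitzOnWith.of_dist_le_mul fun t ht s hs => ?_)
  rw [Real.dist_eq, Real.dist_eq]
  exact (hL s hs t ht).trans (mul_le_mul_of_nonneg_right (Real.le_coe_toNNReal L) (abs_nonneg _))

end IsRateFlow

/-! ### Minimum principle and truncated systems -/

/-- Discrete Dirichlet energy: the defect in the inequality is the sum of the squared increments. -/
lemma sum_mul_secondDiff_self_le (n : ℕ → ℝ) (h0 : n 0 = 0) (N : ℕ) :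
    ∑ i ∈ Finset.range N, n (i + 1) * secondDiff n i ≤ n N * n (N + 1) - n N ^ 2 := by
  induction N with
  | zero => simp [h0]
  | succ N ih =>
    rw [Finset.sum_range_succ]
    simp only [secondDiff] at *
    nlinarith [sq_nonneg (n (N + 1) - n N)]

/-- Replacing v by -v⁻ leaves the central term of v⁻Δv unchanged and can only lower the neighbouring
ones. This gives -v⁻Δv⁻, whose sum is nonnegative by the energy inequality because v⁻ vanishes at `N
+ 1`. -/
lemma sum_negPart_mul_secondDiff_nonneg (v : ℕ → ℝ) (N : ℕ) (h0 : v 0 = 0)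
    (hN : 0 ≤ v (N + 1)) :
    0 ≤ ∑ i ∈ Finset.range N, max (-v (i + 1)) 0 * secondDiff v i := by
  have h1 := sum_mul_secondDiff_self_le (fun k => max (-v k) 0) (by simp [h0]) N
  have h2 : max (-v (N + 1)) 0 = 0 := max_eq_right (by linarith)
  have h3 : -∑ i ∈ Finset.range N, max (-v (i + 1)) 0 * secondDiff (fun k => max (-v k) 0) i ≤
      ∑ i ∈ Finset.range N, max (-v (i + 1)) 0 * secondDiff v i := by
    rw [← Finset.sum_neg_distrib]
    refine Finset.sum_le_sum fun i _ => ?_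
    simp only [secondDiff]
    have a1 : -v (i + 2) ≤ max (-v (i + 2)) 0 := le_max_left _ _
    have a2 : -v i ≤ max (-v i) 0 := le_max_left _ _
    have a3 : 0 ≤ max (-v (i + 1)) 0 := le_max_right _ _
    have a4 : max (-v (i + 1)) 0 * v (i + 1) = -(max (-v (i + 1)) 0 * max (-v (i + 1)) 0) := by
      rcases le_total (-v (i + 1)) 0 with h | h
      · rw [max_eq_right h]; simp
      · rw [max_eq_left h]; ring
    nlinarith [mul_nonneg a3 (show 0 ≤ v (i + 2) + max (-v (i + 2)) 0 by linarith),
      mul_nonneg a3 (show 0 ≤ v i + max (-v i) 0 by linarith)]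
  simp only [h2, mul_zero] at h1
  nlinarith [sq_nonneg (max (-v N) 0)]

/-- Minimum principle for the system on finitely many cluster sizes. -/
lemma rate_comparison {lam b : ℝ} {m : ℝ → ℝ} {w : ℝ → ℕ → ℝ} {N : ℕ}
    (hm : ∀ t ∈ Ioo 0 b, 0 ≤ m t)
    (hc : ∀ i < N, ContinuousOn (fun t => w t (i + 1)) (Icc 0 b))
    (hd : ∀ i < N, ∀ t ∈ Ioo 0 b, HasDerivAt (fun t => w t (i + 1))
      (m t * secondDiff (fun k => clusterRate lam k * w t k) i) t)
    (hN : ∀ t ∈ Ioo 0 b, 0 ≤ w t (N + 1)) (h0 : ∀ i < N, 0 ≤ w 0 (i + 1))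
    {t : ℝ} (ht : t ∈ Icc 0 b) {i : ℕ} (hi : i < N) : 0 ≤ w t (i + 1) := by
  -- The weight `clusterRate` turns the test function into the negative part of v = k^λ w, the
  -- sequence that the second difference acts on. Thus E' = -2m Σ v⁻Δv ≤ 0.
  set E : ℝ → ℝ := fun t => ∑ i ∈ Finset.range N,
    clusterRate lam (i + 1) * (max (-w t (i + 1)) 0) ^ 2 with hE
  have hanti : AntitoneOn E (Icc 0 b) := by
    refine antitoneOn_of_hasDerivWithinAt_nonpos (f' := fun t => ∑ i ∈ Finset.range N,
      clusterRate lam (i + 1) * (2 * max (-w t (i + 1)) 0 *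
        (-(m t * secondDiff (fun k => clusterRate lam k * w t k) i)))) (convex_Icc 0 b) ?_ ?_ ?_
    · refine continuousOn_finsetSum _ fun i hi => continuousOn_const.mul ?_
      exact (((hc i (Finset.mem_range.1 hi)).neg).sup continuousOn_const).pow 2
    · intro t ht
      rw [interior_Icc] at ht ⊢
      refine HasDerivAt.hasDerivWithinAt ?_
      refine HasDerivAt.fun_sum fun i hi => HasDerivAt.const_mul _ ?_
      exact (hasDerivAt_posPart_sq (-w t (i + 1))).comp t (hd i (Finset.mem_range.1 hi) t ht).neg
    · intro t ht
      rw [interior_Icc] at ht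
      have := sum_negPart_mul_secondDiff_nonneg (fun k => clusterRate lam k * w t k) N (by simp)
        (mul_nonneg (clusterRate_nonneg _ _) (hN t ht))
      have e : ∑ i ∈ Finset.range N, clusterRate lam (i + 1) * (2 * max (-w t (i + 1)) 0 *
          (-(m t * secondDiff (fun k => clusterRate lam k * w t k) i))) =
          -(2 * m t) * ∑ i ∈ Finset.range N, max (-(clusterRate lam (i + 1) * w t (i + 1))) 0 *
            secondDiff (fun k => clusterRate lam k * w t k) i := by
        rw [Finset.mul_sum]
        refine Finset.sum_congr rfl fun i _ => ?_
        have : max (-(clusterRate lam (i + 1) * w t (i + 1))) 0 =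
            clusterRate lam (i + 1) * max (-w t (i + 1)) 0 := by
          rw [mul_max_of_nonneg _ _ (clusterRate_nonneg _ _)]; simp
        rw [this]; ring
      rw [e]
      nlinarith [mul_nonneg (hm t ht) this]
  have hE0 : E 0 = 0 := Finset.sum_eq_zero fun i hi => by
    rw [max_eq_right (by linarith [h0 i (Finset.mem_range.1 hi)])]; simp
  have hEt : E t ≤ 0 := hE0 ▸ hanti ⟨le_rfl, ht.1.trans ht.2⟩ ht ht.1
  have hnn : ∀ i ∈ Finset.range N, 0 ≤ clusterRate lam (i + 1) * (max (-w t (i + 1)) 0) ^ 2 :=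
    fun i _ => mul_nonneg (clusterRate_nonneg _ _) (sq_nonneg _)
  have hz := (Finset.sum_eq_zero_iff_of_nonneg hnn).1
    (le_antisymm hEt (Finset.sum_nonneg hnn)) i (Finset.mem_range.2 hi)
  have hz' : max (-w t (i + 1)) 0 = 0 := by
    rcases mul_eq_zero.1 hz with h | h
    · exact absurd h (clusterRate_succ_pos lam i).ne'
    · exact pow_eq_zero_iff (two_ne_zero) |>.1 h
  linarith [le_max_left (-w t (i + 1)) 0]

/-- The system truncated at cluster size `N`, with everything above `N` removed. -/
structure IsTruncated (lam : ℝ) (N : ℕ) (x : ℕ → ℝ) (u : ℝ → ℕ → ℝ) : Prop where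
  above : ∀ t k, N < k → u t k = 0
  init : ∀ i < N, u 0 (i + 1) = x (i + 1)
  deriv : ∀ i < N, ∀ t, HasDerivAt (fun t => u t (i + 1))
    (secondDiff (fun k => clusterRate lam k * u t k) i) t

/-- A linear system in dimension `N`, solved by the matrix exponential; `ext` pads a vector with
zeros at size 0 and above `N`. -/
lemma exists_isTruncated (lam : ℝ) (N : ℕ) (x : ℕ → ℝ) : ∃ u, IsTruncated lam N x u := by
  let ext : (Fin N → ℝ) → ℕ → ℝ := fun y k =>
    if h : 0 < k ∧ k - 1 < N then y ⟨k - 1, h.2⟩ else 0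
  have hadd : ∀ y z k, ext (y + z) k = ext y k + ext z k := by
    intro y z k; simp only [ext]; split_ifs <;> simp
  have hsmul : ∀ (r : ℝ) y k, ext (r • y) k = r * ext y k := by
    intro r y k; simp only [ext]; split_ifs <;> simp
  let A : (Fin N → ℝ) →ₗ[ℝ] (Fin N → ℝ) :=
    { toFun := fun y i => secondDiff (fun k => clusterRate lam k * ext y k) i
      map_add' := fun y z => by
        funext i; simp only [secondDiff, hadd, Pi.add_apply]; ring
      map_smul' := fun r y => by
        funext i; simp only [secondDiff, hsmul, Pi.smul_apply, smul_eq_mul, RingHom.id_apply]; ring }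
  let L : (Fin N → ℝ) →L[ℝ] (Fin N → ℝ) := LinearMap.toContinuousLinearMap A
  let y₀ : Fin N → ℝ := fun i => x (i + 1)
  let y : ℝ → Fin N → ℝ := fun t => NormedSpace.exp (t • L) y₀
  have hy : ∀ t, HasDerivAt y (A (y t)) t := by
    intro t
    have h1 := (hasDerivAt_exp_smul_const' (𝕂 := ℝ) L t).clm_apply (hasDerivAt_const t y₀)
    simpa [L, y] using h1
  have hext : ∀ i (hi : i < N) t, ext (y t) (i + 1) = y t ⟨i, hi⟩ := by
    intro i hi t; simp [ext, hi]
  refine ⟨fun t => ext (y t), ⟨fun t k hk => ?_, fun i hi => ?_, fun i hi t => ?_⟩⟩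
  · simp only [ext]; rw [dif_neg]; omega
  · rw [hext i hi]; simp [y, y₀]
  · simp only [hext i hi]
    exact (hasDerivAt_pi.1 (hy t)) ⟨i, hi⟩

namespace IsTruncated

variable {lam : ℝ} {N : ℕ} {x : ℕ → ℝ} {u : ℝ → ℕ → ℝ}

lemma continuous (h : IsTruncated lam N x u) (i : ℕ) : Continuous (fun t => u t (i + 1)) := by
  rcases Nat.lt_or_ge i N with hi | hi
  · exact continuous_iff_continuousAt.2 fun t => (h.deriv i hi t).continuousAt
  · simp only [h.above _ (i + 1) (by omega)]; exact continuous_const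

lemma nonneg (h : IsTruncated lam N x u) (hx : ∀ i, 0 ≤ x (i + 1)) {t : ℝ} (ht : 0 ≤ t) (i : ℕ) :
    0 ≤ u t (i + 1) := by
  rcases Nat.lt_or_ge i N with hi | hi
  · exact rate_comparison (lam := lam) (b := t) (m := fun _ => 1) (N := N)
      (fun _ _ => zero_le_one) (fun i _ => (h.continuous i).continuousOn)
      (fun i hi t _ => by simpa using h.deriv i hi t)
      (fun t _ => (h.above t (N + 1) (by omega)).ge)
      (fun i hi => by rw [h.init i hi]; exact hx i) ⟨ht, le_rfl⟩ hi
  · rw [h.above t (i + 1) (by omega)]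

/-- Supersolutions of the backward equation bound weighted sums of the truncated system. -/
lemma sum_le_of_supersolution (h : IsTruncated lam N x u) (hx : ∀ i, 0 ≤ x (i + 1))
    {H H' : ℝ → ℕ → ℝ} {τ : ℝ} (hτ : 0 ≤ τ) (hH0 : ∀ s, H s 0 = 0)
    (hHnn : ∀ s ∈ Icc 0 τ, ∀ i, 0 ≤ H s (i + 1))
    (hHc : ∀ i, ContinuousOn (fun s => H s (i + 1)) (Icc 0 τ))
    (hHd : ∀ i, ∀ s ∈ Ioo 0 τ, HasDerivAt (fun s => H s (i + 1)) (H' s i) s)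
    (hsup : ∀ i, ∀ s ∈ Ioo 0 τ, clusterRate lam (i + 1) * secondDiff (H s) i ≤ H' s i) :
    ∑ i ∈ Finset.range N, H 0 (i + 1) * u τ (i + 1) ≤
      ∑ i ∈ Finset.range N, H τ (i + 1) * x (i + 1) := by
  -- Duality: the weight runs backward while `u` runs forward. After summation by parts the interior
  -- terms are nonpositive by the supersolution property, and the remaining boundary term carries
  -- -H(N+1) ≤ 0.
  set G : ℝ → ℝ := fun s => ∑ i ∈ Finset.range N, H (τ - s) (i + 1) * u s (i + 1) with hG
  have hmap : ∀ s ∈ Icc 0 τ, τ - s ∈ Icc 0 τ := fun s hs => ⟨by linarith [hs.2], by linarith [hs.1]⟩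
  have hanti : AntitoneOn G (Icc 0 τ) := by
    refine antitoneOn_of_hasDerivWithinAt_nonpos (f' := fun s => ∑ i ∈ Finset.range N,
      (-H' (τ - s) i * u s (i + 1) + H (τ - s) (i + 1) *
        secondDiff (fun k => clusterRate lam k * u s k) i)) (convex_Icc 0 τ) ?_ ?_ ?_
    · refine continuousOn_finsetSum _ fun i _ => ContinuousOn.mul ?_ (h.continuous i).continuousOn
      exact (hHc i).comp (by fun_prop) hmap
    · intro s hs
      rw [interior_Icc] at hs ⊢
      refine (HasDerivAt.fun_sum fun i hi => ?_).hasDerivWithinAt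
      refine HasDerivAt.fun_mul ?_ (h.deriv i (Finset.mem_range.1 hi) s)
      exact (hHd i (τ - s) ⟨by linarith [hs.2], by linarith [hs.1]⟩).comp_const_sub τ s
    · intro s hs
      rw [interior_Icc] at hs
      have hs' : τ - s ∈ Ioo 0 τ := ⟨by linarith [hs.2], by linarith [hs.1]⟩
      rw [Finset.sum_add_distrib, sum_mul_secondDiff (H (τ - s))
        (fun k => clusterRate lam k * u s k) N (hH0 _) (by simp)]
      simp only [h.above s (N + 1) (by omega), mul_zero]
      have h1 : ∑ i ∈ Finset.range N, -H' (τ - s) i * u s (i + 1) +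
          ∑ i ∈ Finset.range N, clusterRate lam (i + 1) * u s (i + 1) * secondDiff (H (τ - s)) i
          ≤ 0 := by
        rw [← Finset.sum_add_distrib]
        refine Finset.sum_nonpos fun i _ => ?_
        nlinarith [mul_le_mul_of_nonneg_right (hsup i (τ - s) hs') (h.nonneg hx hs.1.le i)]
      have h2 : 0 ≤ H (τ - s) (N + 1) * (clusterRate lam N * u s N) := by
        refine mul_nonneg (hHnn _ (Ioo_subset_Icc_self hs') N) ?_
        cases N with
        | zero => simp
        | succ n => exact mul_nonneg (clusterRate_nonneg _ _) (h.nonneg hx hs.1.le n)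
      linarith
  have := hanti ⟨le_rfl, hτ⟩ ⟨hτ, le_rfl⟩ hτ
  simp only [hG, sub_self, sub_zero] at this
  refine this.trans (le_of_eq (Finset.sum_congr rfl fun i hi => ?_))
  rw [h.init i (Finset.mem_range.1 hi)]

/-- Minimum principle for the difference: at size `N + 1` the smaller system is zero and the larger
one nonnegative. -/
lemma mono {N' : ℕ} {u' : ℝ → ℕ → ℝ} (h : IsTruncated lam N x u) (h' : IsTruncated lam N' x u')
    (hNN : N ≤ N') (hx : ∀ i, 0 ≤ x (i + 1)) {t : ℝ} (ht : 0 ≤ t) (i : ℕ) :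
    u t (i + 1) ≤ u' t (i + 1) := by
  rcases Nat.lt_or_ge i N with hi | hi
  · rw [← sub_nonneg]
    refine rate_comparison (lam := lam) (b := t) (m := fun _ => 1) (N := N)
      (w := fun t k => u' t k - u t k)
      (fun _ _ => zero_le_one) (fun i _ => ((h'.continuous i).sub (h.continuous i)).continuousOn)
      (fun i hi t _ => ?_) (fun s hs => ?_) (fun i hi => ?_) ⟨ht, le_rfl⟩ hi
    · refine ((h'.deriv i (by omega) t).fun_sub (h.deriv i hi t)).congr_deriv ?_
      simp only [secondDiff]; ring
    · rw [h.above s (N + 1) (by omega), sub_zero]; exact h'.nonneg hx hs.1.le N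
    · rw [h.init i hi, h'.init i (by omega), sub_self]
  · rw [h.above t (i + 1) (by omega)]; exact h'.nonneg hx ht i

end IsTruncated

lemma IsRateFlow.hasDerivAt {lam b : ℝ} {m : ℝ → ℝ} {c : ℝ → ℕ → ℝ} (h : IsRateFlow lam m b c)
    (hm : ContinuousOn m (Icc 0 b)) (i : ℕ) {t : ℝ} (ht : t ∈ Ioo 0 b) :
    HasDerivAt (fun t => c t (i + 1))
      (m t * secondDiff (fun k => clusterRate lam k * c t k) i) t := by
  have hv := h.continuousOn_rate_mul
  have hf : ContinuousOn (fun t => m t * secondDiff (fun k => clusterRate lam k * c t k) i)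
      (Icc 0 b) :=
    hm.mul (((hv (i + 2)).sub (continuousOn_const.mul (hv (i + 1)))).add (hv i))
  have h1 := intervalIntegral.integral_hasDerivAt_right (a := 0) (b := t)
    (f := fun t => m t * secondDiff (fun k => clusterRate lam k * c t k) i)
    (ContinuousOn.intervalIntegrable (hf.mono (by
      rw [uIcc_of_le ht.1.le]; exact Icc_subset_Icc_right ht.2.le)))
    ((hf.mono Ioo_subset_Icc_self).stronglyMeasurableAtFilter isOpen_Ioo t ht)
    (hf.continuousAt (Icc_mem_nhds ht.1 ht.2))
  refine (h1.const_add (c 0 (i + 1))).congr_of_eventuallyEq ?_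
  filter_upwards [Ioo_mem_nhds ht.1 ht.2] with s hs
  exact h.eqn i s (Ioo_subset_Icc_self hs)

/-! ### The limit of the truncations -/

/-- `U` is the limit of the truncated systems with initial data `x`. -/
structure IsLimitFlow (lam : ℝ) (x : ℕ → ℝ) (U : ℝ → ℕ → ℝ) : Prop where
  mem : MemEDGCone (max 1 lam) x
  approx : ∃ u : ℕ → ℝ → ℕ → ℝ, (∀ N, IsTruncated lam N x (u N)) ∧
    ∀ t, 0 ≤ t → ∀ i, Tendsto (fun N => u N t (i + 1)) atTop (𝓝 (U t (i + 1)))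

namespace IsTruncated

variable {lam : ℝ} {N : ℕ} {x : ℕ → ℝ} {u : ℝ → ℕ → ℝ}

/-- The weight `k` has zero second difference, so truncation can only lose mass. The resulting bound
is uniform in `N`. -/
lemma le_edgMoment_one (h : IsTruncated lam N x u) (hx : MemEDGCone (max 1 lam) x) {t : ℝ}
    (ht : 0 ≤ t) (i : ℕ) : u t (i + 1) ≤ edgMoment 1 x := by
  have hx0 : ∀ i, 0 ≤ x (i + 1) := fun i => hx.1 _
  rcases Nat.lt_or_ge i N with hi | hi
  · have h1 := h.sum_le_of_supersolution hx0 (H := fun _ k => (k : ℝ)) (H' := fun _ _ => 0) ht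
      (by simp) (fun _ _ _ => by positivity) (fun _ => continuousOn_const)
      (fun _ _ _ => hasDerivAt_const _ _)
      (fun i _ _ => le_of_eq (by simp only [secondDiff]; push_cast; ring))
    have h2 : ((i + 1 : ℕ) : ℝ) * u t (i + 1) ≤
        ∑ i ∈ Finset.range N, ((i + 1 : ℕ) : ℝ) * u t (i + 1) :=
      Finset.single_le_sum (f := fun i : ℕ => ((i + 1 : ℕ) : ℝ) * u t (i + 1))
        (fun j _ => mul_nonneg (by positivity) (h.nonneg hx0 ht j)) (Finset.mem_range.2 hi)
    have h3 : ∑ i ∈ Finset.range N, ((i + 1 : ℕ) : ℝ) * x (i + 1) ≤ edgMoment 1 x := by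
      have := (summable_moment_mono (le_max_left 1 lam) hx0 hx.2).sum_le_tsum (Finset.range N)
        fun i _ => mul_nonneg (by positivity) (hx0 i)
      simpa only [edgMoment, Real.rpow_one] using this
    have h4 := le_mul_of_one_le_left (h.nonneg hx0 ht i) (one_le_cast_succ i)
    linarith
  · rw [h.above t (i + 1) (by omega)]; exact edgMoment_nonneg hx0

lemma rate_mul_mem (h : IsTruncated lam N x u) (hx : MemEDGCone (max 1 lam) x) {t : ℝ}
    (ht : 0 ≤ t) (k : ℕ) :
    clusterRate lam k * u t k ∈ Icc 0 (clusterRate lam k * edgMoment 1 x) := by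
  cases k with
  | zero => simp
  | succ i => exact ⟨mul_nonneg (clusterRate_nonneg _ _) (h.nonneg (fun i => hx.1 _) ht i),
      mul_le_mul_of_nonneg_left (h.le_edgMoment_one hx ht i) (clusterRate_nonneg _ _)⟩

lemma exists_secondDiff_bound (lam : ℝ) (hx : MemEDGCone (max 1 lam) x) (i : ℕ) :
    ∃ B, ∀ N u, IsTruncated lam N x u → ∀ t, 0 ≤ t →
      |secondDiff (fun k => clusterRate lam k * u t k) i| ≤ B := by
  refine ⟨clusterRate lam (i + 2) * edgMoment 1 x + 2 * (clusterRate lam (i + 1) * edgMoment 1 x) +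
    clusterRate lam i * edgMoment 1 x, fun N u h t ht => ?_⟩
  have h1 := h.rate_mul_mem hx ht i
  have h2 := h.rate_mul_mem hx ht (i + 1)
  have h3 := h.rate_mul_mem hx ht (i + 2)
  simp only [secondDiff]
  rw [abs_le]; constructor <;> linarith [h1.1, h1.2, h2.1, h2.2, h3.1, h3.2]

lemma continuous_secondDiff (h : IsTruncated lam N x u) (i : ℕ) :
    Continuous fun t => secondDiff (fun k => clusterRate lam k * u t k) i := by
  have hv : ∀ k, Continuous fun t => clusterRate lam k * u t k := by
    intro k
    cases k with
    | zero => simpa using continuous_const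
    | succ i => exact continuous_const.mul (h.continuous i)
  exact ((hv (i + 2)).sub (continuous_const.mul (hv (i + 1)))).add (hv i)

lemma integral_eq (h : IsTruncated lam N x u) {i : ℕ} (hi : i < N) (s t : ℝ) :
    u t (i + 1) - u s (i + 1) = ∫ r in s..t, secondDiff (fun k => clusterRate lam k * u r k) i :=
  (intervalIntegral.integral_eq_sub_of_hasDerivAt (fun r _ => h.deriv i hi r)
    ((h.continuous_secondDiff i).intervalIntegrable _ _)).symm

end IsTruncated

/-- The truncations increase with `N` and are bounded by the initial mass, so their supremum is
their limit. -/
lemma exists_isLimitFlow {lam : ℝ} {x : ℕ → ℝ} (hx : MemEDGCone (max 1 lam) x) :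
    ∃ U, IsLimitFlow lam x U := by
  choose u hu using fun N => exists_isTruncated lam N x
  refine ⟨fun t k => ⨆ N, u N t k, hx, u, hu, fun t ht i => ?_⟩
  refine tendsto_atTop_ciSup (fun N N' hN => (hu N).mono (hu N') hN (fun i => hx.1 _) ht i) ?_
  exact ⟨edgMoment 1 x, by rintro _ ⟨N, rfl⟩; exact (hu N).le_edgMoment_one hx ht i⟩

namespace IsLimitFlow

variable {lam : ℝ} {x : ℕ → ℝ} {U : ℝ → ℕ → ℝ}

lemma init (h : IsLimitFlow lam x U) (i : ℕ) : U 0 (i + 1) = x (i + 1) := by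
  obtain ⟨u, hu, hlim⟩ := h.approx
  refine tendsto_nhds_unique (hlim 0 le_rfl i) (tendsto_const_nhds.congr' ?_)
  filter_upwards [eventually_gt_atTop i] with N hN
  exact ((hu N).init i hN).symm

lemma nonneg (h : IsLimitFlow lam x U) {t : ℝ} (ht : 0 ≤ t) (i : ℕ) : 0 ≤ U t (i + 1) := by
  obtain ⟨u, hu, hlim⟩ := h.approx
  exact ge_of_tendsto' (hlim t ht i) fun N => (hu N).nonneg (fun i => h.mem.1 _) ht i

/-- Supersolutions of the backward equation bound weighted sums of the limit flow. -/
lemma tsum_le_of_supersolution (h : IsLimitFlow lam x U)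
    {H H' : ℝ → ℕ → ℝ} {τ : ℝ} (hτ : 0 ≤ τ) (hH0 : ∀ s, H s 0 = 0)
    (hHnn : ∀ s ∈ Icc 0 τ, ∀ i, 0 ≤ H s (i + 1))
    (hHc : ∀ i, ContinuousOn (fun s => H s (i + 1)) (Icc 0 τ))
    (hHd : ∀ i, ∀ s ∈ Ioo 0 τ, HasDerivAt (fun s => H s (i + 1)) (H' s i) s)
    (hsup : ∀ i, ∀ s ∈ Ioo 0 τ, clusterRate lam (i + 1) * secondDiff (H s) i ≤ H' s i)
    (hsum : Summable fun l => H τ (l + 1) * x (l + 1)) :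
    Summable (fun l => H 0 (l + 1) * U τ (l + 1)) ∧
      ∑' l, H 0 (l + 1) * U τ (l + 1) ≤ ∑' l, H τ (l + 1) * x (l + 1) := by
  obtain ⟨u, hu, hlim⟩ := h.approx
  have hx0 : ∀ i, 0 ≤ x (i + 1) := fun i => h.mem.1 _
  have h0 : (0 : ℝ) ∈ Icc 0 τ := ⟨le_rfl, hτ⟩
  have hnn : ∀ l, 0 ≤ H 0 (l + 1) * U τ (l + 1) := fun l =>
    mul_nonneg (hHnn 0 h0 l) (h.nonneg hτ l)
  have key : ∀ K, ∑ l ∈ Finset.range K, H 0 (l + 1) * U τ (l + 1) ≤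
      ∑' l, H τ (l + 1) * x (l + 1) := by
    intro K
    refine le_of_tendsto (tendsto_finsetSum (Finset.range K) fun l _ =>
      (hlim τ hτ l).const_mul (H 0 (l + 1))) ?_
    filter_upwards [eventually_ge_atTop K] with N hN
    refine (Finset.sum_le_sum_of_subset_of_nonneg (Finset.range_mono hN) fun i _ _ =>
      mul_nonneg (hHnn 0 h0 i) ((hu N).nonneg hx0 hτ i)).trans ?_
    refine ((hu N).sum_le_of_supersolution hx0 hτ hH0 hHnn hHc hHd hsup).trans ?_
    exact hsum.sum_le_tsum _ fun i _ => mul_nonneg (hHnn τ ⟨hτ, le_rfl⟩ i) (hx0 i)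
  have hs := summable_of_sum_range_le hnn key
  exact ⟨hs, hs.tsum_le_of_sum_range_le key⟩

lemma moment_one_le (h : IsLimitFlow lam x U) {t : ℝ} (ht : 0 ≤ t) :
    Summable (fun l : ℕ => ((l + 1 : ℕ) : ℝ) ^ (1 : ℝ) * U t (l + 1)) ∧
      edgMoment 1 (U t) ≤ edgMoment 1 x := by
  have hs := summable_moment_mono (le_max_left 1 lam) (fun i => h.mem.1 _) h.mem.2
  have := h.tsum_le_of_supersolution (H := fun _ k => (k : ℝ)) (H' := fun _ _ => 0) ht
    (by simp) (fun _ _ _ => by positivity) (fun _ => continuousOn_const)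
    (fun _ _ _ => hasDerivAt_const _ _)
    (fun i _ _ => le_of_eq (by simp only [secondDiff]; push_cast; ring))
    (by simpa only [Real.rpow_one] using hs)
  simpa only [edgMoment, Real.rpow_one] using this

end IsLimitFlow

/-! ### Upper bound for the moment of order `lam > 1` -/

lemma crossover_pos {p r S : ℝ} (hS : 0 ≤ S) (i : ℕ) : 0 < crossover p r S (i + 1) := by
  unfold crossover; positivity

lemma hasDerivAt_crossover (p r K : ℝ) (i : ℕ) {s : ℝ} (hs : 0 ≤ K * s) :
    HasDerivAt (fun s => crossover p r (K * s) (i + 1))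
      (K * r * (((i + 1 : ℕ) : ℝ) * (((i + 1 : ℕ) : ℝ) ^ p + K * s) ^ (r - 1))) s := by
  unfold crossover
  have h1 : HasDerivAt (fun s => ((i + 1 : ℕ) : ℝ) ^ p + K * s) K s := by
    simpa using ((hasDerivAt_id s).const_mul K).const_add (((i + 1 : ℕ) : ℝ) ^ p)
  have hpos : ((i + 1 : ℕ) : ℝ) ^ p + K * s ≠ 0 := by positivity
  exact ((h1.rpow_const (p := r) (Or.inl hpos)).const_mul _).congr_deriv (by ring)

/-- On the backward equation, `crossover` varies at most as fast as its explicit time derivative. -/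
lemma exists_abs_rate_mul_secondDiff_crossover_le {lam : ℝ} (hlam2 : lam < 2) (r : ℝ) :
    ∃ C : ℝ, 0 < C ∧ ∀ S : ℝ, 0 ≤ S → ∀ i : ℕ,
      |clusterRate lam (i + 1) * secondDiff (crossover (2 - lam) r S) i| ≤
        C * (((i + 1 : ℕ) : ℝ) * (((i + 1 : ℕ) : ℝ) ^ (2 - lam) + S) ^ (r - 1)) := by
  obtain ⟨C, hC, h⟩ := exists_abs_secondDiff_crossover_le (2 - lam) r (by linarith)
  refine ⟨C, hC, fun S hS i => ?_⟩
  set k : ℝ := ((i + 1 : ℕ) : ℝ) with hk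
  have hk0 : 0 < k := by positivity
  rw [abs_mul, abs_of_nonneg (clusterRate_nonneg _ _), clusterRate_succ, ← hk]
  calc k ^ lam * |secondDiff (crossover (2 - lam) r S) i|
      ≤ k ^ lam * (C * (k ^ (2 - lam - 1) * (k ^ (2 - lam) + S) ^ (r - 1))) := by
        gcongr; exact h S hS i
    _ = C * ((k ^ lam * k ^ (2 - lam - 1)) * (k ^ (2 - lam) + S) ^ (r - 1)) := by ring
    _ = _ := by
        rw [← Real.rpow_add hk0, show lam + (2 - lam - 1) = 1 by ring, Real.rpow_one]

lemma add_rpow_le_two_rpow_mul {a b r : ℝ} (ha : 0 ≤ a) (hb : 0 ≤ b) (hr : 0 ≤ r) :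
    (a + b) ^ r ≤ 2 ^ r * (a ^ r + b ^ r) := by
  have h1 : a + b ≤ 2 * max a b := by linarith [le_max_left a b, le_max_right a b]
  calc (a + b) ^ r ≤ (2 * max a b) ^ r := Real.rpow_le_rpow (by positivity) h1 hr
    _ = 2 ^ r * (max a b) ^ r := Real.mul_rpow zero_le_two (by positivity)
    _ ≤ _ := by
      gcongr
      rcases le_total a b with h | h
      · rw [max_eq_right h]; linarith [Real.rpow_nonneg ha r]
      · rw [max_eq_left h]; linarith [Real.rpow_nonneg hb r]

/-- Growth of the moment of order `lam ∈ (1, 2)`. -/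
lemma exists_edgMoment_lam_le {lam : ℝ} (hlam1 : 1 < lam) (hlam2 : lam < 2) :
    ∃ K : ℝ, 0 < K ∧ ∀ x U, IsLimitFlow lam x U → ∀ t, 0 ≤ t →
      Summable (fun l : ℕ => ((l + 1 : ℕ) : ℝ) ^ lam * U t (l + 1)) ∧
      edgMoment lam (U t) ≤ 2 ^ ((lam - 1) / (2 - lam)) *
        (edgMoment lam x + (K * t) ^ ((lam - 1) / (2 - lam)) * edgMoment 1 x) := by
  -- With this exponent the crossover weight equals k^λ at `S = 0`, while for large `S` it is close
  -- to k S^r, so the final bound involves only M_λ and the mass of the data.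
  set r : ℝ := (lam - 1) / (2 - lam) with hr
  have hr0 : 0 < r := div_pos (by linarith) (by linarith)
  have hpr : (2 - lam) * r = lam - 1 := by
    rw [hr]; field_simp [show (2 - lam) ≠ 0 by linarith]
  obtain ⟨C, hC, hcr⟩ := exists_abs_rate_mul_secondDiff_crossover_le hlam2 r
  -- At speed `K = C / r` the time derivative of the crossover weight has prefactor `K * r = C`,
  -- just enough to dominate the spatial term.
  refine ⟨C / r, by positivity, fun x U h t ht => ?_⟩
  have hx0 : ∀ i, 0 ≤ x (i + 1) := fun i => h.mem.1 _
  have hmax : max 1 lam = lam := max_eq_right hlam1.le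
  have hsl := h.mem.2
  rw [hmax] at hsl
  have hs1 := summable_moment_mono hlam1.le hx0 hsl
  have hK : ∀ s, 0 ≤ s → 0 ≤ C / r * s := fun s hs => by positivity
  have hkp : ∀ l : ℕ, ((l + 1 : ℕ) : ℝ) * (((l + 1 : ℕ) : ℝ) ^ (2 - lam)) ^ r =
      ((l + 1 : ℕ) : ℝ) ^ lam := fun l => by
    rw [← Real.rpow_mul (by positivity), hpr, Real.rpow_sub_one (by positivity)]; field_simp
  have hle : ∀ l : ℕ, crossover (2 - lam) r (C / r * t) (l + 1) * x (l + 1) ≤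
      2 ^ r * (((l + 1 : ℕ) : ℝ) ^ lam * x (l + 1) +
        (C / r * t) ^ r * (((l + 1 : ℕ) : ℝ) ^ (1 : ℝ) * x (l + 1))) := by
    intro l
    have h1 := add_rpow_le_two_rpow_mul (a := ((l + 1 : ℕ) : ℝ) ^ (2 - lam)) (b := C / r * t)
      (by positivity) (hK t ht) hr0.le
    have h2 := mul_le_mul_of_nonneg_left h1 (show (0 : ℝ) ≤ ((l + 1 : ℕ) : ℝ) by positivity)
    have h3 := mul_le_mul_of_nonneg_right h2 (hx0 l)
    refine h3.trans (le_of_eq ?_)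
    rw [← hkp l, Real.rpow_one]; ring
  have hsB := ((hsl.add (hs1.mul_left ((C / r * t) ^ r))).mul_left (2 ^ r))
  have hsH : Summable fun l => crossover (2 - lam) r (C / r * t) (l + 1) * x (l + 1) :=
    hsB.of_nonneg_of_le (fun l => mul_nonneg (crossover_pos (hK t ht) l).le (hx0 l)) hle
  have hmain := h.tsum_le_of_supersolution (H := fun s k => crossover (2 - lam) r (C / r * s) k)
    (H' := fun s i => C / r * r * (((i + 1 : ℕ) : ℝ) *
      (((i + 1 : ℕ) : ℝ) ^ (2 - lam) + C / r * s) ^ (r - 1))) ht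
    (fun s => by simp [crossover]) (fun s hs i => (crossover_pos (hK s hs.1) i).le)
    (fun i s hs => (hasDerivAt_crossover _ _ _ i (hK s hs.1)).continuousAt.continuousWithinAt)
    (fun i s hs => hasDerivAt_crossover _ _ _ i (hK s hs.1.le))
    (fun i s hs => by
      refine (le_abs_self _).trans ((hcr _ (hK s hs.1.le) i).trans (le_of_eq ?_))
      rw [div_mul_cancel₀ _ hr0.ne'])
    hsH
  have h0 : ∀ l : ℕ, crossover (2 - lam) r (C / r * 0) (l + 1) = ((l + 1 : ℕ) : ℝ) ^ lam := by
    intro l; rw [mul_zero, crossover, add_zero, hkp]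
  simp only [h0] at hmain
  refine ⟨hmain.1, hmain.2.trans ((hsH.tsum_le_tsum hle hsB).trans (le_of_eq ?_))⟩
  rw [tsum_mul_left, Summable.tsum_add hsl (hs1.mul_left _), tsum_mul_left]
  rfl

namespace IsLimitFlow

variable {lam : ℝ} {x : ℕ → ℝ} {U : ℝ → ℕ → ℝ}

lemma integral_eq (h : IsLimitFlow lam x U) (i : ℕ) {s t : ℝ} (hs : 0 ≤ s) (ht : 0 ≤ t) :
    U t (i + 1) - U s (i + 1) =
      ∫ r in s..t, secondDiff (fun k => clusterRate lam k * U r k) i := by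
  obtain ⟨u, hu, hlim⟩ := h.approx
  obtain ⟨B, hB⟩ := IsTruncated.exists_secondDiff_bound lam h.mem i
  have hr0 : ∀ r ∈ uIoc s t, 0 ≤ r := fun r hr => (le_min hs ht).trans hr.1.le
  have hv : ∀ r, 0 ≤ r → ∀ k, Tendsto (fun N => clusterRate lam k * u N r k) atTop
      (𝓝 (clusterRate lam k * U r k)) := by
    intro r hr k
    cases k with
    | zero => simp
    | succ i => exact (hlim r hr i).const_mul _
  have h1 := intervalIntegral.tendsto_integral_filter_of_dominated_convergence
    (μ := volume) (a := s) (b := t) (l := atTop)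
    (F := fun N r => secondDiff (fun k => clusterRate lam k * u N r k) i)
    (f := fun r => secondDiff (fun k => clusterRate lam k * U r k) i) (fun _ => B)
    (Eventually.of_forall fun N => ((hu N).continuous_secondDiff i).aestronglyMeasurable)
    (Eventually.of_forall fun N => Eventually.of_forall fun r hr => by
      rw [Real.norm_eq_abs]; exact hB N (u N) (hu N) r (hr0 r hr))
    (by simp)
    (Eventually.of_forall fun r hr =>
      ((hv r (hr0 r hr) (i + 2)).sub ((hv r (hr0 r hr) (i + 1)).const_mul 2)).add
        (hv r (hr0 r hr) i))
  refine tendsto_nhds_unique (((hlim t ht i).sub (hlim s hs i)).congr' ?_) h1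
  filter_upwards [eventually_gt_atTop i] with N hN
  exact (hu N).integral_eq hN s t

lemma exists_lipschitz (h : IsLimitFlow lam x U) (i : ℕ) :
    ∃ B, ∀ s, 0 ≤ s → ∀ t, 0 ≤ t → |U t (i + 1) - U s (i + 1)| ≤ B * |t - s| := by
  obtain ⟨u, hu, hlim⟩ := h.approx
  obtain ⟨B, hB⟩ := IsTruncated.exists_secondDiff_bound lam h.mem i
  refine ⟨B, fun s hs t ht => ?_⟩
  refine le_of_tendsto ((hlim t ht i).sub (hlim s hs i)).abs ?_
  filter_upwards [eventually_gt_atTop i] with N hN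
  rw [(hu N).integral_eq hN s t, ← Real.norm_eq_abs]
  exact intervalIntegral.norm_integral_le_of_norm_le_const fun r hr =>
    hB N (u N) (hu N) r ((le_min hs ht).trans hr.1.le)

lemma continuousOn (h : IsLimitFlow lam x U) (i : ℕ) :
    ContinuousOn (fun t => U t (i + 1)) (Ici 0) := by
  obtain ⟨B, hB⟩ := h.exists_lipschitz i
  refine LipschitzOnWith.continuousOn (K := B.toNNReal)
    (LipschitzOnWith.of_dist_le_mul fun t ht s hs => ?_)
  rw [Real.dist_eq, Real.dist_eq]
  exact (hB s hs t ht).trans (mul_le_mul_of_nonneg_right (Real.le_coe_toNNReal B) (abs_nonneg _))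

/-- What has to be supplied is a bounded moment of order max(1, λ): mass suffices for λ ≤ 1, the
crossover bound for λ > 1. In particular no mass is lost in the limit `N → ∞`, although each
truncation may lose some. -/
lemma isRateFlow (h : IsLimitFlow lam x U) (hlam2 : lam < 2) (b : ℝ) :
    IsRateFlow lam (fun _ => 1) b U := by
  have hmom : ∃ B, ∀ t ∈ Icc 0 b,
      Summable (fun l : ℕ => ((l + 1 : ℕ) : ℝ) ^ max 1 lam * U t (l + 1)) ∧
      edgMoment (max 1 lam) (U t) ≤ B := by
    rcases le_or_gt lam 1 with h1 | h1
    · rw [max_eq_left h1]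
      exact ⟨edgMoment 1 x, fun t ht => h.moment_one_le ht.1⟩
    · rw [max_eq_right h1.le]
      obtain ⟨K, hK, hKb⟩ := exists_edgMoment_lam_le h1 hlam2
      refine ⟨2 ^ ((lam - 1) / (2 - lam)) *
        (edgMoment lam x + (K * b) ^ ((lam - 1) / (2 - lam)) * edgMoment 1 x), fun t ht =>
        ⟨(hKb x U h t ht.1).1, (hKb x U h t ht.1).2.trans ?_⟩⟩
      have : (K * t) ^ ((lam - 1) / (2 - lam)) ≤ (K * b) ^ ((lam - 1) / (2 - lam)) :=
        Real.rpow_le_rpow (mul_nonneg hK.le ht.1) (mul_le_mul_of_nonneg_left ht.2 hK.le)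
          (div_nonneg (by linarith) (by linarith))
      have h1 : 0 ≤ edgMoment 1 x := edgMoment_nonneg fun i => h.mem.1 _
      gcongr
  obtain ⟨B, hB⟩ := hmom
  exact
    { nonneg := fun t ht i => h.nonneg ht.1 i
      summable := fun t ht => (hB t ht).1
      bdd := ⟨B, fun t ht => (hB t ht).2⟩
      cont := fun i => (h.continuousOn i).mono Icc_subset_Ici_self
      rate_int := by simp
      rate_bdd := ⟨1, by simp⟩
      eqn := fun i t ht => by
        simp only [one_mul]
        rw [← h.integral_eq i le_rfl ht.1]; ring }

lemma edgMoment_one (h : IsLimitFlow lam x U) (hlam2 : lam < 2) {t : ℝ} (ht : 0 ≤ t) :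
    edgMoment 1 (U t) = edgMoment 1 x := by
  rw [(h.isRateFlow hlam2 t).edgMoment_one ⟨ht, le_rfl⟩]
  simp only [edgMoment, h.init]

end IsLimitFlow

/-! ### Decay of the number of clusters -/

/-- `6 y - y ^ (1 + p)` at `y = k S ^ (-1/p)`. -/
noncomputable def concaveProfile (p S : ℝ) (k : ℕ) : ℝ :=
  6 * ((k : ℝ) * S ^ (-(1 / p))) - (k : ℝ) ^ (1 + p) * S ^ (-(1 / p) - 1)

/-- The concave profile capped smoothly at height one. -/
noncomputable def cappedProfile (p S : ℝ) (k : ℕ) : ℝ :=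
  if (k : ℝ) * S ^ (-(1 / p)) < 2 then 1 - (max (1 - concaveProfile p S k) 0) ^ 2 else 1

lemma concaveProfile_eq {p S : ℝ} (hp : 0 < p) (hS : 0 < S) (k : ℕ) :
    concaveProfile p S k =
      ((k : ℝ) * S ^ (-(1 / p))) * (6 - ((k : ℝ) * S ^ (-(1 / p))) ^ p) := by
  have h1 : ((k : ℝ) * S ^ (-(1 / p))) ^ p = (k : ℝ) ^ p * S⁻¹ := by
    rw [Real.mul_rpow (by positivity) (by positivity), ← Real.rpow_mul hS.le,
      show -(1 / p) * p = -1 by field_simp, Real.rpow_neg_one]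
  rw [h1, concaveProfile, Real.rpow_one_add' (by positivity) (by linarith),
    Real.rpow_sub_one hS.ne']
  field_simp

/-- The constant 6 is chosen for this: y^p ≤ 4 on the window [1/2, 2), so y (6 - y^p) ≥ 2y ≥ 1. The
cap is therefore already active on the whole window, and the switch at 2 in `cappedProfile` creates
no jump. -/
lemma one_le_concaveProfile {p S : ℝ} (hp : 0 < p) (hp2 : p ≤ 2) (hS : 0 < S) {k : ℕ}
    (h1 : 1 / 2 ≤ (k : ℝ) * S ^ (-(1 / p))) (h2 : (k : ℝ) * S ^ (-(1 / p)) < 2) :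
    1 ≤ concaveProfile p S k := by
  rw [concaveProfile_eq hp hS]
  set y := (k : ℝ) * S ^ (-(1 / p))
  have : y ^ p ≤ 4 := by
    calc y ^ p ≤ 2 ^ p := Real.rpow_le_rpow (by linarith) h2.le hp.le
      _ ≤ 2 ^ (2 : ℝ) := Real.rpow_le_rpow_of_exponent_le one_le_two hp2
      _ = 4 := by norm_num
  nlinarith

lemma cappedProfile_eq_one {p S : ℝ} (hp : 0 < p) (hp2 : p ≤ 2) (hS : 0 < S) {k : ℕ}
    (h1 : 1 / 2 ≤ (k : ℝ) * S ^ (-(1 / p))) : cappedProfile p S k = 1 := by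
  unfold cappedProfile
  split_ifs with h
  · rw [max_eq_right (by linarith [one_le_concaveProfile hp hp2 hS h1 h])]; simp
  · rfl

lemma cappedProfile_le_one (p S : ℝ) (k : ℕ) : cappedProfile p S k ≤ 1 := by
  unfold cappedProfile
  split_ifs
  · linarith [sq_nonneg (max (1 - concaveProfile p S k) 0)]
  · rfl

lemma cappedProfile_nonneg {p S : ℝ} (hp : 0 < p) (hp2 : p ≤ 2) (hS : 0 < S) (k : ℕ) :
    0 ≤ cappedProfile p S k := by
  rcases le_or_gt (1 / 2) ((k : ℝ) * S ^ (-(1 / p))) with h | h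
  · rw [cappedProfile_eq_one hp hp2 hS h]; exact zero_le_one
  · rw [cappedProfile, if_pos (by linarith)]
    have h0 : 0 ≤ (k : ℝ) * S ^ (-(1 / p)) := by positivity
    have h1 : 0 ≤ concaveProfile p S k := by
      rw [concaveProfile_eq hp hS]
      have : ((k : ℝ) * S ^ (-(1 / p))) ^ p ≤ 1 := Real.rpow_le_one h0 (by linarith) hp.le
      exact mul_nonneg h0 (by linarith)
    have h2 : max (1 - concaveProfile p S k) 0 ≤ 1 := max_le (by linarith) zero_le_one
    have h3 : 0 ≤ max (1 - concaveProfile p S k) 0 := le_max_right _ _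
    nlinarith

lemma cappedProfile_le {p S : ℝ} (hS : 0 < S) (k : ℕ) :
    cappedProfile p S k ≤ 12 * ((k : ℝ) * S ^ (-(1 / p))) := by
  unfold cappedProfile
  split_ifs with h
  · have h1 : concaveProfile p S k ≤ 6 * ((k : ℝ) * S ^ (-(1 / p))) := by
      unfold concaveProfile
      have : 0 ≤ (k : ℝ) ^ (1 + p) * S ^ (-(1 / p) - 1) := by positivity
      linarith
    rcases le_total (1 - concaveProfile p S k) 0 with h2 | h2
    · rw [max_eq_right h2]; linarith
    · rw [max_eq_left h2]; nlinarith [sq_nonneg (concaveProfile p S k)]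
  · linarith

/-- The cap b ↦ 1 - ((1-b)⁺)² is concave, so it lies below its tangents. Its slope is nonnegative,
so it carries supersolutions to supersolutions. -/
lemma cap_le_tangent (a b : ℝ) :
    1 - (max (1 - b) 0) ^ 2 ≤ 1 - (max (1 - a) 0) ^ 2 + 2 * max (1 - a) 0 * (b - a) := by
  rcases le_total (1 - a) 0 with h1 | h1 <;> rcases le_total (1 - b) 0 with h2 | h2
  · rw [max_eq_right h1, max_eq_right h2]; simp
  · rw [max_eq_right h1, max_eq_left h2]; nlinarith [sq_nonneg (1 - b)]
  · rw [max_eq_left h1, max_eq_right h2]; nlinarith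
  · rw [max_eq_left h1, max_eq_left h2]; nlinarith [sq_nonneg (a - b)]

/-- Time derivative of the concave profile along `S = 1 + ε s`. -/
noncomputable def concaveProfileDeriv (p ε s : ℝ) (k : ℕ) : ℝ :=
  ε * (-(6 / p) * ((k : ℝ) * (1 + ε * s) ^ (-(1 / p) - 1)) +
    (1 / p + 1) * ((k : ℝ) ^ (1 + p) * (1 + ε * s) ^ (-(1 / p) - 1 - 1)))

lemma hasDerivAt_concaveProfile {p ε s : ℝ} (hS : 0 < 1 + ε * s) (k : ℕ) :
    HasDerivAt (fun s => concaveProfile p (1 + ε * s) k) (concaveProfileDeriv p ε s k) s := by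
  have h1 : HasDerivAt (fun s => 1 + ε * s) ε s := by
    simpa using ((hasDerivAt_id s).const_mul ε).const_add 1
  have h2 := h1.rpow_const (p := -(1 / p)) (Or.inl hS.ne')
  have h3 := h1.rpow_const (p := -(1 / p) - 1) (Or.inl hS.ne')
  refine (((h2.const_mul (k : ℝ)).const_mul 6).fun_sub
    (h3.const_mul ((k : ℝ) ^ (1 + p)))).congr_deriv ?_
  unfold concaveProfileDeriv; ring

/-- Time derivative of the capped profile along `S = 1 + ε s`. -/
noncomputable def cappedProfileDeriv (p ε s : ℝ) (k : ℕ) : ℝ :=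
  if (k : ℝ) * (1 + ε * s) ^ (-(1 / p)) < 1 then
    2 * max (1 - concaveProfile p (1 + ε * s) k) 0 * concaveProfileDeriv p ε s k else 0

lemma hasDerivAt_cappedProfile {p ε s : ℝ} (hp : 0 < p) (hp2 : p ≤ 2) (hS : 0 < 1 + ε * s)
    (k : ℕ) :
    HasDerivAt (fun s => cappedProfile p (1 + ε * s) k) (cappedProfileDeriv p ε s k) s := by
  have hSc : ContinuousAt (fun s => 1 + ε * s) s := by fun_prop
  have hc : ContinuousAt (fun s => (k : ℝ) * (1 + ε * s) ^ (-(1 / p))) s :=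
    continuousAt_const.mul (hSc.rpow_const (Or.inl hS.ne'))
  unfold cappedProfileDeriv
  split_ifs with h
  · have h1 : HasDerivAt (fun s => 1 - (max (1 - concaveProfile p (1 + ε * s) k) 0) ^ 2)
        (2 * max (1 - concaveProfile p (1 + ε * s) k) 0 * concaveProfileDeriv p ε s k) s := by
      have h2 := (hasDerivAt_posPart_sq (1 - concaveProfile p (1 + ε * s) k)).comp s
        ((hasDerivAt_concaveProfile (p := p) hS k).const_sub 1)
      exact (h2.const_sub 1).congr_deriv (by ring)
    refine h1.congr_of_eventuallyEq ?_
    filter_upwards [hc.eventually_lt_const (show _ < (2 : ℝ) by linarith)] with z hz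
    rw [cappedProfile, if_pos hz]
  · refine (hasDerivAt_const s (1 : ℝ)).congr_of_eventuallyEq ?_
    filter_upwards [hc.eventually_const_lt (show (1 / 2 : ℝ) < _ by linarith),
      hSc.eventually_const_lt hS] with z hz hz'
    exact cappedProfile_eq_one hp hp2 hz' hz.le

/-- Below the cap, the concave term -k^(1+p) S^(-1/p-1) yields at least c k S^(-1/p-1) of decay
under k^λ Δ, which pays for the decrease in time of 6 k S^(-1/p). On the cap the profile is at its
maximum 1 and constant in time. -/
lemma exists_cappedProfile_supersolution {lam : ℝ} (hlam0 : 0 ≤ lam) (hlam2 : lam < 2) :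
    ∃ ε : ℝ, 0 < ε ∧ ∀ s, 0 ≤ s → ∀ i,
      clusterRate lam (i + 1) * secondDiff (cappedProfile (2 - lam) (1 + ε * s)) i ≤
        cappedProfileDeriv (2 - lam) ε s (i + 1) := by
  have hp : 0 < 2 - lam := by linarith
  obtain ⟨c, hc, hconv⟩ := exists_le_secondDiff_rpow (2 - lam) hp
  -- This value makes the two competing terms cancel exactly: 6ε/p = c.
  refine ⟨c * (2 - lam) / 6, by positivity, fun s hs i => ?_⟩
  set p := 2 - lam with hpdef
  set ε := c * p / 6 with hε
  have hε0 : 0 < ε := by positivity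
  set S := 1 + ε * s with hSdef
  have hS1 : 1 ≤ S := by nlinarith [mul_nonneg hε0.le hs]
  have hS : 0 < S := by linarith
  have hr := clusterRate_nonneg lam (i + 1)
  unfold cappedProfileDeriv
  split_ifs with h
  -- Since S ≥ 1, the rescaled lattice spacing is at most 1. If site `i + 1` is below height 1 in
  -- the rescaled variable, its right neighbour is below 2, and all three sites use the formula for
  -- the smooth cap.
  · have hq : S ^ (-(1 / p)) ≤ 1 :=
      Real.rpow_le_one_of_one_le_of_nonpos hS1 (by rw [neg_nonpos]; positivity)
    have hq0 : 0 < S ^ (-(1 / p)) := by positivity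
    have e0 : cappedProfile p S i = 1 - (max (1 - concaveProfile p S i) 0) ^ 2 := by
      rw [cappedProfile, if_pos]
      push_cast at h; nlinarith
    have e1 : cappedProfile p S (i + 1) = 1 - (max (1 - concaveProfile p S (i + 1)) 0) ^ 2 := by
      rw [cappedProfile, if_pos (by linarith)]
    have e2 : cappedProfile p S (i + 2) = 1 - (max (1 - concaveProfile p S (i + 2)) 0) ^ 2 := by
      rw [cappedProfile, if_pos]
      push_cast at h ⊢; nlinarith
    set θ := max (1 - concaveProfile p S (i + 1)) 0 with hθ
    have hθ0 : 0 ≤ θ := le_max_right _ _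
    have h1 : secondDiff (cappedProfile p S) i ≤ 2 * θ * secondDiff (concaveProfile p S) i := by
      have t0 := cap_le_tangent (concaveProfile p S (i + 1)) (concaveProfile p S i)
      have t2 := cap_le_tangent (concaveProfile p S (i + 1)) (concaveProfile p S (i + 2))
      simp only [secondDiff, e0, e1, e2]
      rw [← hθ] at t0 t2
      linarith
    have h2 : clusterRate lam (i + 1) * secondDiff (concaveProfile p S) i ≤
        concaveProfileDeriv p ε s (i + 1) := by
      set k : ℝ := ((i + 1 : ℕ) : ℝ) with hk
      have hk0 : 0 < k := by positivity
      have e : secondDiff (concaveProfile p S) i =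
          -(S ^ (-(1 / p) - 1) * secondDiff (fun k => (k : ℝ) ^ (1 + p)) i) := by
        simp only [secondDiff, concaveProfile]; push_cast; ring
      have hW : 0 < S ^ (-(1 / p) - 1) := by positivity
      have hmul : k ^ lam * k ^ (p - 1) = k := by
        rw [← Real.rpow_add hk0, hpdef, show lam + (2 - lam - 1) = 1 by ring, Real.rpow_one]
      have h3 : c * k * S ^ (-(1 / p) - 1) ≤
          clusterRate lam (i + 1) *
            (S ^ (-(1 / p) - 1) * secondDiff (fun k => (k : ℝ) ^ (1 + p)) i) := by
        have := mul_le_mul_of_nonneg_left (mul_le_mul_of_nonneg_left (hconv i) hW.le) hr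
        refine le_trans (le_of_eq ?_) this
        rw [clusterRate_succ, ← hk]
        calc c * k * S ^ (-(1 / p) - 1) = c * (k ^ lam * k ^ (p - 1)) * S ^ (-(1 / p) - 1) := by
              rw [hmul]
          _ = _ := by ring
      have h4 : -(c * k * S ^ (-(1 / p) - 1)) ≤ concaveProfileDeriv p ε s (i + 1) := by
        unfold concaveProfileDeriv
        rw [← hSdef, ← hk]
        have h5 : 0 ≤ ε * ((1 / p + 1) * (k ^ (1 + p) * S ^ (-(1 / p) - 1 - 1))) := by positivity
        have h6 : ε * (-(6 / p) * (k * S ^ (-(1 / p) - 1))) = -(c * k * S ^ (-(1 / p) - 1)) := by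
          rw [hε]; field_simp
        rw [mul_add, h6]; linarith
      rw [e]; linarith
    calc clusterRate lam (i + 1) * secondDiff (cappedProfile p S) i
        ≤ clusterRate lam (i + 1) * (2 * θ * secondDiff (concaveProfile p S) i) := by gcongr
      _ = 2 * θ * (clusterRate lam (i + 1) * secondDiff (concaveProfile p S) i) := by ring
      _ ≤ _ := by gcongr
  · have e1 : cappedProfile p S (i + 1) = 1 :=
      cappedProfile_eq_one hp (by linarith) hS (by linarith)
    refine mul_nonpos_of_nonneg_of_nonpos hr ?_
    simp only [secondDiff, e1]
    linarith [cappedProfile_le_one p S i, cappedProfile_le_one p S (i + 2)]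

/-- Decay of the number of clusters. -/
lemma exists_edgMoment_zero_le {lam : ℝ} (hlam0 : 0 ≤ lam) (hlam2 : lam < 2) :
    ∃ ε : ℝ, 0 < ε ∧ ∀ x U, IsLimitFlow lam x U → ∀ t, 0 ≤ t →
      edgMoment 0 (U t) ≤ 12 * (1 + ε * t) ^ (-(1 / (2 - lam))) * edgMoment 1 x := by
  obtain ⟨ε, hε, hsup⟩ := exists_cappedProfile_supersolution hlam0 hlam2
  refine ⟨ε, hε, fun x U h t ht => ?_⟩
  set p := 2 - lam with hpdef
  have hp : 0 < p := by linarith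
  have hp2 : p ≤ 2 := by linarith
  have hx0 : ∀ i, 0 ≤ x (i + 1) := fun i => h.mem.1 _
  have hs1 := summable_moment_mono (le_max_left 1 lam) hx0 h.mem.2
  have hS : ∀ s, 0 ≤ s → 0 < 1 + ε * s := fun s hs => by positivity
  have hle : ∀ l : ℕ, cappedProfile p (1 + ε * t) (l + 1) * x (l + 1) ≤
      12 * (1 + ε * t) ^ (-(1 / p)) * (((l + 1 : ℕ) : ℝ) ^ (1 : ℝ) * x (l + 1)) := by
    intro l
    refine (mul_le_mul_of_nonneg_right (cappedProfile_le (hS t ht) (l + 1)) (hx0 l)).trans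
      (le_of_eq ?_)
    rw [Real.rpow_one]; ring
  have hsB := hs1.mul_left (12 * (1 + ε * t) ^ (-(1 / p)))
  have hsH : Summable fun l => cappedProfile p (1 + ε * t) (l + 1) * x (l + 1) :=
    hsB.of_nonneg_of_le (fun l => mul_nonneg (cappedProfile_nonneg hp hp2 (hS t ht) _) (hx0 l)) hle
  have hmain := h.tsum_le_of_supersolution (H := fun s k => cappedProfile p (1 + ε * s) k)
    (H' := fun s i => cappedProfileDeriv p ε s (i + 1)) ht
    (fun s => by
      have : (0 : ℝ) ^ (1 + p) = 0 := Real.zero_rpow (by linarith)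
      simp [cappedProfile, concaveProfile, this])
    (fun s hs i => cappedProfile_nonneg hp hp2 (hS s hs.1) _)
    (fun i s hs =>
      (hasDerivAt_cappedProfile hp hp2 (hS s hs.1) (i + 1)).continuousAt.continuousWithinAt)
    (fun i s hs => hasDerivAt_cappedProfile hp hp2 (hS s hs.1.le) (i + 1))
    (fun i s hs => hsup s hs.1.le i) hsH
  -- At `S = 1` the rescaled variable is `k ≥ 1`, so the capped weight is identically 1 on living
  -- clusters and counts them.
  have h0 : ∀ l : ℕ, cappedProfile p (1 + ε * 0) (l + 1) = ((l + 1 : ℕ) : ℝ) ^ (0 : ℝ) := by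
    intro l
    rw [Real.rpow_zero]
    refine cappedProfile_eq_one hp hp2 (by simp) ?_
    simp only [mul_zero, add_zero, Real.one_rpow, mul_one]
    linarith [one_le_cast_succ l]
  simp only [h0] at hmain
  refine hmain.2.trans ((hsH.tsum_le_tsum hle hsB).trans (le_of_eq ?_))
  rw [tsum_mul_left]; rfl

/-! ### Lower bounds for moments of order below one -/

lemma crossover_sub_secondDiff (p r S g : ℝ) (i : ℕ) :
    secondDiff (fun k => crossover p r S k - k * g) i = secondDiff (crossover p r S) i := by
  simp only [secondDiff]; push_cast; ring

/-- Lower bound for the moments of order less than one. -/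
lemma exists_le_edgMoment_of_lt_one {lam κ : ℝ} (hlam2 : lam < 2) (hκ0 : 0 ≤ κ) (hκ1 : κ < 1) :
    ∃ K : ℝ, 0 < K ∧ ∀ x U, IsLimitFlow lam x U → ∀ t, 0 ≤ t →
      edgMoment 0 x * (1 + K * t) ^ ((κ - 1) / (2 - lam)) ≤ edgMoment κ (U t) := by
  set r : ℝ := (κ - 1) / (2 - lam) with hr
  have hr0 : r < 0 := div_neg_of_neg_of_pos (by linarith) (by linarith)
  obtain ⟨C, hC, hcr⟩ := exists_abs_rate_mul_secondDiff_crossover_le hlam2 r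
  have hK0 : 0 < C / (-r) := div_pos hC (by linarith)
  refine ⟨C / (-r), hK0, fun x U h τ hτ => ?_⟩
  set K := C / (-r) with hK
  have hKr : K * r = -C := by rw [hK, div_neg, neg_mul, div_mul_cancel₀ _ hr0.ne]
  set p := 2 - lam with hp
  have hp0 : 0 < p := by linarith
  have hpr : p * r = κ - 1 := by rw [hr]; field_simp
  have hx0 : ∀ i, 0 ≤ x (i + 1) := fun i => h.mem.1 _
  set ρ := edgMoment 1 x with hρ
  have hflow := h.isRateFlow hlam2 (τ + 1)
  have key : ∀ n : ℕ, (1 + K * τ) ^ r * ∑ i ∈ Finset.range (n + 1), x (i + 1) ≤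
      ((n + 1 : ℕ) : ℝ) ^ (κ - 1) * ρ + edgMoment κ (U τ) := by
    intro n
    set N : ℝ := ((n + 1 : ℕ) : ℝ) with hN
    have hN0 : 0 < N := by positivity
    set g : ℝ → ℝ := fun s => (N ^ p + K * s) ^ r with hg
    -- For a lower bound the boundary term at `n + 2` has the wrong sign. Subtracting the linear
    -- function `k * g s`, which has no second difference, makes the weight vanish at `n + 1` and
    -- nonpositive at `n + 2`.
    set ψ : ℝ → ℕ → ℝ := fun s k => crossover p r (K * s) k - k * g s with hψ
    have hψN : ∀ s, ψ s (n + 1) = 0 := fun s => by simp only [hψ, crossover, hg, hN]; ring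
    have hgd : ∀ s, 0 ≤ s → HasDerivAt g (K * r * (N ^ p + K * s) ^ (r - 1)) s := by
      intro s hs
      have h1 : HasDerivAt (fun s => N ^ p + K * s) K s := by
        simpa using ((hasDerivAt_id s).const_mul K).const_add (N ^ p)
      have hpos : N ^ p + K * s ≠ 0 := by positivity
      exact (h1.rpow_const (p := r) (Or.inl hpos)).congr_deriv (by ring)
    set ψ' : ℝ → ℕ → ℝ := fun s i =>
      -C * (((i + 1 : ℕ) : ℝ) * (((i + 1 : ℕ) : ℝ) ^ p + K * s) ^ (r - 1)) -
        ((i + 1 : ℕ) : ℝ) * (-C * (N ^ p + K * s) ^ (r - 1)) with hψ'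
    have hψd : ∀ i s, 0 ≤ s → HasDerivAt (fun s => ψ s (i + 1)) (ψ' s i) s := by
      intro i s hs
      refine ((hasDerivAt_crossover p r K i (by positivity)).fun_sub
        ((hgd s hs).const_mul ((i + 1 : ℕ) : ℝ))).congr_deriv ?_
      simp only [hψ', hKr]
    -- The term `g * ρ` compensates for the subtracted linear part. It grows along the flow at rate
    -- C W ρ, which covers the loss C W Σ k U_k because this partial mass is at most `ρ`.
    set G : ℝ → ℝ := fun σ => g (τ - σ) * ρ +
      ∑ i ∈ Finset.range (n + 1), ψ (τ - σ) (i + 1) * U σ (i + 1) with hG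
    have hmono : MonotoneOn G (Icc 0 τ) := by
      refine monotoneOn_of_hasDerivWithinAt_nonneg (f' := fun σ =>
        -(K * r * (N ^ p + K * (τ - σ)) ^ (r - 1)) * ρ +
        ∑ i ∈ Finset.range (n + 1), (-ψ' (τ - σ) i * U σ (i + 1) + ψ (τ - σ) (i + 1) *
          secondDiff (fun k => clusterRate lam k * U σ k) i)) (convex_Icc 0 τ) ?_ ?_ ?_
      · have hmap : ∀ σ ∈ Icc 0 τ, τ - σ ∈ Ici (0 : ℝ) := fun σ hσ => by
          simpa using hσ.2
        have hcg : ContinuousOn g (Ici 0) := fun s hs => (hgd s hs).continuousAt.continuousWithinAt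
        refine ((hcg.comp (by fun_prop) hmap).mul continuousOn_const).add ?_
        refine continuousOn_finsetSum _ fun i _ => ContinuousOn.mul ?_
          ((h.continuousOn i).mono Icc_subset_Ici_self)
        have hcψ : ContinuousOn (fun s => ψ s (i + 1)) (Ici 0) := fun s hs =>
          (hψd i s hs).continuousAt.continuousWithinAt
        exact hcψ.comp (by fun_prop) hmap
      · intro σ hσ
        rw [interior_Icc] at hσ ⊢
        have hs : 0 ≤ τ - σ := by linarith [hσ.2]
        refine HasDerivAt.hasDerivWithinAt (((hgd _ hs).comp_const_sub τ σ).mul_const ρ |>.fun_add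
          (HasDerivAt.fun_sum fun i _ => ((hψd i _ hs).comp_const_sub τ σ).fun_mul ?_))
        simpa using hflow.hasDerivAt continuousOn_const i (t := σ) ⟨hσ.1, by linarith [hσ.2]⟩
      · intro σ hσ
        rw [interior_Icc] at hσ
        set s := τ - σ with hs
        have hs0 : 0 ≤ s := by linarith [hσ.2]
        have hU0 : ∀ i, 0 ≤ U σ (i + 1) := h.nonneg hσ.1.le
        rw [Finset.sum_add_distrib, sum_mul_secondDiff (ψ s)
          (fun k => clusterRate lam k * U σ k) (n + 1) (by simp [hψ, crossover]) (by simp), hψN s,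
          zero_mul]
        have hψn : ψ s (n + 1 + 1) ≤ 0 := by
          have e : ψ s (n + 1 + 1) = ((n + 1 + 1 : ℕ) : ℝ) *
              ((((n + 1 + 1 : ℕ) : ℝ) ^ p + K * s) ^ r - (N ^ p + K * s) ^ r) := by
            simp only [hψ, crossover, hg]; ring
          rw [e]
          refine mul_nonpos_of_nonneg_of_nonpos (by positivity) (sub_nonpos.2 ?_)
          refine Real.rpow_le_rpow_of_nonpos (by positivity) ?_ hr0.le
          gcongr
          rw [hN]; push_cast; linarith
        have h1 : 0 ≤ -(ψ s (n + 1 + 1) * (clusterRate lam (n + 1) * U σ (n + 1))) :=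
          neg_nonneg.2 (mul_nonpos_of_nonpos_of_nonneg hψn
            (mul_nonneg (clusterRate_nonneg _ _) (hU0 n)))
        have h2 : ∑ i ∈ Finset.range (n + 1), ((i + 1 : ℕ) : ℝ) * U σ (i + 1) ≤ ρ := by
          have := (h.moment_one_le hσ.1.le).1.sum_le_tsum (Finset.range (n + 1))
            fun i _ => mul_nonneg (by positivity) (hU0 i)
          refine le_trans ?_ (h.moment_one_le hσ.1.le).2
          simpa only [edgMoment, Real.rpow_one] using this
        set W := (N ^ p + K * s) ^ (r - 1) with hW
        have hW0 : 0 ≤ W := by positivity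
        have h3 : -(C * W) * ∑ i ∈ Finset.range (n + 1), ((i + 1 : ℕ) : ℝ) * U σ (i + 1) ≤
            ∑ i ∈ Finset.range (n + 1), -ψ' s i * U σ (i + 1) +
            ∑ i ∈ Finset.range (n + 1),
              clusterRate lam (i + 1) * U σ (i + 1) * secondDiff (ψ s) i := by
          rw [Finset.mul_sum, ← Finset.sum_add_distrib]
          refine Finset.sum_le_sum fun i _ => ?_
          have e : secondDiff (ψ s) i = secondDiff (crossover p r (K * s)) i :=
            crossover_sub_secondDiff _ _ _ _ _
          have := (abs_le.1 (hcr (K * s) (by positivity) i)).1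
          rw [e]
          simp only [hψ']
          have h5 := mul_le_mul_of_nonneg_right this (hU0 i)
          linarith
        have h4 : C * W * ∑ i ∈ Finset.range (n + 1), ((i + 1 : ℕ) : ℝ) * U σ (i + 1) ≤
            C * W * ρ := mul_le_mul_of_nonneg_left h2 (by positivity)
        rw [hKr]
        linarith
    have hle := hmono ⟨le_rfl, hτ⟩ ⟨hτ, le_rfl⟩ hτ
    simp only [hG, sub_zero, sub_self] at hle
    have hxs : ∑ i ∈ Finset.range (n + 1), ((i + 1 : ℕ) : ℝ) * x (i + 1) ≤ ρ := by
      have := (summable_moment_mono (le_max_left 1 lam) hx0 h.mem.2).sum_le_tsum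
        (Finset.range (n + 1)) fun i _ => mul_nonneg (by positivity) (hx0 i)
      simpa only [hρ, edgMoment, Real.rpow_one] using this
    -- As `r < 0` and k^p + S ≤ k^p (1 + S), the crossover weight is at least k^κ (1 + S)^r, hence
    -- at least (1 + S)^r.
    have hlow : (1 + K * τ) ^ r * ∑ i ∈ Finset.range (n + 1), x (i + 1) ≤
        g τ * ρ + ∑ i ∈ Finset.range (n + 1), ψ τ (i + 1) * U 0 (i + 1) := by
      have hg0 : 0 ≤ g τ := by simp only [hg]; positivity
      have h1 := mul_le_mul_of_nonneg_left hxs hg0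
      refine le_trans ?_ (add_le_add_left h1 _)
      rw [Finset.mul_sum, Finset.mul_sum, ← Finset.sum_add_distrib]
      refine Finset.sum_le_sum fun i _ => ?_
      rw [h.init i]
      have e : g τ * (((i + 1 : ℕ) : ℝ) * x (i + 1)) + ψ τ (i + 1) * x (i + 1) =
          crossover p r (K * τ) (i + 1) * x (i + 1) := by simp only [hψ]; ring
      rw [e]
      refine mul_le_mul_of_nonneg_right ?_ (hx0 i)
      unfold crossover
      set k : ℝ := ((i + 1 : ℕ) : ℝ) with hk
      have hk1 : 1 ≤ k := one_le_cast_succ i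
      have hkp : 1 ≤ k ^ p := Real.one_le_rpow hk1 hp0.le
      have hKτ : 0 ≤ K * τ := by positivity
      calc (1 + K * τ) ^ r ≤ k ^ κ * (1 + K * τ) ^ r :=
            le_mul_of_one_le_left (by positivity) (Real.one_le_rpow hk1 hκ0)
        _ = k * (k ^ p * (1 + K * τ)) ^ r := by
            rw [Real.mul_rpow (by positivity) (by positivity), ← Real.rpow_mul (by positivity),
              hpr, Real.rpow_sub_one (by positivity)]
            field_simp
        _ ≤ k * (k ^ p + K * τ) ^ r := by
            refine mul_le_mul_of_nonneg_left ?_ (by positivity)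
            exact Real.rpow_le_rpow_of_nonpos (by positivity) (by nlinarith) hr0.le
    refine hlow.trans (hle.trans ?_)
    have hpow : ∀ y : ℝ, 0 < y → (y ^ p + K * 0) ^ r = y ^ (κ - 1) := fun y hy => by
      rw [mul_zero, add_zero, ← Real.rpow_mul hy.le, hpr]
    have hsκ := summable_moment_mono hκ1.le (h.nonneg hτ) (h.moment_one_le hτ).1
    have hup : ∑ i ∈ Finset.range (n + 1), ψ 0 (i + 1) * U τ (i + 1) ≤ edgMoment κ (U τ) := by
      refine le_trans (Finset.sum_le_sum fun i _ => ?_) (hsκ.sum_le_tsum (Finset.range (n + 1))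
        fun i _ => mul_nonneg (by positivity) (h.nonneg hτ i))
      refine mul_le_mul_of_nonneg_right ?_ (h.nonneg hτ i)
      simp only [hψ, crossover, hg]
      rw [hpow _ hN0, hpow _ (by positivity), Real.rpow_sub_one (x := ((i + 1 : ℕ) : ℝ))
        (by positivity), mul_div_cancel₀ _ (by positivity)]
      have : 0 ≤ ((i + 1 : ℕ) : ℝ) * N ^ (κ - 1) := by positivity
      linarith
    have hg00 : g 0 = N ^ (κ - 1) := by simp only [hg]; exact hpow N hN0
    rw [hg00]
    linarith
  have hs0 := summable_moment_mono (κ := 0) (zero_le_one.trans (le_max_left 1 lam)) hx0 h.mem.2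
  have l1 : Tendsto (fun n : ℕ => (1 + K * τ) ^ r * ∑ i ∈ Finset.range (n + 1), x (i + 1)) atTop
      (𝓝 ((1 + K * τ) ^ r * edgMoment 0 x)) := by
    refine Tendsto.const_mul _ ?_
    have := hs0.hasSum.tendsto_sum_nat.comp (tendsto_add_atTop_nat 1)
    simpa only [edgMoment, Real.rpow_zero, one_mul, Function.comp_def] using this
  -- Here κ < 1 is essential: the price N^(κ-1) ρ of the linear correction disappears as `n → ∞`.
  have l2 : Tendsto (fun n : ℕ => ((n + 1 : ℕ) : ℝ) ^ (κ - 1) * ρ + edgMoment κ (U τ)) atTop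
      (𝓝 (0 * ρ + edgMoment κ (U τ))) := by
    refine Tendsto.add_const _ (Tendsto.mul_const ρ ?_)
    have h1 := (tendsto_rpow_neg_atTop (show 0 < 1 - κ by linarith)).comp
      (tendsto_natCast_atTop_atTop.comp (tendsto_add_atTop_nat 1))
    rw [neg_sub] at h1
    exact h1
  have := le_of_tendsto_of_tendsto' l1 l2 key
  linarith

/-! ### Two-sided bounds by interpolation -/

lemma one_add_mul_rpow_bounds {K t e : ℝ} (hK : 0 < K) (ht : 0 ≤ t) (he : e ≤ 0) :
    (max 1 K) ^ e * (1 + t) ^ e ≤ (1 + K * t) ^ e ∧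
      (1 + K * t) ^ e ≤ (min 1 K) ^ e * (1 + t) ^ e := by
  have h1 : 0 < max 1 K := lt_max_of_lt_left one_pos
  have h2 : 0 < min 1 K := lt_min one_pos hK
  rw [← Real.mul_rpow h1.le (by positivity), ← Real.mul_rpow h2.le (by positivity)]
  constructor
  · refine Real.rpow_le_rpow_of_nonpos (by positivity) ?_ he
    nlinarith [le_max_left 1 K, mul_le_mul_of_nonneg_right (le_max_right 1 K) ht]
  · refine Real.rpow_le_rpow_of_nonpos (by positivity) ?_ he
    nlinarith [min_le_left 1 K, mul_le_mul_of_nonneg_right (min_le_right 1 K) ht]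

/-- Interpolation of a moment of order in `[0, 1]` between the moments of order `0` and `1`. -/
lemma edgMoment_le_of_le_one {lam R : ℝ} {c : ℕ → ℝ} (hlam0 : 0 ≤ lam) (hlam1 : lam ≤ 1)
    (hR : 0 < R) (h0 : ∀ i, 0 ≤ c (i + 1))
    (hs : Summable (fun l : ℕ => ((l + 1 : ℕ) : ℝ) ^ (1 : ℝ) * c (l + 1))) :
    edgMoment lam c ≤ R ^ lam * edgMoment 0 c + R ^ (lam - 1) * edgMoment 1 c := by
  have hs0 := summable_moment_mono zero_le_one h0 hs
  have hsl := summable_moment_mono hlam1 h0 hs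
  unfold edgMoment
  rw [← tsum_mul_left, ← tsum_mul_left,
    ← Summable.tsum_add (hs0.mul_left _) (hs.mul_left _)]
  refine hsl.tsum_le_tsum (fun l => ?_) ((hs0.mul_left _).add (hs.mul_left _))
  rw [← mul_assoc, ← mul_assoc, ← add_mul]
  refine mul_le_mul_of_nonneg_right ?_ (h0 l)
  set k : ℝ := ((l + 1 : ℕ) : ℝ) with hk
  have hk0 : 0 < k := by positivity
  rw [Real.rpow_zero, mul_one, Real.rpow_one]
  rcases le_total k R with h | h
  · have := Real.rpow_le_rpow hk0.le h hlam0
    have : 0 ≤ R ^ (lam - 1) * k := by positivity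
    linarith
  · have h1 := Real.rpow_le_rpow_of_nonpos hR h (show lam - 1 ≤ 0 by linarith)
    have h2 : k ^ lam = k ^ (lam - 1) * k := by rw [Real.rpow_sub_one hk0.ne']; field_simp
    have : 0 ≤ R ^ lam := by positivity
    rw [h2]; nlinarith

/-- Interpolation of the mass between the moments of order `0` and `lam > 1`. -/
lemma edgMoment_one_le_of_one_lt {lam R : ℝ} {c : ℕ → ℝ} (hlam1 : 1 < lam)
    (hR : 0 < R) (h0 : ∀ i, 0 ≤ c (i + 1))
    (hs : Summable (fun l : ℕ => ((l + 1 : ℕ) : ℝ) ^ lam * c (l + 1))) :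
    edgMoment 1 c ≤ R * edgMoment 0 c + R ^ (1 - lam) * edgMoment lam c := by
  have hs0 := summable_moment_mono (show 0 ≤ lam by linarith) h0 hs
  have hs1 := summable_moment_mono hlam1.le h0 hs
  unfold edgMoment
  rw [← tsum_mul_left, ← tsum_mul_left,
    ← Summable.tsum_add (hs0.mul_left _) (hs.mul_left _)]
  refine hs1.tsum_le_tsum (fun l => ?_) ((hs0.mul_left _).add (hs.mul_left _))
  rw [← mul_assoc, ← mul_assoc, ← add_mul]
  refine mul_le_mul_of_nonneg_right ?_ (h0 l)
  set k : ℝ := ((l + 1 : ℕ) : ℝ) with hk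
  have hk0 : 0 < k := by positivity
  rw [Real.rpow_zero, mul_one, Real.rpow_one]
  rcases le_total k R with h | h
  · have : 0 ≤ R ^ (1 - lam) * k ^ lam := by positivity
    linarith
  · have h1 := Real.rpow_le_rpow_of_nonpos hR h (show 1 - lam ≤ 0 by linarith)
    have h2 : k = k ^ (1 - lam) * k ^ lam := by rw [← Real.rpow_add hk0]; simp
    have h3 := mul_le_mul_of_nonneg_right h1 (show 0 ≤ k ^ lam by positivity)
    linarith

/-- For λ < 1 duality gives the lower bound and interpolation between the number of clusters and the
mass the upper one; for λ > 1 the roles are exchanged. For λ = 1 the moment is the conserved mass.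
-/
lemma exists_edgMoment_lam_bounds {lam ρ m₀ m : ℝ} (hlam0 : 0 ≤ lam) (hlam2 : lam < 2)
    (hρ : 0 < ρ) (hm₀ : 0 < m₀) (hm : 0 < m) :
    ∃ A₁ A₂ : ℝ, 0 < A₁ ∧ 0 < A₂ ∧ ∀ x U, IsLimitFlow lam x U → edgMoment 1 x = ρ →
      edgMoment 0 x = m₀ → edgMoment lam x = m → ∀ t, 0 ≤ t →
      A₁ * (1 + t) ^ ((lam - 1) / (2 - lam)) ≤ edgMoment lam (U t) ∧
      edgMoment lam (U t) ≤ A₂ * (1 + t) ^ ((lam - 1) / (2 - lam)) := by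
  have hp : 0 < 2 - lam := by linarith
  obtain ⟨ε, hε, hzero⟩ := exists_edgMoment_zero_le hlam0 hlam2
  have hα : -(1 / (2 - lam)) ≤ 0 := by rw [neg_nonpos]; positivity
  set B := 12 * (min 1 ε) ^ (-(1 / (2 - lam))) * ρ with hB
  have hB0 : 0 < B := by
    have : 0 < min 1 ε := lt_min one_pos hε
    positivity
  have hM0 : ∀ x U, IsLimitFlow lam x U → edgMoment 1 x = ρ → ∀ t, 0 ≤ t →
      edgMoment 0 (U t) ≤ B * (1 + t) ^ (-(1 / (2 - lam))) := by
    intro x U h h1 t ht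
    refine (hzero x U h t ht).trans ?_
    rw [h1]
    have := (one_add_mul_rpow_bounds hε ht hα).2
    calc 12 * (1 + ε * t) ^ (-(1 / (2 - lam))) * ρ
        ≤ 12 * ((min 1 ε) ^ (-(1 / (2 - lam))) * (1 + t) ^ (-(1 / (2 - lam)))) * ρ := by gcongr
      _ = _ := by rw [hB]; ring
  rcases lt_trichotomy lam 1 with hl | hl | hl
  · obtain ⟨K, hK, hlow⟩ := exists_le_edgMoment_of_lt_one hlam2 hlam0 hl
    have he : (lam - 1) / (2 - lam) ≤ 0 := div_nonpos_of_nonpos_of_nonneg (by linarith) hp.le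
    have hK1 : 0 < max 1 K := lt_max_of_lt_left one_pos
    refine ⟨m₀ * (max 1 K) ^ ((lam - 1) / (2 - lam)), B + ρ, by positivity, by positivity,
      fun x U h h1 h0 _ t ht => ⟨?_, ?_⟩⟩
    · refine le_trans ?_ (hlow x U h t ht)
      rw [h0, mul_assoc]
      exact mul_le_mul_of_nonneg_left (one_add_mul_rpow_bounds hK ht he).1 hm₀.le
    · have h1t : 0 < 1 + t := by linarith
      -- The splitting size is the self-similar cluster size, at which both interpolation terms have
      -- the same order.
      have := edgMoment_le_of_le_one hlam0 hl.le (R := (1 + t) ^ (1 / (2 - lam))) (by positivity)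
        (h.nonneg ht) (h.moment_one_le ht).1
      rw [h.edgMoment_one hlam2 ht, h1, ← Real.rpow_mul h1t.le, ← Real.rpow_mul h1t.le,
        show 1 / (2 - lam) * (lam - 1) = (lam - 1) / (2 - lam) by ring] at this
      have h2 := mul_le_mul_of_nonneg_left (hM0 x U h h1 t ht)
        (show 0 ≤ (1 + t) ^ (1 / (2 - lam) * lam) by positivity)
      have h3 : (1 + t) ^ (1 / (2 - lam) * lam) * (B * (1 + t) ^ (-(1 / (2 - lam)))) =
          B * (1 + t) ^ ((lam - 1) / (2 - lam)) := by
        rw [mul_left_comm, ← Real.rpow_add h1t]; congr 2; ring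
      rw [h3] at h2
      linarith
  · subst hl
    refine ⟨ρ, ρ, hρ, hρ, fun x U h h1 _ _ t ht => ?_⟩
    rw [h.edgMoment_one hlam2 ht, h1]; simp
  · obtain ⟨K, hK, hup⟩ := exists_edgMoment_lam_le hl hlam2
    set r := (lam - 1) / (2 - lam) with hr
    have hr0 : 0 < r := div_pos (by linarith) hp
    -- The splitting size is `D` times the self-similar one. This `D` lets clusters below it carry
    -- at most half of the mass, so the other half bounds M_λ from below.
    set D := ρ / (2 * B) with hD
    have hD0 : 0 < D := by positivity
    refine ⟨D ^ (lam - 1) * (ρ / 2), 2 ^ r * (m + K ^ r * ρ), by positivity, by positivity,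
      fun x U h h1 h0 hmx t ht => ?_⟩
    have h1t : 0 < 1 + t := by linarith
    obtain ⟨hs, hle⟩ := hup x U h t ht
    constructor
    · have hR : 0 < D * (1 + t) ^ (1 / (2 - lam)) := by positivity
      have hint := edgMoment_one_le_of_one_lt hl hR (h.nonneg ht) hs
      rw [h.edgMoment_one hlam2 ht, h1] at hint
      have h2 := mul_le_mul_of_nonneg_left (hM0 x U h h1 t ht) hR.le
      have h3 : D * (1 + t) ^ (1 / (2 - lam)) * (B * (1 + t) ^ (-(1 / (2 - lam)))) = ρ / 2 := by
        have : (1 + t) ^ (1 / (2 - lam)) * (1 + t) ^ (-(1 / (2 - lam))) = 1 := by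
          rw [← Real.rpow_add h1t]; simp
        calc _ = D * B * ((1 + t) ^ (1 / (2 - lam)) * (1 + t) ^ (-(1 / (2 - lam)))) := by ring
          _ = _ := by rw [this, hD]; field_simp
      rw [h3] at h2
      have h4 : ρ / 2 ≤ (D * (1 + t) ^ (1 / (2 - lam))) ^ (1 - lam) * edgMoment lam (U t) := by
        linarith
      have h5 := mul_le_mul_of_nonneg_left h4
        (show 0 ≤ (D * (1 + t) ^ (1 / (2 - lam))) ^ (lam - 1) by positivity)
      rw [← mul_assoc, ← Real.rpow_add hR, show lam - 1 + (1 - lam) = 0 by ring, Real.rpow_zero,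
        one_mul, Real.mul_rpow hD0.le (by positivity), ← Real.rpow_mul h1t.le,
        show 1 / (2 - lam) * (lam - 1) = r by rw [hr]; ring] at h5
      linarith
    · rw [h1, hmx] at hle
      refine hle.trans ?_
      have h2 : (K * t) ^ r ≤ K ^ r * (1 + t) ^ r := by
        rw [← Real.mul_rpow hK.le h1t.le]
        exact Real.rpow_le_rpow (by positivity) (by nlinarith) hr0.le
      have h3 : 1 ≤ (1 + t) ^ r := Real.one_le_rpow (by linarith) hr0.le
      calc 2 ^ r * (m + (K * t) ^ r * ρ)
          ≤ 2 ^ r * (m * (1 + t) ^ r + K ^ r * (1 + t) ^ r * ρ) := by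
            gcongr
            exact le_mul_of_one_le_right hm.le h3
        _ = _ := by ring

lemma exists_avgClusterSize_bounds {lam ρ m₀ : ℝ} (hlam0 : 0 ≤ lam) (hlam2 : lam < 2)
    (hρ : 0 < ρ) (hm₀ : 0 < m₀) :
    ∃ B₁ B₂ : ℝ, 0 < B₁ ∧ 0 < B₂ ∧ ∀ x U, IsLimitFlow lam x U → edgMoment 1 x = ρ →
      edgMoment 0 x = m₀ → ∀ t, 0 ≤ t →
      B₁ * (1 + t) ^ (1 / (2 - lam)) ≤ avgClusterSize (U t) ∧
      avgClusterSize (U t) ≤ B₂ * (1 + t) ^ (1 / (2 - lam)) := by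
  have hp : 0 < 2 - lam := by linarith
  obtain ⟨ε, hε, hzero⟩ := exists_edgMoment_zero_le hlam0 hlam2
  obtain ⟨K, hK, hlow⟩ := exists_le_edgMoment_of_lt_one hlam2 le_rfl one_pos
  have hα : -(1 / (2 - lam)) ≤ 0 := by rw [neg_nonpos]; positivity
  have hε1 : 0 < min 1 ε := lt_min one_pos hε
  have hK1 : 0 < max 1 K := lt_max_of_lt_left one_pos
  refine ⟨(12 * (min 1 ε) ^ (-(1 / (2 - lam))))⁻¹, ρ / (m₀ * (max 1 K) ^ (-(1 / (2 - lam)))),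
    by positivity, by positivity, fun x U h h1 h0 t ht => ?_⟩
  have h1t : 0 < 1 + t := by linarith
  have hup := hzero x U h t ht
  have hlo := hlow x U h t ht
  rw [h1] at hup
  rw [h0, show ((0 : ℝ) - 1) / (2 - lam) = -(1 / (2 - lam)) by ring] at hlo
  obtain ⟨-, e2⟩ := one_add_mul_rpow_bounds hε ht hα
  obtain ⟨e1, -⟩ := one_add_mul_rpow_bounds hK ht hα
  have hQ : (1 + t) ^ (-(1 / (2 - lam))) = ((1 + t) ^ (1 / (2 - lam)))⁻¹ :=
    Real.rpow_neg h1t.le _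
  rw [hQ] at e1 e2
  set Q := (1 + t) ^ (1 / (2 - lam)) with hQd
  have hQ0 : 0 < Q := by positivity
  set a := (min 1 ε) ^ (-(1 / (2 - lam)))
  set b := (max 1 K) ^ (-(1 / (2 - lam)))
  have ha : 0 < a := by positivity
  have hb : 0 < b := by positivity
  set M := edgMoment 0 (U t) with hM
  have hM1 : M ≤ 12 * (a * Q⁻¹) * ρ := hup.trans (by gcongr)
  have hM2 : m₀ * (b * Q⁻¹) ≤ M := le_trans (by gcongr) hlo
  have hM0 : 0 < M := lt_of_lt_of_le (by positivity) hM2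
  rw [avgClusterSize, h.edgMoment_one hlam2 ht, h1]
  constructor
  · rw [le_div_iff₀ hM0]
    calc (12 * a)⁻¹ * Q * M ≤ (12 * a)⁻¹ * Q * (12 * (a * Q⁻¹) * ρ) := by gcongr
      _ = ρ := by field_simp
  · rw [div_le_iff₀ hM0]
    calc ρ = ρ / (m₀ * b) * Q * (m₀ * (b * Q⁻¹)) := by field_simp
      _ ≤ _ := by gcongr

/-! ### Time change: uniqueness and existence of solutions -/

lemma edgMoment_congr {κ : ℝ} {c d : ℕ → ℝ} (h : ∀ i, c (i + 1) = d (i + 1)) :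
    edgMoment κ c = edgMoment κ d := by
  simp only [edgMoment, h]

lemma avgClusterSize_congr {c d : ℕ → ℝ} (h : ∀ i, c (i + 1) = d (i + 1)) :
    avgClusterSize c = avgClusterSize d := by
  rw [avgClusterSize, avgClusterSize, edgMoment_congr h, edgMoment_congr h]

lemma edgMoment_pos_of_pos {κ μ : ℝ} {c : ℕ → ℝ} (h0 : ∀ i, 0 ≤ c (i + 1))
    (hs : Summable (fun l : ℕ => ((l + 1 : ℕ) : ℝ) ^ κ * c (l + 1)))
    (hpos : 0 < edgMoment μ c) : 0 < edgMoment κ c := by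
  obtain ⟨i, hi⟩ : ∃ i, 0 < c (i + 1) := by
    by_contra hcon
    push Not at hcon
    have : edgMoment μ c = 0 := by
      unfold edgMoment
      simp only [fun i => le_antisymm (hcon i) (h0 i), mul_zero, tsum_zero]
    linarith
  exact hs.tsum_pos (fun l => mul_nonneg (by positivity) (h0 l)) i
    (mul_pos (by positivity) hi)

lemma IsEDGSolution.init {lam : ℝ} {x : ℕ → ℝ} {T : EReal} {c : ℝ → ℕ → ℝ}
    (h : IsEDGSolution lam x T c) (k : ℕ) : c 0 k = x k := by
  have := h.eqn k 0 le_rfl (by simpa using h.pos)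
  simpa using this

/-- Only measurability and boundedness of M_λ[c(t)] are available at this stage, the former as a
limit of continuous partial sums. Its continuity then follows from
`IsRateFlow.continuousOn_edgMoment`. -/
lemma IsEDGSolution.isRateFlow {lam b : ℝ} {x : ℕ → ℝ} {T : EReal} {c : ℝ → ℕ → ℝ}
    (h : IsEDGSolution lam x T c) (hb0 : 0 ≤ b) (hb : (b : EReal) < T) :
    IsRateFlow lam (fun t => edgMoment lam (c t)) b c := by
  have hlt : ∀ t ∈ Icc 0 b, (t : EReal) < T := fun t ht =>
    lt_of_le_of_lt (EReal.coe_le_coe_iff.2 ht.2) hb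
  have hmem : ∀ t ∈ Icc 0 b, MemEDGCone (max 1 lam) (c t) := fun t ht => h.mem t ht.1 (hlt t ht)
  have hcont : ∀ i, ContinuousOn (fun t => c t i) (Icc 0 b) := fun i =>
    (h.cont i).mono fun t ht => ⟨ht.1, hlt t ht⟩
  obtain ⟨B, hB⟩ := h.locBdd b hb
  have hbd : ∀ t ∈ Icc 0 b, |edgMoment lam (c t)| ≤ B := fun t ht => by
    rw [abs_of_nonneg (edgMoment_nonneg fun i => (hmem t ht).1 _)]
    exact (edgMoment_mono (le_max_right 1 lam) (fun i => (hmem t ht).1 _) (hmem t ht).2).trans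
      (hB t ht.1 ht.2)
  refine
    { nonneg := fun t ht i => (hmem t ht).1 _
      summable := fun t ht => (hmem t ht).2
      bdd := ⟨B, fun t ht => hB t ht.1 ht.2⟩
      cont := fun i => hcont (i + 1)
      rate_int := ?_
      rate_bdd := ⟨B, hbd⟩
      eqn := fun i t ht => ?_ }
  · have hmeas : AEStronglyMeasurable (fun t => edgMoment lam (c t))
        (volume.restrict (Icc 0 b)) := by
      refine aestronglyMeasurable_of_tendsto_ae atTop
        (f := fun K t => ∑ l ∈ Finset.range K, ((l + 1 : ℕ) : ℝ) ^ lam * c t (l + 1))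
        (fun K => ContinuousOn.aestronglyMeasurable (continuousOn_finsetSum _ fun l _ =>
          continuousOn_const.mul (hcont (l + 1))) measurableSet_Icc) ?_
      filter_upwards [ae_restrict_mem measurableSet_Icc] with t ht
      exact (summable_moment_mono (le_max_right 1 lam) (fun i => (hmem t ht).1 _)
        (hmem t ht).2).hasSum.tendsto_sum_nat
    rw [intervalIntegrable_iff_integrableOn_Icc_of_le hb0]
    refine Integrable.of_bound hmeas B ?_
    filter_upwards [ae_restrict_mem measurableSet_Icc] with t ht
    exact hbd t ht
  · rw [h.eqn (i + 1) t ht.1 (hlt t ht), h.init]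
    simp only [edgRhs_succ]

/-- The physical time that has elapsed when the linear flow has run for the time `σ`. -/
noncomputable def elapsedTime (lam : ℝ) (U : ℝ → ℕ → ℝ) (σ : ℝ) : ℝ :=
  ∫ s in (0 : ℝ)..σ, (edgMoment lam (U (max s 0)))⁻¹

namespace IsLimitFlow

variable {lam : ℝ} {x : ℕ → ℝ} {U : ℝ → ℕ → ℝ}

lemma continuous_edgMoment (h : IsLimitFlow lam x U) (hlam0 : 0 ≤ lam) (hlam2 : lam < 2) :
    Continuous fun s => edgMoment lam (U (max s 0)) := by
  have h1 : ContinuousOn (fun s => edgMoment lam (U s)) (Ici 0) := by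
    intro s hs
    have h2 := (h.isRateFlow hlam2 (s + 1)).continuousOn_edgMoment hlam0 hlam2 s
      ⟨hs, by linarith⟩
    refine h2.mono_of_mem_nhdsWithin ?_
    exact mem_nhdsWithin.2 ⟨Iio (s + 1), isOpen_Iio, by simp, fun y hy => ⟨hy.2, hy.1.le⟩⟩
  exact h1.comp_continuous (by fun_prop) fun s => mem_Ici.2 (le_max_right _ _)

lemma edgMoment_lam_pos (h : IsLimitFlow lam x U) (hlam2 : lam < 2) (hx : 0 < edgMoment 1 x)
    {s : ℝ} (hs : 0 ≤ s) : 0 < edgMoment lam (U s) := by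
  have hf := h.isRateFlow hlam2 s
  have hm : s ∈ Icc 0 s := ⟨hs, le_rfl⟩
  refine edgMoment_pos_of_pos (μ := 1) (h.nonneg hs) (summable_moment_mono (le_max_right 1 lam)
    (h.nonneg hs) (hf.summable s hm)) ?_
  rwa [h.edgMoment_one hlam2 hs]

/-- Freezing the integrand at negative times makes the elapsed time differentiable on the whole
line, with no one-sided derivative at 0. -/
lemma hasDerivAt_elapsedTime (h : IsLimitFlow lam x U) (hlam0 : 0 ≤ lam) (hlam2 : lam < 2)
    (hx : 0 < edgMoment 1 x) (σ : ℝ) :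
    HasDerivAt (elapsedTime lam U) (edgMoment lam (U (max σ 0)))⁻¹ σ :=
  (((h.continuous_edgMoment hlam0 hlam2).inv₀ fun s =>
    (h.edgMoment_lam_pos hlam2 hx (le_max_right s 0)).ne').integral_hasStrictDerivAt 0 σ).hasDerivAt

lemma strictMono_elapsedTime (h : IsLimitFlow lam x U) (hlam0 : 0 ≤ lam) (hlam2 : lam < 2)
    (hx : 0 < edgMoment 1 x) : StrictMono (elapsedTime lam U) :=
  strictMono_of_hasDerivAt_pos (h.hasDerivAt_elapsedTime hlam0 hlam2 hx) fun s =>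
    inv_pos.2 (h.edgMoment_lam_pos hlam2 hx (le_max_right s 0))

/-- Every solution is the linear flow run at the speed given by the moment of order `lam`. -/
lemma solution_eq (h : IsLimitFlow lam x U) (hlam0 : 0 ≤ lam) (hlam2 : lam < 2)
    (hx : 0 < edgMoment 1 x) {T : EReal} {c : ℝ → ℕ → ℝ} (hc : IsEDGSolution lam x T c)
    {t : ℝ} (ht0 : 0 ≤ t) (htT : (t : EReal) < T) :
    ∃ σ, 0 ≤ σ ∧ elapsedTime lam U σ = t ∧ ∀ i, c t (i + 1) = U σ (i + 1) := by
  have hflow := hc.isRateFlow ht0 htT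
  have hmem : ∀ s ∈ Icc 0 t, MemEDGCone (max 1 lam) (c s) := fun s hs =>
    hc.mem s hs.1 (lt_of_le_of_lt (EReal.coe_le_coe_iff.2 hs.2) htT)
  have hMc := hflow.continuousOn_edgMoment hlam0 hlam2
  have hM0 : ∀ s ∈ Icc 0 t, 0 ≤ edgMoment lam (c s) := fun s hs =>
    edgMoment_nonneg fun i => (hmem s hs).1 _
  set τ : ℝ → ℝ := fun s => ∫ r in (0 : ℝ)..s, edgMoment lam (c r) with hτ
  have hτ0 : τ 0 = 0 := by simp [hτ]
  have hτc : ContinuousOn τ (Icc 0 t) := by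
    have := intervalIntegral.continuousOn_primitive_interval (a := 0) (b := t) (μ := volume)
      (f := fun r => edgMoment lam (c r)) (by
        rw [uIcc_of_le ht0]; exact hMc.integrableOn_Icc)
    rwa [uIcc_of_le ht0] at this
  have hτd : ∀ s ∈ Ioo 0 t, HasDerivAt τ (edgMoment lam (c s)) s := fun s hs =>
    intervalIntegral.integral_hasDerivAt_right
      (ContinuousOn.intervalIntegrable (hMc.mono (by
        rw [uIcc_of_le hs.1.le]; exact Icc_subset_Icc_right hs.2.le)))
      ((hMc.mono Ioo_subset_Icc_self).stronglyMeasurableAtFilter isOpen_Ioo s hs)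
      (hMc.continuousAt (Icc_mem_nhds hs.1 hs.2))
  have hτnn : ∀ s ∈ Icc 0 t, 0 ≤ τ s := fun s hs =>
    intervalIntegral.integral_nonneg hs.1 fun r hr => hM0 r ⟨hr.1, hr.2.trans hs.2⟩
  obtain ⟨u, hu, hlim⟩ := h.approx
  -- Run in the clock `τ` of the given solution, each truncation obeys the same linear equation but
  -- vanishes at `N + 1`. The minimum principle puts it below `c`, and `N → ∞` preserves this.
  have hge : ∀ s ∈ Icc 0 t, ∀ i, U (τ s) (i + 1) ≤ c s (i + 1) := by
    intro s hs i
    refine le_of_tendsto (hlim (τ s) (hτnn s hs) i) ?_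
    filter_upwards [eventually_gt_atTop i] with N hN
    rw [← sub_nonneg]
    refine rate_comparison (lam := lam) (b := t) (m := fun s => edgMoment lam (c s)) (N := N)
      (w := fun s k => c s k - u N (τ s) k) (fun r hr => hM0 r (Ioo_subset_Icc_self hr))
      (fun i _ => (hflow.cont i).sub (((hu N).continuous i).comp_continuousOn hτc))
      (fun i hi r hr => ?_) (fun r hr => ?_) (fun i hi => ?_) hs hN
    · refine ((hflow.hasDerivAt hMc i hr).fun_sub
        (((hu N).deriv i hi (τ r)).comp r (hτd r hr))).congr_deriv ?_
      simp only [secondDiff]; ring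
    · simp only [(hu N).above (τ r) (N + 1) (by omega), sub_zero]
      exact (hmem r (Ioo_subset_Icc_self hr)).1 _
    · simp only [hτ0]; rw [(hu N).init i hi, hc.init, sub_self]
  -- Both sides have the same mass, so the ordering leaves no room for a difference at any size.
  have heq : ∀ s ∈ Icc 0 t, ∀ i, c s (i + 1) = U (τ s) (i + 1) := by
    intro s hs i
    have hs1 := summable_moment_mono (le_max_left 1 lam) (fun i => (hmem s hs).1 _) (hmem s hs).2
    have hs2 := (h.moment_one_le (hτnn s hs)).1
    have hm : edgMoment 1 (c s) = edgMoment 1 (U (τ s)) := by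
      rw [h.edgMoment_one hlam2 (hτnn s hs), hflow.edgMoment_one hs]
      exact edgMoment_congr fun i => hc.init _
    have hz : ∑' l : ℕ, (((l + 1 : ℕ) : ℝ) ^ (1 : ℝ) * c s (l + 1) -
        ((l + 1 : ℕ) : ℝ) ^ (1 : ℝ) * U (τ s) (l + 1)) = 0 := by
      rw [hs1.tsum_sub hs2]; exact sub_eq_zero.2 hm
    have hnn : ∀ l : ℕ, 0 ≤ ((l + 1 : ℕ) : ℝ) ^ (1 : ℝ) * c s (l + 1) -
        ((l + 1 : ℕ) : ℝ) ^ (1 : ℝ) * U (τ s) (l + 1) := fun l =>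
      sub_nonneg.2 (mul_le_mul_of_nonneg_left (hge s hs l) (by positivity))
    have h1 := (hasSum_zero_iff_of_nonneg hnn).1 (hz ▸ (hs1.sub hs2).hasSum)
    have h2 := congrFun h1 i
    simp only [Pi.zero_apply, ← mul_sub] at h2
    rcases mul_eq_zero.1 h2 with h3 | h3
    · exact absurd h3 (by positivity)
    · linarith
  refine ⟨τ t, hτnn t ⟨ht0, le_rfl⟩, ?_, heq t ⟨ht0, le_rfl⟩⟩
  have hΓd := h.hasDerivAt_elapsedTime hlam0 hlam2 hx
  -- By the identification with `U`, the clock satisfies τ' = M_λ[U(τ)], the reciprocal of the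
  -- derivative of the elapsed time at τ. The two are inverse to each other.
  have hconst : ∀ s ∈ Icc 0 t, elapsedTime lam U (τ s) - s = elapsedTime lam U (τ 0) - 0 := by
    have hcont : ContinuousOn (fun s => elapsedTime lam U (τ s) - s) (Icc 0 t) :=
      ((continuous_iff_continuousAt.2 fun s => (hΓd s).continuousAt).comp_continuousOn hτc).sub
        continuousOn_id
    have hder : ∀ s ∈ Ioo 0 t, HasDerivAt (fun s => elapsedTime lam U (τ s) - s) 0 s := by
      intro s hs
      have hs' := Ioo_subset_Icc_self hs
      refine (((hΓd (τ s)).comp s (hτd s hs)).fun_sub (hasDerivAt_id s)).congr_deriv ?_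
      rw [max_eq_left (hτnn s hs'), edgMoment_congr (heq s hs'),
        inv_mul_cancel₀ (h.edgMoment_lam_pos hlam2 hx (hτnn s hs')).ne', sub_self]
    intro s hs
    rcases hs.1.eq_or_lt with h0 | h0
    · rw [← h0]
    · obtain ⟨y, hy, he⟩ := exists_hasDerivAt_eq_slope (fun s => elapsedTime lam U (τ s) - s)
        (fun _ => 0) h0 (hcont.mono (Icc_subset_Icc_right hs.2))
        (fun r hr => hder r ⟨hr.1, hr.2.trans_le hs.2⟩)
      rw [eq_comm, div_eq_zero_iff] at he
      rcases he with he | he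
      · exact sub_eq_zero.1 he
      · linarith
  have := hconst t ⟨ht0, le_rfl⟩
  rw [hτ0] at this
  have h0 : elapsedTime lam U 0 = 0 := by simp [elapsedTime]
  linarith

/-- Uniqueness of solutions on their common interval of existence. -/
lemma solution_unique (h : IsLimitFlow lam x U) (hlam0 : 0 ≤ lam) (hlam2 : lam < 2)
    (hx : 0 < edgMoment 1 x) {T T' : EReal} {c c' : ℝ → ℕ → ℝ} (hc : IsEDGSolution lam x T c)
    (hc' : IsEDGSolution lam x T' c') {t : ℝ} (ht0 : 0 ≤ t) (htT : (t : EReal) < T)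
    (htT' : (t : EReal) < T') : c t = c' t := by
  have hsucc : ∀ s ∈ Icc 0 t, ∀ i, c s (i + 1) = c' s (i + 1) := by
    intro s hs i
    have hst : (s : EReal) ≤ t := EReal.coe_le_coe_iff.2 hs.2
    obtain ⟨σ, -, hσ, he⟩ := h.solution_eq hlam0 hlam2 hx hc hs.1 (hst.trans_lt htT)
    obtain ⟨σ', -, hσ', he'⟩ := h.solution_eq hlam0 hlam2 hx hc' hs.1 (hst.trans_lt htT')
    rw [he, he', (h.strictMono_elapsedTime hlam0 hlam2 hx).injective (hσ.trans hσ'.symm)]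
  funext k
  cases k with
  | zero =>
    rw [hc.eqn 0 t ht0 htT, hc'.eqn 0 t ht0 htT']
    congr 1
    refine intervalIntegral.integral_congr fun s hs => ?_
    rw [uIcc_of_le ht0] at hs
    simp only [edgRhs]
    rw [edgMoment_congr (hsucc s hs), hsucc s hs 0]
  | succ i => exact hsucc t ⟨ht0, le_rfl⟩ i

/-- The time-changed linear flow is a solution as long as its elapsed time permits. -/
lemma exists_solution (h : IsLimitFlow lam x U) (hlam0 : 0 ≤ lam) (hlam2 : lam < 2)
    (hx : 0 < edgMoment 1 x) {T : EReal}
    (hT : ∀ t : ℝ, (t : EReal) < T ↔ ∃ σ, t < elapsedTime lam U σ) :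
    ∃ c, IsEDGSolution lam x T c := by
  set Γ := elapsedTime lam U with hΓ
  have hΓd : ∀ σ, HasDerivAt Γ (edgMoment lam (U (max σ 0)))⁻¹ σ :=
    h.hasDerivAt_elapsedTime hlam0 hlam2 hx
  have hΓm : StrictMono Γ := h.strictMono_elapsedTime hlam0 hlam2 hx
  have hΓc : Continuous Γ := continuous_iff_continuousAt.2 fun s => (hΓd s).continuousAt
  have hΓ0 : Γ 0 = 0 := by simp [hΓ, elapsedTime]
  set S : Set ℝ := {t : ℝ | (t : EReal) < T} with hS
  have hSopen : IsOpen S := isOpen_Iio.preimage continuous_coe_real_ereal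
  have hsurj : ∀ t ∈ S, ∃ σ, Γ σ = t := by
    intro t ht
    obtain ⟨σ₁, hσ₁⟩ := (hT t).1 ht
    -- Negative times are included so that `τ` inverts `Γ` on an open set containing 0. There `Γ` is
    -- linear, so an explicit preimage exists.
    have hlow : ∃ σ₀, Γ σ₀ ≤ t := by
      rcases le_total 0 t with h0 | h0
      · exact ⟨0, by rwa [hΓ0]⟩
      · set f := edgMoment lam (U 0) with hf
        have hf0 : 0 < f := h.edgMoment_lam_pos hlam2 hx le_rfl
        refine ⟨t * f, le_of_eq ?_⟩
        have hneg : t * f ≤ 0 := mul_nonpos_of_nonpos_of_nonneg h0 hf0.le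
        have e : Γ (t * f) = ∫ s in (0 : ℝ)..(t * f), f⁻¹ := by
          refine intervalIntegral.integral_congr fun s hs => ?_
          rw [uIcc_of_ge hneg] at hs
          simp only [max_eq_right hs.2, hf]
        rw [e, intervalIntegral.integral_const, sub_zero, smul_eq_mul]
        field_simp
    obtain ⟨σ₀, hσ₀⟩ := hlow
    exact mem_range_of_exists_le_of_exists_ge hΓc ⟨σ₀, hσ₀⟩ ⟨σ₁, hσ₁.le⟩
  choose! τ hτ using hsurj
  have hτm : StrictMonoOn τ S := fun s hs t ht hst => by
    rw [← hΓm.lt_iff_lt, hτ s hs, hτ t ht]; exact hst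
  have hΓS : ∀ σ, Γ σ ∈ S := fun σ => (hT _).2 ⟨σ + 1, hΓm (by linarith)⟩
  have hτΓ : ∀ σ, τ (Γ σ) = σ := fun σ => hΓm.injective (hτ _ (hΓS σ))
  have hτcont : ∀ t ∈ S, ContinuousAt τ t := fun t ht =>
    hτm.continuousAt_of_image_mem_nhds (hSopen.mem_nhds ht) (by
      have : τ '' S = univ := eq_univ_of_forall fun σ => ⟨Γ σ, hΓS σ, hτΓ σ⟩
      rw [this]; exact univ_mem)
  have h0S : (0 : ℝ) ∈ S := hΓ0 ▸ hΓS 0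
  have hτ0 : τ 0 = 0 := by have := hτΓ 0; rwa [hΓ0] at this
  have hτnn : ∀ t ∈ S, 0 ≤ t → 0 ≤ τ t := fun t ht h0 => by
    rw [← hτ0]; exact hτm.monotoneOn h0S ht h0
  have hτpos : ∀ t ∈ S, 0 < t → 0 < τ t := fun t ht h0 => by
    calc 0 = τ 0 := hτ0.symm
      _ < τ t := hτm h0S ht h0
  have hτd : ∀ t ∈ S, 0 ≤ t → HasDerivAt τ (edgMoment lam (U (τ t))) t := by
    intro t ht h0
    have hne : (edgMoment lam (U (max (τ t) 0)))⁻¹ ≠ 0 :=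
      inv_ne_zero (h.edgMoment_lam_pos hlam2 hx (le_max_right _ _)).ne'
    have := HasDerivAt.of_local_left_inverse (hτcont t ht) (hΓd (τ t)) hne
      (by filter_upwards [hSopen.mem_nhds ht] with s hs using hτ s hs)
    rwa [inv_inv, max_eq_left (hτnn t ht h0)] at this
  have hdown : ∀ b ∈ S, ∀ s, s ≤ b → s ∈ S := fun b hb s hs =>
    lt_of_le_of_lt (EReal.coe_le_coe_iff.2 hs) hb
  have hτcOn : ∀ b ∈ S, ContinuousOn τ (Icc 0 b) := fun b hb s hs =>
    (hτcont s (hdown b hb s hs.2)).continuousWithinAt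
  have hUc : ∀ b ∈ S, ∀ i, ContinuousOn (fun s => U (τ s) (i + 1)) (Icc 0 b) := fun b hb i =>
    (h.continuousOn i).comp (hτcOn b hb) fun s hs => hτnn s (hdown b hb s hs.2) hs.1
  have hFc : ∀ b ∈ S, ContinuousOn (fun s => edgMoment lam (U (τ s))) (Icc 0 b) := fun b hb => by
    refine ((h.continuous_edgMoment hlam0 hlam2).comp_continuousOn (hτcOn b hb)).congr
      fun s hs => ?_
    simp only [Function.comp, max_eq_left (hτnn s (hdown b hb s hs.2) hs.1)]
  -- The empty clusters do not act back on the others, so their number is obtained by integrating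
  -- afterwards.
  set c : ℝ → ℕ → ℝ := fun t k => if k = 0 then
    x 0 + ∫ s in (0 : ℝ)..t, edgMoment lam (U (τ s)) * U (τ s) 1 else U (τ t) k with hcdef
  have hcs : ∀ t i, c t (i + 1) = U (τ t) (i + 1) := fun t i => by simp [hcdef]
  have hc0 : ∀ t, c t 0 = x 0 + ∫ s in (0 : ℝ)..t, edgMoment lam (U (τ s)) * U (τ s) 1 :=
    fun t => by simp [hcdef]
  have hmom : ∀ κ t, edgMoment κ (c t) = edgMoment κ (U (τ t)) := fun κ t =>
    edgMoment_congr (hcs t)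
  have hgc : ∀ b ∈ S, ContinuousOn (fun s => edgMoment lam (U (τ s)) * U (τ s) 1) (Icc 0 b) :=
    fun b hb => (hFc b hb).mul (hUc b hb 0)
  have hwithin : ∀ t, 0 ≤ t → t ∈ S → ∃ b ∈ S, t ∈ Icc 0 b ∧
      Icc 0 b ∈ 𝓝[{t : ℝ | 0 ≤ t ∧ (t : EReal) < T}] t := by
    intro t h0 ht
    refine ⟨Γ (τ t + 1), hΓS _, ?_, ?_⟩
    · refine ⟨h0, ?_⟩
      rw [← hτ t ht, hτΓ]; exact (hΓm (by linarith)).le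
    · refine mem_nhdsWithin.2 ⟨Iio (Γ (τ t + 1)), isOpen_Iio, ?_, fun y hy => ⟨hy.2.1, hy.1.le⟩⟩
      rw [mem_Iio]
      conv_lhs => rw [← hτ t ht]
      exact hΓm (by linarith)
  refine ⟨c, ?_, fun t h0 ht => ⟨fun k => ?_, ?_⟩, fun b hb => ?_, fun k => ?_,
    fun k t h0 ht => ?_⟩
  · exact_mod_cast h0S
  · cases k with
    | zero =>
      rw [hc0]
      refine add_nonneg (h.mem.1 0) (intervalIntegral.integral_nonneg h0 fun s hs => ?_)
      have hs0 := hτnn s (hdown t ht s hs.2) hs.1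
      exact mul_nonneg (edgMoment_nonneg (h.nonneg hs0)) (h.nonneg hs0 0)
    | succ i => rw [hcs]; exact h.nonneg (hτnn t ht h0) i
  · simp only [hcs]
    exact (h.isRateFlow hlam2 (τ t)).summable _ ⟨hτnn t ht h0, le_rfl⟩
  · obtain ⟨B, hB⟩ := (h.isRateFlow hlam2 (τ b)).bdd
    refine ⟨B, fun t h0 htb => ?_⟩
    rw [hmom]
    exact hB _ ⟨hτnn t (hdown b hb t htb) h0, hτm.monotoneOn (hdown b hb t htb) hb htb⟩
  · rintro t ⟨h0, ht⟩
    obtain ⟨b, hb, htb, hnb⟩ := hwithin t h0 ht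
    refine ContinuousWithinAt.mono_of_mem_nhdsWithin (t := Icc 0 b) ?_ hnb
    cases k with
    | zero =>
      simp only [hc0]
      have hb0 : 0 ≤ b := htb.1.trans htb.2
      have := intervalIntegral.continuousOn_primitive_interval (a := 0) (b := b) (μ := volume)
        (f := fun s => edgMoment lam (U (τ s)) * U (τ s) 1) (by
          rw [uIcc_of_le hb0]; exact (hgc b hb).integrableOn_Icc)
      rw [uIcc_of_le hb0] at this
      exact (continuousOn_const.add this) t htb
    | succ i =>
      simp only [hcs]
      exact hUc b hb i t htb
  · cases k with
    | zero =>
      rw [hc0]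
      congr 1
    | succ i =>
      have hvc : ∀ k, ContinuousOn (fun s => clusterRate lam k * U (τ s) k) (Icc 0 t) := by
        intro k
        cases k with
        | zero => simpa using continuousOn_const
        | succ j => exact continuousOn_const.mul (hUc t ht j)
      have hrc : ContinuousOn (fun s => edgMoment lam (U (τ s)) *
          secondDiff (fun k => clusterRate lam k * U (τ s) k) i) (Icc 0 t) :=
        (hFc t ht).mul (((hvc (i + 2)).sub (continuousOn_const.mul (hvc (i + 1)))).add (hvc i))
      have hint := intervalIntegral.integral_eq_sub_of_hasDerivAt_of_le h0 (hUc t ht i)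
        (f' := fun s => edgMoment lam (U (τ s)) *
          secondDiff (fun k => clusterRate lam k * U (τ s) k) i) (fun s hs => by
          have hsS := hdown t ht s hs.2.le
          have hp := hτpos s hsS hs.1
          have h1 := (h.isRateFlow hlam2 (τ s + 1)).hasDerivAt continuousOn_const i
            (t := τ s) ⟨hp, by linarith⟩
          refine (h1.comp s (hτd s hsS hs.1.le)).congr_deriv ?_
          ring)
        (ContinuousOn.intervalIntegrable (by rwa [uIcc_of_le h0]))
      rw [hcs]
      have e : ∫ s in (0 : ℝ)..t, edgRhs lam (c s) (i + 1) =
          ∫ s in (0 : ℝ)..t, edgMoment lam (U (τ s)) *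
            secondDiff (fun k => clusterRate lam k * U (τ s) k) i := by
        refine intervalIntegral.integral_congr fun s _ => ?_
        have e2 : (fun k => clusterRate lam k * c s k) = fun k => clusterRate lam k * U (τ s) k := by
          funext k
          cases k with
          | zero => simp
          | succ j => rw [hcs]
        simp only [edgRhs_succ, hmom, e2]
      rw [e, hint, hτ0, h.init i]; ring

/-- The maximal time of existence bounds the life span of every solution. -/
lemma solution_le (h : IsLimitFlow lam x U) (hlam0 : 0 ≤ lam) (hlam2 : lam < 2)
    (hx : 0 < edgMoment 1 x) {T T' : EReal}
    (hT : ∀ t : ℝ, (t : EReal) < T ↔ ∃ σ, t < elapsedTime lam U σ) {c : ℝ → ℕ → ℝ}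
    (hc : IsEDGSolution lam x T' c) : T' ≤ T := by
  have hm := h.strictMono_elapsedTime hlam0 hlam2 hx
  by_contra hlt
  rw [not_le] at hlt
  obtain ⟨r, hr1, hr2⟩ := EReal.lt_iff_exists_real_btwn.1 hlt
  have hT0 : ((0 : ℝ) : EReal) < T := (hT 0).2 ⟨1, by
    have h1 := hm (show (0 : ℝ) < 1 by norm_num)
    rwa [show elapsedTime lam U 0 = 0 by simp [elapsedTime]] at h1⟩
  have hr0 : 0 ≤ r := EReal.coe_le_coe_iff.1 (hT0.trans hr1).le
  obtain ⟨σ, -, hσ, -⟩ := h.solution_eq hlam0 hlam2 hx hc hr0 hr2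
  have : (r : EReal) < T := (hT r).2 ⟨σ + 1, by rw [← hσ]; exact hm (by linarith)⟩
  exact lt_asymm this hr1

end IsLimitFlow

/-! ### The three coarsening regimes -/

lemma exists_limitFlow_bounds {lam ρ : ℝ} (m₀ m : ℝ) (hlam0 : 0 ≤ lam) (hlam2 : lam < 2)
    (hρ : 0 < ρ) :
    ∃ A₁ A₂ B₁ B₂ : ℝ, 0 < A₁ ∧ 0 < A₂ ∧ 0 < B₁ ∧ 0 < B₂ ∧
      ∀ x, MemEDGCone (max 1 lam) x → edgMoment 1 x = ρ → edgMoment 0 x = m₀ →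
        edgMoment lam x = m → ∃ U, IsLimitFlow lam x U ∧ ∀ σ, 0 ≤ σ →
          (A₁ * (1 + σ) ^ ((lam - 1) / (2 - lam)) ≤ edgMoment lam (U σ) ∧
            edgMoment lam (U σ) ≤ A₂ * (1 + σ) ^ ((lam - 1) / (2 - lam))) ∧
          (B₁ * (1 + σ) ^ (1 / (2 - lam)) ≤ avgClusterSize (U σ) ∧
            avgClusterSize (U σ) ≤ B₂ * (1 + σ) ^ (1 / (2 - lam))) := by
  by_cases hm : 0 < m₀ ∧ 0 < m
  · obtain ⟨A₁, A₂, hA₁, hA₂, hA⟩ := exists_edgMoment_lam_bounds hlam0 hlam2 hρ hm.1 hm.2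
    obtain ⟨B₁, B₂, hB₁, hB₂, hB⟩ := exists_avgClusterSize_bounds hlam0 hlam2 hρ hm.1
    refine ⟨A₁, A₂, B₁, B₂, hA₁, hA₂, hB₁, hB₂, fun x hx h1 h0 hl => ?_⟩
    obtain ⟨U, hU⟩ := exists_isLimitFlow hx
    exact ⟨U, hU, fun σ hσ => ⟨hA x U hU h1 h0 hl σ hσ, hB x U hU h1 h0 σ hσ⟩⟩
  -- Positive mass forces the other two moments to be positive, so no data have the prescribed
  -- values and any constants serve.
  · refine ⟨1, 1, 1, 1, one_pos, one_pos, one_pos, one_pos, fun x hx h1 h0 hl => absurd ?_ hm⟩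
    have hx0 : ∀ i, 0 ≤ x (i + 1) := fun i => hx.1 _
    rw [← h0, ← hl]
    exact ⟨edgMoment_pos_of_pos hx0 (summable_moment_mono (zero_le_one.trans (le_max_left 1 lam))
      hx0 hx.2) (h1 ▸ hρ), edgMoment_pos_of_pos hx0 (summable_moment_mono (le_max_right 1 lam)
      hx0 hx.2) (h1 ▸ hρ)⟩

namespace IsLimitFlow

variable {lam : ℝ} {x : ℕ → ℝ} {U : ℝ → ℕ → ℝ}

/-- Two-sided comparison of the elapsed time with a primitive `P` of `(1 + σ) ^ (-e)`. -/
lemma elapsedTime_bounds (h : IsLimitFlow lam x U) (hlam0 : 0 ≤ lam) (hlam2 : lam < 2)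
    (hx : 0 < edgMoment 1 x) {A₁ A₂ e : ℝ} (hF : ∀ σ, 0 ≤ σ →
      A₁ * (1 + σ) ^ e ≤ edgMoment lam (U σ) ∧ edgMoment lam (U σ) ≤ A₂ * (1 + σ) ^ e)
    {P : ℝ → ℝ} (hP : ∀ σ, 0 ≤ σ → HasDerivAt P ((1 + σ) ^ (-e)) σ) {σ σ' : ℝ} (hσ : 0 ≤ σ)
    (hσσ' : σ ≤ σ') :
    A₁ * (elapsedTime lam U σ' - elapsedTime lam U σ) ≤ P σ' - P σ ∧
      P σ' - P σ ≤ A₂ * (elapsedTime lam U σ' - elapsedTime lam U σ) := by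
  have hd := h.hasDerivAt_elapsedTime hlam0 hlam2 hx
  have hkey : ∀ s, 0 ≤ s → A₁ * (edgMoment lam (U (max s 0)))⁻¹ ≤ (1 + s) ^ (-e) ∧
      (1 + s) ^ (-e) ≤ A₂ * (edgMoment lam (U (max s 0)))⁻¹ := by
    intro s hs
    rw [max_eq_left hs, Real.rpow_neg (by positivity)]
    have hM := h.edgMoment_lam_pos hlam2 hx hs
    have hq : 0 < (1 + s) ^ e := by positivity
    obtain ⟨h1, h2⟩ := hF s hs
    constructor
    · rw [← div_eq_mul_inv, div_le_iff₀ hM, inv_mul_eq_div, le_div_iff₀ hq]; exact h1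
    · rw [← div_eq_mul_inv, le_div_iff₀ hM, inv_mul_eq_div, div_le_iff₀ hq]; exact h2
  have m1 : MonotoneOn (fun s => P s - A₁ * elapsedTime lam U s) (Ici 0) := by
    refine monotoneOn_of_hasDerivWithinAt_nonneg (f' := fun s => (1 + s) ^ (-e) -
      A₁ * (edgMoment lam (U (max s 0)))⁻¹) (convex_Ici 0) ?_ ?_ ?_
    · exact fun s hs => ((hP s hs).sub ((hd s).const_mul A₁)).continuousAt.continuousWithinAt
    · intro s hs
      rw [interior_Ici] at hs
      exact ((hP s (le_of_lt hs)).fun_sub ((hd s).const_mul A₁)).hasDerivWithinAt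
    · intro s hs
      rw [interior_Ici] at hs
      linarith [(hkey s (le_of_lt hs)).1]
  have m2 : MonotoneOn (fun s => A₂ * elapsedTime lam U s - P s) (Ici 0) := by
    refine monotoneOn_of_hasDerivWithinAt_nonneg (f' := fun s =>
      A₂ * (edgMoment lam (U (max s 0)))⁻¹ - (1 + s) ^ (-e)) (convex_Ici 0) ?_ ?_ ?_
    · exact fun s hs => (((hd s).const_mul A₂).sub (hP s hs)).continuousAt.continuousWithinAt
    · intro s hs
      rw [interior_Ici] at hs
      exact (((hd s).const_mul A₂).fun_sub (hP s (le_of_lt hs))).hasDerivWithinAt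
    · intro s hs
      rw [interior_Ici] at hs
      linarith [(hkey s (le_of_lt hs)).2]
  have e1 := m1 (mem_Ici.2 hσ) (mem_Ici.2 (hσ.trans hσσ')) hσσ'
  have e2 := m2 (mem_Ici.2 hσ) (mem_Ici.2 (hσ.trans hσσ')) hσσ'
  simp only at e1 e2
  constructor <;> linarith

/-- If the elapsed time is unbounded, solutions are global. -/
lemma global_solution (h : IsLimitFlow lam x U) (hlam0 : 0 ≤ lam) (hlam2 : lam < 2)
    (hx : 0 < edgMoment 1 x) (hunb : ∀ t : ℝ, ∃ σ, t < elapsedTime lam U σ) :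
    (∃ c, IsEDGSolution lam x ⊤ c) ∧
      ∀ (T : EReal) (c : ℝ → ℕ → ℝ), IsEDGSolution lam x T c →
        ∃ c' : ℝ → ℕ → ℝ, IsEDGSolution lam x ⊤ c' ∧
          ∀ t : ℝ, 0 ≤ t → (t : EReal) < T → c' t = c t := by
  obtain ⟨c', hc'⟩ := h.exists_solution hlam0 hlam2 hx (T := ⊤)
    fun t => ⟨fun _ => hunb t, fun _ => EReal.coe_lt_top t⟩
  exact ⟨⟨c', hc'⟩, fun T c hc => ⟨c', hc', fun t h0 ht =>
    h.solution_unique hlam0 hlam2 hx hc' hc h0 (EReal.coe_lt_top t) ht⟩⟩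

end IsLimitFlow

lemma hasDerivAt_one_add_rpow_div {δ σ : ℝ} (hδ : δ ≠ 0) (hσ : 0 ≤ σ) :
    HasDerivAt (fun s : ℝ => (1 + s) ^ δ / δ) ((1 + σ) ^ (δ - 1)) σ := by
  have h1 : HasDerivAt (fun s : ℝ => 1 + s) 1 σ := (hasDerivAt_id σ).const_add 1
  refine ((h1.rpow_const (p := δ) (Or.inl (by positivity))).div_const δ).congr_deriv ?_
  field_simp

/-- Here δ > 0: integrating the bounds on M_λ makes (1+σ)^δ - 1 comparable to the elapsed time,
which is therefore unbounded, and raising to the power β gives the rate. -/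
theorem algebraic_coarsening {lam ρ : ℝ} (m₀ m : ℝ) (hlam0 : 0 ≤ lam) (hlam : lam < 3 / 2)
    (hρ : 0 < ρ) :
    ∃ C₁ C₂ t₀ : ℝ, 0 < C₁ ∧ 0 < C₂ ∧ 0 < t₀ ∧
      ∀ c₀ : ℕ → ℝ, MemEDGCone (max 1 lam) c₀ → edgMoment 1 c₀ = ρ →
        edgMoment 0 c₀ = m₀ → edgMoment lam c₀ = m →
        (∃ c, IsEDGSolution lam c₀ ⊤ c) ∧
        (∀ (T : EReal) (c : ℝ → ℕ → ℝ), IsEDGSolution lam c₀ T c →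
          ∃ c' : ℝ → ℕ → ℝ, IsEDGSolution lam c₀ ⊤ c' ∧
            ∀ t : ℝ, 0 ≤ t → (t : EReal) < T → c' t = c t) ∧
        (∀ c : ℝ → ℕ → ℝ, IsEDGSolution lam c₀ ⊤ c → ∀ t : ℝ, t₀ ≤ t →
          C₁ * t ^ (3 - 2 * lam)⁻¹ ≤ avgClusterSize (c t) ∧
          avgClusterSize (c t) ≤ C₂ * t ^ (3 - 2 * lam)⁻¹) := by
  have hlam2 : lam < 2 := by linarith
  have hp : 0 < 2 - lam := by linarith
  have hq : 0 < 3 - 2 * lam := by linarith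
  obtain ⟨A₁, A₂, B₁, B₂, hA₁, hA₂, hB₁, hB₂, hdata⟩ :=
    exists_limitFlow_bounds m₀ m hlam0 hlam2 hρ
  set δ := (3 - 2 * lam) / (2 - lam) with hδ
  have hδ0 : 0 < δ := div_pos hq hp
  have hδe : δ - 1 = -((lam - 1) / (2 - lam)) := by rw [hδ]; field_simp; ring
  set β := (3 - 2 * lam)⁻¹ with hβ
  have hβ0 : 0 < β := inv_pos.2 hq
  have hδβ : δ * β = 1 / (2 - lam) := by rw [hδ, hβ]; field_simp
  -- The choice `t₀ = 1` absorbs the additive constant: 1 + δ A₂ t ≤ (1 + δ A₂) t for t ≥ 1.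
  refine ⟨B₁ * (δ * A₁) ^ β, B₂ * (1 + δ * A₂) ^ β, 1, by positivity, by positivity, one_pos,
    fun c₀ hc₀ h1 h0 hl => ?_⟩
  obtain ⟨U, hU, hb⟩ := hdata c₀ hc₀ h1 h0 hl
  have hx : 0 < edgMoment 1 c₀ := h1 ▸ hρ
  have hΓ : ∀ σ, 0 ≤ σ → δ * A₁ * elapsedTime lam U σ ≤ (1 + σ) ^ δ - 1 ∧
      (1 + σ) ^ δ - 1 ≤ δ * A₂ * elapsedTime lam U σ := by
    intro σ hσ
    have := hU.elapsedTime_bounds hlam0 hlam2 hx (fun σ hσ => (hb σ hσ).1)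
      (P := fun s => (1 + s) ^ δ / δ)
      (fun s hs => by rw [← hδe]; exact hasDerivAt_one_add_rpow_div hδ0.ne' hs) le_rfl hσ
    rw [show elapsedTime lam U 0 = 0 by simp [elapsedTime], sub_zero, ← sub_div, add_zero,
      Real.one_rpow, le_div_iff₀ hδ0, div_le_iff₀ hδ0] at this
    constructor <;> linarith [this.1, this.2]
  have hunb : ∀ t : ℝ, ∃ σ, t < elapsedTime lam U σ := by
    intro t
    have hy : 1 ≤ 1 + δ * A₂ * (|t| + 1) := by
      have : 0 ≤ δ * A₂ * (|t| + 1) := by positivity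
      linarith
    have hσ : 0 ≤ (1 + δ * A₂ * (|t| + 1)) ^ (1 / δ) - 1 :=
      sub_nonneg.2 (Real.one_le_rpow hy (by positivity))
    -- This solves (1+σ)^δ - 1 = δ A₂ (|t| + 1), which forces the elapsed time to be at least |t| +
    -- 1.
    refine ⟨(1 + δ * A₂ * (|t| + 1)) ^ (1 / δ) - 1, ?_⟩
    have := (hΓ _ hσ).2
    rw [add_sub_cancel, ← Real.rpow_mul (by positivity), one_div_mul_cancel hδ0.ne',
      Real.rpow_one, add_sub_cancel_left] at this
    have h3 := le_of_mul_le_mul_left this (by positivity)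
    linarith [le_abs_self t]
  obtain ⟨g1, g2⟩ := hU.global_solution hlam0 hlam2 hx hunb
  refine ⟨g1, g2, fun c hc t ht => ?_⟩
  obtain ⟨σ, hσ, hσt, he⟩ := hU.solution_eq hlam0 hlam2 hx hc (by linarith) (EReal.coe_lt_top t)
  rw [avgClusterSize_congr he]
  obtain ⟨-, hℓ1, hℓ2⟩ := hb σ hσ
  obtain ⟨k1, k2⟩ := hΓ σ hσ
  rw [hσt] at k1 k2
  have ht0 : 0 < t := by linarith
  have hσα : (1 + σ) ^ (1 / (2 - lam)) = ((1 + σ) ^ δ) ^ β := by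
    rw [← Real.rpow_mul (by positivity), hδβ]
  rw [hσα] at hℓ1 hℓ2
  constructor
  · refine le_trans ?_ hℓ1
    rw [mul_assoc, ← Real.mul_rpow (by positivity) ht0.le]
    exact mul_le_mul_of_nonneg_left
      (Real.rpow_le_rpow (by positivity) (by linarith) hβ0.le) hB₁.le
  · refine hℓ2.trans ?_
    rw [mul_assoc, ← Real.mul_rpow (by positivity) ht0.le]
    exact mul_le_mul_of_nonneg_left
      (Real.rpow_le_rpow (by positivity) (by linarith) hβ0.le) hB₂.le

theorem exponential_coarsening {lam ρ : ℝ} (m₀ m : ℝ) (hlam : lam = 3 / 2) (hρ : 0 < ρ) :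
    ∃ C₁ C₂ K₁ K₂ t₀ : ℝ, 0 < C₁ ∧ 0 < C₂ ∧ 0 < K₁ ∧ 0 < K₂ ∧ 0 < t₀ ∧
      ∀ c₀ : ℕ → ℝ, MemEDGCone (max 1 lam) c₀ → edgMoment 1 c₀ = ρ →
        edgMoment 0 c₀ = m₀ → edgMoment lam c₀ = m →
        (∃ c, IsEDGSolution lam c₀ ⊤ c) ∧
        (∀ (T : EReal) (c : ℝ → ℕ → ℝ), IsEDGSolution lam c₀ T c →
          ∃ c' : ℝ → ℕ → ℝ, IsEDGSolution lam c₀ ⊤ c' ∧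
            ∀ t : ℝ, 0 ≤ t → (t : EReal) < T → c' t = c t) ∧
        (∀ c : ℝ → ℕ → ℝ, IsEDGSolution lam c₀ ⊤ c → ∀ t : ℝ, t₀ ≤ t →
          K₁ * Real.exp (C₁ * t) ≤ avgClusterSize (c t) ∧
          avgClusterSize (c t) ≤ K₂ * Real.exp (C₂ * t)) := by
  have hlam0 : 0 ≤ lam := by linarith
  have hlam2 : lam < 2 := by linarith
  obtain ⟨A₁, A₂, B₁, B₂, hA₁, hA₂, hB₁, hB₂, hdata⟩ :=
    exists_limitFlow_bounds m₀ m hlam0 hlam2 hρ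
  have he1 : (lam - 1) / (2 - lam) = 1 := by rw [hlam]; norm_num
  have hα : 1 / (2 - lam) = 2 := by rw [hlam]; norm_num
  rw [he1, hα] at hdata
  -- At the critical exponent log(1+σ) is comparable to the elapsed time, and ℓ ~ (1+σ)² = exp(2
  -- log(1+σ)) explains the factor 2. The value of `t₀` is immaterial.
  refine ⟨A₁ * 2, A₂ * 2, B₁, B₂, 1, by positivity, by positivity, hB₁, hB₂, one_pos,
    fun c₀ hc₀ h1 h0 hl => ?_⟩
  obtain ⟨U, hU, hb⟩ := hdata c₀ hc₀ h1 h0 hl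
  have hx : 0 < edgMoment 1 c₀ := h1 ▸ hρ
  have hΓ : ∀ σ, 0 ≤ σ → A₁ * elapsedTime lam U σ ≤ Real.log (1 + σ) ∧
      Real.log (1 + σ) ≤ A₂ * elapsedTime lam U σ := by
    intro σ hσ
    have := hU.elapsedTime_bounds hlam0 hlam2 hx (fun σ hσ => (hb σ hσ).1)
      (P := fun s => Real.log (1 + s))
      (fun s hs => by
        rw [Real.rpow_neg_one, ← one_div]
        exact ((hasDerivAt_id s).const_add 1).log (by simp only [id]; positivity)) le_rfl hσ
    rw [show elapsedTime lam U 0 = 0 by simp [elapsedTime], sub_zero, add_zero, Real.log_one,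
      sub_zero] at this
    exact this
  have hunb : ∀ t : ℝ, ∃ σ, t < elapsedTime lam U σ := by
    intro t
    have hσ : 0 ≤ Real.exp (A₂ * (|t| + 1)) - 1 :=
      sub_nonneg.2 (Real.one_le_exp (by positivity))
    refine ⟨Real.exp (A₂ * (|t| + 1)) - 1, ?_⟩
    have := (hΓ _ hσ).2
    rw [add_sub_cancel, Real.log_exp] at this
    have h3 := le_of_mul_le_mul_left this hA₂
    linarith [le_abs_self t]
  obtain ⟨g1, g2⟩ := hU.global_solution hlam0 hlam2 hx hunb
  refine ⟨g1, g2, fun c hc t ht => ?_⟩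
  obtain ⟨σ, hσ, hσt, he⟩ := hU.solution_eq hlam0 hlam2 hx hc (by linarith) (EReal.coe_lt_top t)
  rw [avgClusterSize_congr he]
  obtain ⟨-, hℓ1, hℓ2⟩ := hb σ hσ
  obtain ⟨k1, k2⟩ := hΓ σ hσ
  rw [hσt] at k1 k2
  rw [Real.rpow_def_of_pos (by positivity)] at hℓ1 hℓ2
  constructor
  · refine le_trans ?_ hℓ1
    exact mul_le_mul_of_nonneg_left (Real.exp_le_exp.2 (by linarith)) hB₁.le
  · refine hℓ2.trans ?_
    exact mul_le_mul_of_nonneg_left (Real.exp_le_exp.2 (by linarith)) hB₂.le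

/-- Here δ < 0, so the elapsed time stays bounded: the linear flow completes its whole infinite
evolution before a finite physical time. The remaining time after σ is comparable to (1+σ)^δ. -/
theorem finite_time_blowup {lam ρ : ℝ} (m₀ m : ℝ) (hlam : 3 / 2 < lam) (hlam2 : lam < 2)
    (hρ : 0 < ρ) :
    ∃ C₁ C₂ t₀ : ℝ, 0 < C₁ ∧ 0 < C₂ ∧ 0 < t₀ ∧
      ∀ c₀ : ℕ → ℝ, MemEDGCone (max 1 lam) c₀ → edgMoment 1 c₀ = ρ →
        edgMoment 0 c₀ = m₀ → edgMoment lam c₀ = m →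
        ∃ tstar : ℝ, t₀ < tstar ∧
          (∃ c, IsEDGSolution lam c₀ tstar c) ∧
          (∀ (T : EReal) (c : ℝ → ℕ → ℝ), IsEDGSolution lam c₀ T c →
            T ≤ tstar ∧
            ∃ c' : ℝ → ℕ → ℝ, IsEDGSolution lam c₀ tstar c' ∧
              ∀ t : ℝ, 0 ≤ t → (t : EReal) < T → c' t = c t) ∧
          (∀ c : ℝ → ℕ → ℝ, IsEDGSolution lam c₀ tstar c → ∀ t : ℝ, t₀ ≤ t → t < tstar →
            C₁ * (tstar - t) ^ (3 - 2 * lam)⁻¹ ≤ avgClusterSize (c t) ∧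
            avgClusterSize (c t) ≤ C₂ * (tstar - t) ^ (3 - 2 * lam)⁻¹) := by
  have hlam0 : 0 ≤ lam := by linarith
  have hp : 0 < 2 - lam := by linarith
  have hq : 3 - 2 * lam < 0 := by linarith
  obtain ⟨A₁, A₂, B₁, B₂, hA₁, hA₂, hB₁, hB₂, hdata⟩ :=
    exists_limitFlow_bounds m₀ m hlam0 hlam2 hρ
  set δ := (3 - 2 * lam) / (2 - lam) with hδ
  have hδ0 : δ < 0 := div_neg_of_neg_of_pos hq hp
  have hδe : δ - 1 = -((lam - 1) / (2 - lam)) := by rw [hδ]; field_simp; ring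
  set d := -δ with hd
  have hd0 : 0 < d := by linarith
  set β := (3 - 2 * lam)⁻¹ with hβ
  have hβ0 : β < 0 := inv_lt_zero.2 hq
  have hδβ : δ * β = 1 / (2 - lam) := by
    rw [hδ, hβ, div_mul_eq_mul_div, mul_inv_cancel₀ hq.ne]
  -- As β < 0, the upper constant `A₂` enters the lower bound and vice versa. The estimate at σ = 0
  -- gives t* ≥ 1/(d A₂); half of that is a `t₀` that does not depend on the data beyond the three
  -- moments.
  refine ⟨B₁ * (d * A₂) ^ β, B₂ * (d * A₁) ^ β, 1 / (2 * (d * A₂)), by positivity, by positivity,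
    by positivity, fun c₀ hc₀ h1 h0 hl => ?_⟩
  obtain ⟨U, hU, hb⟩ := hdata c₀ hc₀ h1 h0 hl
  have hx : 0 < edgMoment 1 c₀ := h1 ▸ hρ
  have hΓm := hU.strictMono_elapsedTime hlam0 hlam2 hx
  have hΓ0 : elapsedTime lam U 0 = 0 := by simp [elapsedTime]
  have hΓ : ∀ σ σ', 0 ≤ σ → σ ≤ σ' →
      d * A₁ * (elapsedTime lam U σ' - elapsedTime lam U σ) ≤ (1 + σ) ^ δ - (1 + σ') ^ δ ∧
      (1 + σ) ^ δ - (1 + σ') ^ δ ≤ d * A₂ * (elapsedTime lam U σ' - elapsedTime lam U σ) := by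
    intro σ σ' hσ hσσ'
    have := hU.elapsedTime_bounds hlam0 hlam2 hx (fun σ hσ => (hb σ hσ).1)
      (P := fun s => (1 + s) ^ δ / δ)
      (fun s hs => by rw [← hδe]; exact hasDerivAt_one_add_rpow_div hδ0.ne hs) hσ hσσ'
    rw [show (1 + σ') ^ δ / δ - (1 + σ) ^ δ / δ = ((1 + σ) ^ δ - (1 + σ') ^ δ) / d by
      rw [hd, div_neg, sub_div]; ring, le_div_iff₀ hd0, div_le_iff₀ hd0] at this
    constructor <;> linarith [this.1, this.2]
  have hbdd : BddAbove (range (elapsedTime lam U)) := by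
    refine ⟨1 / (d * A₁), ?_⟩
    rintro _ ⟨σ, rfl⟩
    refine (hΓm.monotone (le_max_left σ 0)).trans ?_
    have h2 := (hΓ 0 (max σ 0) le_rfl (le_max_right _ _)).1
    have h3 : 0 < (1 + max σ 0) ^ δ := by
      have := le_max_right σ 0
      positivity
    rw [hΓ0, sub_zero, add_zero, Real.one_rpow] at h2
    rw [le_div_iff₀ (by positivity)]
    linarith
  set tstar := ⨆ σ, elapsedTime lam U σ with htstar
  have hlim : Tendsto (elapsedTime lam U) atTop (𝓝 tstar) :=
    tendsto_atTop_ciSup hΓm.monotone hbdd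
  have hQlim : Tendsto (fun s : ℝ => (1 + s) ^ δ) atTop (𝓝 0) := by
    have := (tendsto_rpow_neg_atTop hd0).comp (tendsto_atTop_add_const_left atTop (1 : ℝ) tendsto_id)
    rw [hd, neg_neg] at this
    exact this
  -- Letting the upper endpoint tend to infinity in the two-point comparison leaves only the time
  -- remaining until blow-up.
  have hstar : ∀ σ, 0 ≤ σ → d * A₁ * (tstar - elapsedTime lam U σ) ≤ (1 + σ) ^ δ ∧
      (1 + σ) ^ δ ≤ d * A₂ * (tstar - elapsedTime lam U σ) := by
    intro σ hσ
    have l1 := (hlim.sub_const (elapsedTime lam U σ)).const_mul (d * A₁)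
    have l2 := hQlim.const_sub ((1 + σ) ^ δ)
    have l3 := (hlim.sub_const (elapsedTime lam U σ)).const_mul (d * A₂)
    rw [sub_zero] at l2
    exact ⟨le_of_tendsto_of_tendsto l1 l2 (by
        filter_upwards [eventually_ge_atTop σ] with s hs using (hΓ σ s hσ hs).1),
      le_of_tendsto_of_tendsto l2 l3 (by
        filter_upwards [eventually_ge_atTop σ] with s hs using (hΓ σ s hσ hs).2)⟩
  have hT : ∀ t : ℝ, (t : EReal) < (tstar : EReal) ↔ ∃ σ, t < elapsedTime lam U σ := fun t => by
    rw [EReal.coe_lt_coe_iff]; exact lt_ciSup_iff hbdd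
  have ht0 : 1 / (2 * (d * A₂)) < tstar := by
    have := (hstar 0 le_rfl).2
    rw [hΓ0, sub_zero, add_zero, Real.one_rpow] at this
    rw [div_lt_iff₀ (by positivity)]
    linarith
  obtain ⟨c', hc'⟩ := hU.exists_solution hlam0 hlam2 hx hT
  refine ⟨tstar, ht0, ⟨c', hc'⟩, fun T c hc => ?_, fun c hc t htt ht => ?_⟩
  · have hle := hU.solution_le hlam0 hlam2 hx hT hc
    exact ⟨hle, c', hc', fun t h0 ht =>
      hU.solution_unique hlam0 hlam2 hx hc' hc h0 (ht.trans_le hle) ht⟩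
  · have htpos : 0 < t := lt_of_lt_of_le (by positivity) htt
    obtain ⟨σ, hσ, hσt, he⟩ := hU.solution_eq hlam0 hlam2 hx hc htpos.le
      (EReal.coe_lt_coe_iff.2 ht)
    rw [avgClusterSize_congr he]
    obtain ⟨-, hℓ1, hℓ2⟩ := hb σ hσ
    obtain ⟨k1, k2⟩ := hstar σ hσ
    rw [hσt] at k1 k2
    have hs : 0 < tstar - t := by linarith
    have hσα : (1 + σ) ^ (1 / (2 - lam)) = ((1 + σ) ^ δ) ^ β := by
      rw [← Real.rpow_mul (by positivity), hδβ]
    rw [hσα] at hℓ1 hℓ2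
    constructor
    · refine le_trans ?_ hℓ1
      rw [mul_assoc, ← Real.mul_rpow (by positivity) hs.le]
      exact mul_le_mul_of_nonneg_left
        (Real.rpow_le_rpow_of_nonpos (by positivity) k2 hβ0.le) hB₁.le
    · refine hℓ2.trans ?_
      rw [mul_assoc, ← Real.mul_rpow (by positivity) hs.le]
      exact mul_le_mul_of_nonneg_left
        (Real.rpow_le_rpow_of_nonpos (by positivity) k1 hβ0.le) hB₂.le

theorem theorem1 (lam ρ m₀ m : ℝ) (hlam0 : 0 ≤ lam) (hlam2 : lam < 2) (hρ : 0 < ρ) :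
    -- algebraic coarsening
    (lam < 3 / 2 →
      ∃ C₁ C₂ t₀ : ℝ, 0 < C₁ ∧ 0 < C₂ ∧ 0 < t₀ ∧
        ∀ c₀ : ℕ → ℝ, MemEDGCone (max 1 lam) c₀ → edgMoment 1 c₀ = ρ →
          edgMoment 0 c₀ = m₀ → edgMoment lam c₀ = m →
          (∃ c, IsEDGSolution lam c₀ ⊤ c) ∧
          (∀ (T : EReal) (c : ℝ → ℕ → ℝ), IsEDGSolution lam c₀ T c →
            ∃ c' : ℝ → ℕ → ℝ, IsEDGSolution lam c₀ ⊤ c' ∧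
              ∀ t : ℝ, 0 ≤ t → (t : EReal) < T → c' t = c t) ∧
          (∀ c : ℝ → ℕ → ℝ, IsEDGSolution lam c₀ ⊤ c → ∀ t : ℝ, t₀ ≤ t →
            C₁ * t ^ (3 - 2 * lam)⁻¹ ≤ avgClusterSize (c t) ∧
            avgClusterSize (c t) ≤ C₂ * t ^ (3 - 2 * lam)⁻¹)) ∧
    -- exponential coarsening
    (lam = 3 / 2 →
      ∃ C₁ C₂ K₁ K₂ t₀ : ℝ, 0 < C₁ ∧ 0 < C₂ ∧ 0 < K₁ ∧ 0 < K₂ ∧ 0 < t₀ ∧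
        ∀ c₀ : ℕ → ℝ, MemEDGCone (max 1 lam) c₀ → edgMoment 1 c₀ = ρ →
          edgMoment 0 c₀ = m₀ → edgMoment lam c₀ = m →
          (∃ c, IsEDGSolution lam c₀ ⊤ c) ∧
          (∀ (T : EReal) (c : ℝ → ℕ → ℝ), IsEDGSolution lam c₀ T c →
            ∃ c' : ℝ → ℕ → ℝ, IsEDGSolution lam c₀ ⊤ c' ∧
              ∀ t : ℝ, 0 ≤ t → (t : EReal) < T → c' t = c t) ∧
          (∀ c : ℝ → ℕ → ℝ, IsEDGSolution lam c₀ ⊤ c → ∀ t : ℝ, t₀ ≤ t →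
            K₁ * Real.exp (C₁ * t) ≤ avgClusterSize (c t) ∧
            avgClusterSize (c t) ≤ K₂ * Real.exp (C₂ * t))) ∧
    -- blow-up in finite time
    (3 / 2 < lam →
      ∃ C₁ C₂ t₀ : ℝ, 0 < C₁ ∧ 0 < C₂ ∧ 0 < t₀ ∧
        ∀ c₀ : ℕ → ℝ, MemEDGCone (max 1 lam) c₀ → edgMoment 1 c₀ = ρ →
          edgMoment 0 c₀ = m₀ → edgMoment lam c₀ = m →
          ∃ tstar : ℝ, t₀ < tstar ∧
            (∃ c, IsEDGSolution lam c₀ tstar c) ∧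
            (∀ (T : EReal) (c : ℝ → ℕ → ℝ), IsEDGSolution lam c₀ T c →
              T ≤ tstar ∧
              ∃ c' : ℝ → ℕ → ℝ, IsEDGSolution lam c₀ tstar c' ∧
                ∀ t : ℝ, 0 ≤ t → (t : EReal) < T → c' t = c t) ∧
            (∀ c : ℝ → ℕ → ℝ, IsEDGSolution lam c₀ tstar c → ∀ t : ℝ, t₀ ≤ t → t < tstar →
              C₁ * (tstar - t) ^ (3 - 2 * lam)⁻¹ ≤ avgClusterSize (c t) ∧
              avgClusterSize (c t) ≤ C₂ * (tstar - t) ^ (3 - 2 * lam)⁻¹)) := by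
  exact ⟨fun h => algebraic_coarsening m₀ m hlam0 h hρ, fun h => exponential_coarsening m₀ m h hρ,
    fun h => finite_time_blowup m₀ m h hlam2 hρ⟩
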